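/- **Theorem (phase space of the Ince-XXVI system).** Let $B\subset\mathbb C$ be a connected, non-empty open set, let $q$ be a holomorphic function on $B$, and consider the system $$x'=xy-12q'(t),\qquad y'=-\tfrac14y^2+3x+12q(t)\qquad (t\in B).$$ (1) Embed $\mathbb C^2\ni(x,y)=(z_1/z_0,z_2/z_0)$ in $\mathbb P^2$. For each $t\in B$, blow up $\mathbb P^2$ successively at the ten points which are the origins $u=v=0$ of the following coordinate systems $(u,v)$ (each of them a point of the surface obtained so far; $q,q',q'',q'''$ are evaluated at $t$): $$\Bigl(\tfrac1x,\tfrac yx\Bigr),\ \Bigl(\tfrac yx,\tfrac1y\Bigr),\ \Bigl(\tfrac x{y^2}-\tfrac14,\tfrac1y\Bigr),\ \Bigl(\tfrac{x-y^2/4}{y},\tfrac1y\Bigr),\ \Bigl(x-\tfrac{y^2}4+12q,\tfrac1y\Bigr),$$ $$\Bigl(\tfrac xy,\tfrac1y\Bigr),\ \Bigl(x,\tfrac1y\Bigr),\ \Bigl(xy-16q',\tfrac1y\Bigr),\ \Bigl((xy-16q')y-32q'',\tfrac1y\Bigr),\ \Bigl(((xy-16q')y-32q'')y+768qq'-128q''',\tfrac1y\Bigr).$$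 The resulting rational surface $\mathcal X_t$ is of type $E_8^{(1)}$: the proper transforms of the line at infinity, of the exceptional curves of the blow-ups number $1,2,3,4$ and of those of the blow-ups number $6,7,8,9$ are nine distinct smooth rational curves of self-intersection $-2$, whose pairwise intersection numbers are given by the Dynkin diagram of type $E_8^{(1)}$. (2) The phase space, i.e. the family over $B$ of the surfaces $\mathcal X_t$ without these nine curves, is obtained by gluing three copies $U_j\times B=\mathbb C^2\times B\ni(x_j,y_j,t)$, $j=0,1,2$, along the sets where $y$ is finite and non-zero, via the birational transformations $$\begin{aligned}&x_0=x,\quad y_0=y;\\ &x_1=\Bigl(x-\tfrac{y^2}4+12q(t)\Bigr)y,\quad y_1=\tfrac1y;\\ &x_2=\bigl(((xy-16q'(t))y-32q''(t))y+768q(t)q'(t)-128q'''(t)\bigr)y,\quad y_2=\tfrac1y.\end{aligned}$$ That is, the glued space is a Hausdorff complex manifold with the three open charts $U_j\times B$ and holomorphic coordinate changes, and its points correspond bijectively to those of the phase space, the point $(x_j,y_j,t)=(a,b,t)$ of $U_j\times B$ corresponding to the point of $\mathcal X_t$ with coordinates $x_j=a$, $y_j=b$. (3) In the charts $j=0,1$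 the transformed system is polynomial in $(x_j,y_j)$, with coefficients holomorphic on $B$. In the chart $j=2$ it is polynomial in $(x_2,y_2)$, with coefficients holomorphic on $B$, if and only if there are constants $C_1,C_2\in\mathbb C$ with $$q''(t)=6q(t)^2+C_1t+C_2\qquad\text{for all }t\in B.$$ -/

import Mathlib

namespace InceXXVI

noncomputable section

/-! ### Points, curves and blow-ups inside the function field `ℂ(x, y)`

A smooth rational surface with function field `K = ℂ(x, y)` is described, in the classical manner of
Zariski, by the set of the local rings of its (closed) points, which are subrings of `K`; an
irreducible curve on it is described by the local ring of its generic point. Charts glued by a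
birational transformation have a local ring in common exactly where they are glued, and a curve
and its proper transform under a blow-up have the same generic local ring. -/

/-- The field `K = ℂ(x, y)`. -/
abbrev K : Type := FractionRing (MvPolynomial (Fin 2) ℂ)

/-- The coordinate function `x`. -/
def xK : K := algebraMap (MvPolynomial (Fin 2) ℂ) K (MvPolynomial.X 0)

/-- The coordinate function `y`. -/
def yK : K := algebraMap (MvPolynomial (Fin 2) ℂ) K (MvPolynomial.X 1)

/-- All fractions `P(u, v) / Q(u, v)` with `φ Q ≠ 0`: the localization of `ℂ[u, v]` at the prime
ideal `ker φ`. -/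
def fractionsAway (u v : K) {A : Type} [CommRing A] [IsDomain A] [Algebra ℂ A]
    (φ : MvPolynomial (Fin 2) ℂ →ₐ[ℂ] A) : Subring K where
  carrier := {z | ∃ P Q : MvPolynomial (Fin 2) ℂ, φ Q ≠ 0 ∧
    MvPolynomial.aeval ![u, v] Q ≠ (0 : K) ∧
    z = MvPolynomial.aeval ![u, v] P / MvPolynomial.aeval ![u, v] Q}
  mul_mem' := by
    rintro _ _ ⟨P, Q, h1, h2, rfl⟩ ⟨P', Q', h1', h2', rfl⟩
    refine ⟨P * P', Q * Q', ?_, ?_, ?_⟩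
    · rw [map_mul]; exact mul_ne_zero h1 h1'
    · rw [map_mul]; exact mul_ne_zero h2 h2'
    · rw [map_mul, map_mul, div_mul_div_comm]
  one_mem' := ⟨1, 1, by simp, by simp, by simp⟩
  add_mem' := by
    rintro _ _ ⟨P, Q, h1, h2, rfl⟩ ⟨P', Q', h1', h2', rfl⟩
    refine ⟨P * Q' + Q * P', Q * Q', ?_, ?_, ?_⟩
    · rw [map_mul]; exact mul_ne_zero h1 h1'
    · rw [map_mul]; exact mul_ne_zero h2 h2'
    · rw [map_add, map_mul, map_mul, map_mul, div_add_div _ _ h2 h2']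
  zero_mem' := ⟨0, 1, by simp, by simp, by simp⟩
  neg_mem' := by
    rintro _ ⟨P, Q, h1, h2, rfl⟩
    refine ⟨-P, Q, h1, h2, ?_⟩
    rw [map_neg, div_eq_mul_inv, div_eq_mul_inv]; exact (neg_mul _ _).symm

/-- The local ring of the point `(u, v) = (a, b)` of the affine plane with coordinates `u`, `v`. -/
def pointRing (u v : K) (a b : ℂ) : Subring K :=
  fractionsAway u v (MvPolynomial.aeval ![a, b])

/-- The local ring of the generic point of the line `v = 0` in the affine plane with coordinates
`u`, `v`. -/
def lineRing (u v : K) : Subring K :=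
  fractionsAway u v
    (MvPolynomial.aeval ![(Polynomial.X : Polynomial ℂ), (0 : Polynomial ℂ)])

/-- The points of the affine plane with coordinates `u`, `v`. -/
def affinePlane (u v : K) : Set (Subring K) := {R | ∃ a b : ℂ, R = pointRing u v a b}

/-- The projective plane, with `(x, y) = (z₁/z₀, z₂/z₀)`, covered by its three affine planes. -/
def projectivePlane : Set (Subring K) :=
  affinePlane xK yK ∪ affinePlane (1 / xK) (yK / xK) ∪ affinePlane (xK / yK) (1 / yK)

/-- The blow-up of `S` at the point `u = v = 0`, where `u`, `v` are coordinates of an affine plane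
containing that point: the point is replaced by its exceptional curve, which is covered by the
charts `(u / v, v)` and `(u, v / u)`. -/
def blowUp (S : Set (Subring K)) (u v : K) : Set (Subring K) :=
  (S \ {pointRing u v 0 0}) ∪ {R | ∃ c : ℂ, R = pointRing (u / v) v c 0} ∪ {pointRing u (v / u) 0 0}

/-- The exceptional curve of the blow-up at `u = v = 0`. -/
def exceptionalCurve (u v : K) : Subring K := lineRing (u / v) v

/-! ### Curves on a surface and their intersection numbers -/

/-- The maximal ideal of the local ring of a point. -/
def pointIdeal (R : Subring K) : Ideal R := Ideal.span {a : R | ¬ IsUnit a}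

open Classical in
/-- The ideal, in the local ring of a point, of the curve with generic local ring `C`
(the unit ideal if the curve does not pass through the point). -/
def curveIdeal (R C : Subring K) : Ideal R :=
  if R ≤ C then Ideal.span {a : R | (a : K) = 0 ∨ (a : K)⁻¹ ∉ C} else ⊤

/-- `C` is the generic local ring of a curve on `S`: at each point of `S` on it, it is the
localization of the local ring of the point at a prime ideal that is neither zero nor maximal. -/
def IsCurveOn (S : Set (Subring K)) (C : Subring K) : Prop :=
  (∃ R ∈ S, R ≤ C) ∧
  ∀ R ∈ S, R ≤ C → curveIdeal R C ≠ ⊥ ∧ curveIdeal R C ≠ pointIdeal R ∧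
    ∀ z ∈ C, ∃ a b : R, b ∉ curveIdeal R C ∧ z * (b : K) = (a : K)

/-- The curve is regular at each of its points: the maximal ideal of `R ⧸ curveIdeal R C` is
principal. -/
def IsSmoothCurve (S : Set (Subring K)) (C : Subring K) : Prop :=
  ∀ R ∈ S, R ≤ C → ∃ w : R, pointIdeal R = curveIdeal R C ⊔ Ideal.span {w}

/-- The residue field of `C`, that is, the function field of the curve, is a field `ℂ(s)` of
rational functions of one variable. -/
def IsRationalCurve (C : Subring K) : Prop :=
  ∃ s ∈ C,
    (∀ Q : Polynomial ℂ, Q ≠ 0 → Polynomial.aeval s Q ≠ 0 ∧ (Polynomial.aeval s Q)⁻¹ ∈ C) ∧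
    ∀ z ∈ C, ∃ P Q : Polynomial ℂ, Q ≠ 0 ∧
      (z - Polynomial.aeval s P / Polynomial.aeval s Q = 0 ∨
        (z - Polynomial.aeval s P / Polynomial.aeval s Q)⁻¹ ∉ C)

/-- `n` is the intersection number of the curves `C` and `C'` on `S` (self-intersection number if
`C' = C`): the degree on `C` of the line bundle `𝒪(C')|_C`. In detail, `g R` is a local equation of
`C'` at the point `R` of `C`, the nonzero rational function `f` is such that the divisor
`C' - div f`, with local equations `g R / f`, does not contain `C`, and the order at `R` of the
restriction of `g R / f = a R / b R` to `C` is the difference of the orders of vanishing of `a R`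
and `b R` on `C`. (For `C' ≠ C` one may take `f = 1`, and `n` is the sum of the lengths of
`R ⧸ (curveIdeal R C + curveIdeal R C')`.) -/
def HasIntersectionNumber (S : Set (Subring K)) (C C' : Subring K) (n : ℤ) : Prop :=
  ∃ (f : K) (g a b : (R : Subring K) → R), f ≠ 0 ∧
    (∀ R ∈ S, R ≤ C →
      Ideal.span {g R} = curveIdeal R C' ∧
      a R ∉ curveIdeal R C ∧ b R ∉ curveIdeal R C ∧
      (g R : K) * (b R : K) = f * (a R : K)) ∧
    n = ∑ᶠ (R : Subring K) (_ : R ∈ S ∧ R ≤ C),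
      (((Module.length R (R ⧸ (curveIdeal R C ⊔ Ideal.span {a R}))).toNat : ℤ) -
        ((Module.length R (R ⧸ (curveIdeal R C ⊔ Ideal.span {b R}))).toNat : ℤ))

/-- The generalized Cartan matrix of the affine root system `E₈⁽¹⁾`: the Dynkin diagram is the
chain `0 - 1 - 2 - 3 - 4 - 5 - 6 - 7` with one more node `8` attached to the node `5`. -/
def affineE8 : Matrix (Fin 9) (Fin 9) ℤ :=
  !![ 2, -1,  0,  0,  0,  0,  0,  0,  0;
     -1,  2, -1,  0,  0,  0,  0,  0,  0;
      0, -1,  2, -1,  0,  0,  0,  0,  0;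
      0,  0, -1,  2, -1,  0,  0,  0,  0;
      0,  0,  0, -1,  2, -1,  0,  0,  0;
      0,  0,  0,  0, -1,  2, -1,  0, -1;
      0,  0,  0,  0,  0, -1,  2, -1,  0;
      0,  0,  0,  0,  0,  0, -1,  2,  0;
      0,  0,  0,  0,  0, -1,  0,  0,  2]

/-- The curves `D 0, …, D 8` on `S` are distinct smooth rational curves with `D i · D i = -2` whose
intersection graph is the Dynkin diagram of type `E₈⁽¹⁾`. -/
def IsE8AffineConfiguration (S : Set (Subring K)) (D : Fin 9 → Subring K) : Prop :=
  Function.Injective D ∧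
  (∀ i, IsCurveOn S (D i) ∧ IsSmoothCurve S (D i) ∧ IsRationalCurve (D i)) ∧
  ∀ i j, HasIntersectionNumber S (D i) (D j) (-(affineE8 i j))

/-! ### The system and its charts -/

/-- The birational transformations `(x, y) ↦ (x_j, y_j)`, `j = 0, 1, 2`, over a field `F`;
`q k` is the value of the `k`-th derivative of `q`. -/
def chartMap {F : Type} [Field F] (q : ℕ → F) (j : Fin 3) (x y : F) : F × F :=
  ![(x, y),
    ((x - y ^ 2 / 4 + 12 * q 0) * y, 1 / y),
    ((((x * y - 16 * q 1) * y - 32 * q 2) * y + 768 * q 0 * q 1 - 128 * q 3) * y, 1 / y)] j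

/-- The derivatives of `q` at `t`. -/
def jet (q : ℂ → ℂ) (t : ℂ) (k : ℕ) : ℂ := iteratedDeriv k q t

/-- The derivatives of `q` at `t`, as constants of `K`. -/
def jetK (q : ℂ → ℂ) (t : ℂ) (k : ℕ) : K := algebraMap ℂ K (jet q t k)

/-- The coordinate functions `(x_j, y_j) ∈ K × K` of the `j`-th chart at time `t`. -/
def chartFunctions (q : ℂ → ℂ) (t : ℂ) (j : Fin 3) : K × K := chartMap (jetK q t) j xK yK

/-- The `j`-th chart in all three variables. -/
def chartMapTime (q : ℂ → ℂ) (j : Fin 3) (p : ℂ × ℂ × ℂ) : ℂ × ℂ :=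
  chartMap (jet q p.2.2) j p.1 p.2.1

/-- The vector field `∂/∂t + (x y - 12 q') ∂/∂x + (-y²/4 + 3 x + 12 q) ∂/∂y` in the variables
`(x, y, t)`. -/
def systemField (q : ℂ → ℂ) (p : ℂ × ℂ × ℂ) : ℂ × ℂ × ℂ :=
  (p.1 * p.2.1 - 12 * deriv q p.2.2, -(1 / 4) * p.2.1 ^ 2 + 3 * p.1 + 12 * q p.2.2, 1)

/-- In the coordinates `(x_j, y_j)`, the system reads `x_j' = P(x_j, y_j)`, `y_j' = Q(x_j, y_j)`
where `P`, `Q` are polynomials in `x_j`, `y_j` whose coefficients are holomorphic functions of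
`t ∈ B`. (The charts have the domain `y ≠ 0` in common.) -/
def IsPolynomialInChart (B : Set ℂ) (q : ℂ → ℂ) (j : Fin 3) : Prop :=
  ∃ P Q : MvPolynomial (Fin 2) (ℂ → ℂ),
    (∀ m, AnalyticOnNhd ℂ (P.coeff m) B ∧ AnalyticOnNhd ℂ (Q.coeff m) B) ∧
    ∀ x y t : ℂ, y ≠ 0 → t ∈ B →
      fderiv ℂ (chartMapTime q j) (x, y, t) (systemField q (x, y, t)) =
        (MvPolynomial.eval ![(chartMapTime q j (x, y, t)).1, (chartMapTime q j (x, y, t)).2]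
            (MvPolynomial.map (Pi.evalRingHom (fun _ : ℂ => ℂ) t) P),
          MvPolynomial.eval ![(chartMapTime q j (x, y, t)).1, (chartMapTime q j (x, y, t)).2]
            (MvPolynomial.map (Pi.evalRingHom (fun _ : ℂ => ℂ) t) Q))

/-! ### The blown-up surface -/

/-- Coordinates centered at the points that are successively blown up, at time `t`: five times over
`P₁ = {1/x = y/x = 0}`, then five times over `P₂ = {x/y = 1/y = 0}`. -/
def center (q : ℂ → ℂ) (t : ℂ) : Fin 10 → K × K :=
  ![(1 / xK, yK / xK),
    (yK / xK, 1 / yK),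
    (xK / yK ^ 2 - 1 / 4, 1 / yK),
    ((xK - yK ^ 2 / 4) / yK, 1 / yK),
    (xK - yK ^ 2 / 4 + 12 * jetK q t 0, 1 / yK),
    (xK / yK, 1 / yK),
    (xK, 1 / yK),
    (xK * yK - 16 * jetK q t 1, 1 / yK),
    ((xK * yK - 16 * jetK q t 1) * yK - 32 * jetK q t 2, 1 / yK),
    (((xK * yK - 16 * jetK q t 1) * yK - 32 * jetK q t 2) * yK
      + 768 * jetK q t 0 * jetK q t 1 - 128 * jetK q t 3, 1 / yK)]

/-- The surface after the first `n` blow-ups of the projective plane. -/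
def stage (q : ℂ → ℂ) (t : ℂ) (n : ℕ) : Set (Subring K) :=
  ((List.ofFn (center q t)).take n).foldl (fun S c => blowUp S c.1 c.2) projectivePlane

/-- The surface after all ten blow-ups. -/
def surface (q : ℂ → ℂ) (t : ℂ) : Set (Subring K) := stage q t 10

/-- The line at infinity of the projective plane, and the exceptional curves of the first four
blow-ups over each of `P₂` and `P₁` (numbered as the nodes of the Dynkin diagram). -/
def boundaryCurve (q : ℂ → ℂ) (t : ℂ) : Fin 9 → Subring K :=
  ![exceptionalCurve (center q t 8).1 (center q t 8).2,
    exceptionalCurve (center q t 7).1 (center q t 7).2,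
    exceptionalCurve (center q t 6).1 (center q t 6).2,
    exceptionalCurve (center q t 5).1 (center q t 5).2,
    lineRing (xK / yK) (1 / yK),
    exceptionalCurve (center q t 1).1 (center q t 1).2,
    exceptionalCurve (center q t 2).1 (center q t 2).2,
    exceptionalCurve (center q t 3).1 (center q t 3).2,
    exceptionalCurve (center q t 0).1 (center q t 0).2]

/-! ### The phase space -/

/-- The point of `U_i × B` and the point of `U_j × B` have the same time and correspond to each other
under the birational transformations. -/
def glueRel (B : Set ℂ) (q : ℂ → ℂ) (p p' : Fin 3 × (ℂ × ℂ × B)) : Prop :=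
  p.2.2.2 = p'.2.2.2 ∧ ∃ x y : ℂ, y ≠ 0 ∧
    (p.2.1, p.2.2.1) = chartMap (jet q p.2.2.2) p.1 x y ∧
    (p'.2.1, p'.2.2.1) = chartMap (jet q p'.2.2.2) p'.1 x y

/-- The space glued from three copies of `ℂ² × B`, with the quotient topology. -/
abbrev GluedSpace (B : Set ℂ) (q : ℂ → ℂ) : Type := Quot (glueRel B q)

/-- The inclusion of the `j`-th chart `U_j × B` into the glued space. -/
def chartIncl (B : Set ℂ) (q : ℂ → ℂ) (j : Fin 3) (p : ℂ × ℂ × B) : GluedSpace B q :=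
  Quot.mk (glueRel B q) (j, p)

/-- The glued space is a Hausdorff complex manifold with the three charts `U_j × B`. -/
def IsManifoldGluing (B : Set ℂ) (q : ℂ → ℂ) : Prop :=
  T2Space (GluedSpace B q) ∧
  (∀ j, Topology.IsOpenEmbedding (chartIncl B q j)) ∧
  ∀ i j, ∃ τ : ℂ × ℂ × ℂ → ℂ × ℂ, ∀ (a b a' b' : ℂ) (t t' : B),
    chartIncl B q i (a, b, t) = chartIncl B q j (a', b', t') →
      t = t' ∧ AnalyticAt ℂ τ (a, b, (t : ℂ)) ∧ τ (a, b, (t : ℂ)) = (a', b')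

/-- The phase space: the family over `B` of the surfaces at the times `t`, each without the nine
boundary curves. -/
def PhaseSpace (B : Set ℂ) (q : ℂ → ℂ) : Type :=
  {p : B × Subring K // p.2 ∈ surface q p.1 ∧ ∀ i, ¬ p.2 ≤ boundaryCurve q p.1 i}

end

end InceXXVI

/-! Points and curves are local rings inside K, so the geometry reduces to evaluating functions. A
local ℂ-algebra contains `pointRing u v a b` as soon as u and v take the values a and b at it, and
contains `lineRing u v` as soon as u is regular and non-constant there and v vanishes
(`pointRing_le`, `lineRing_le`). Two local rings given in different coordinates therefore agree once
each pair of coordinates has been evaluated at the other ring. Conversely, R is not below C if some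
function regular at R has a pole along C.

(1) The lines y = const are those through the first center, and after the first blow-up they are the
fibres of a ruling with section x = ∞. Everything else happens in the fibre y = ∞. After the second
blow-up, contracting the line at infinity would give the Hirzebruch surface F₂ with coordinates
x/y², 1/y near that fibre. On F₂ the centers form two branches, starting at x/y² = 0 and at x/y² =
1/4. Both are governed by w₀ = x/y², w_{n+1} = (w_n - c_n) y with constants c_n (`chain`,
`center_eq`), and the line at infinity plays the role of the component with coordinate w₁ on the
first branch. Each later center lies on only one fibre component, so 1/y vanishes to first order on
every component, and the fibre becomes a reduced chain of ten curves A₆, …, A₁, A₀, B₁, B₂, B₃. A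
fibre has intersection number 0 with each of its components, so an inner component, meeting two
others transversally, has self-intersection -2. For the section the function x⁻¹y(y - 1) gives -2.
The section meets A₀, which completes the diagram. All this rests on the complete list of the points
of the surface (`surface_cases`).

(2) Without the nine curves there remain the affine plane and the curves A₆ and B₃ minus their
corners. The latter are the lines y₂ = 0 and y₁ = 0 in the charts 2 and 1, whence the bijection. In
the glued space the only delicate pairs of points for the Hausdorff property are separated by y
(chart 0 against the others) or by x/y², which tends to 1/4 in chart 1 and to 0 in chart 2.

(3) The chain rule expresses the system in each chart. Charts 0 and 1 give polynomials; in chart 2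
the derivative of x₂ is a polynomial minus 128 (q'' - 6q²)''/y₂ (`fderiv_chartMapTime_two`). It is
polynomial exactly when q'' - 6q² has vanishing second derivative, i.e. is affine in t on the
connected set B. -/

namespace InceXXVI

/-! ### Values of functions at local rings. -/

/-- `z` is a non-unit of the subring `C` of `K`. -/
def Small (C : Subring K) (z : K) : Prop := z ∈ C ∧ (z = 0 ∨ z⁻¹ ∉ C)

/-- `C` is a local `ℂ`-algebra. -/
def IsLocalAlgebra (C : Subring K) : Prop :=
  (∀ c : ℂ, algebraMap ℂ K c ∈ C) ∧ ∀ z w, Small C z → Small C w → Small C (z + w)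

/-- The function `z` takes the value `c` at the point or the generic point with local ring `C`. -/
def HasValue (C : Subring K) (z : K) (c : ℂ) : Prop := Small C (z - algebraMap ℂ K c)

/-- The function `z` is regular and not a constant on the curve with generic local ring `C`. -/
def IsGeneric (C : Subring K) (z : K) : Prop := z ∈ C ∧ ∀ c, ¬ HasValue C z c

/-- `u`, `v` generate `K`. -/
def Coord (u v : K) : Prop := IntermediateField.adjoin ℂ {u, v} = ⊤

section Small

variable {C : Subring K} {z w : K}

theorem Small.mul_right (h : Small C z) (hw : w ∈ C) : Small C (z * w) := by
  refine ⟨C.mul_mem h.1 hw, ?_⟩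
  by_cases hz : z = 0
  · simp [hz]
  by_cases hw0 : w = 0
  · simp [hw0]
  refine Or.inr fun hi => (h.2.resolve_left hz) ?_
  have := C.mul_mem hw hi
  rwa [mul_inv, mul_comm z⁻¹, ← mul_assoc, mul_inv_cancel₀ hw0, one_mul] at this

theorem Small.mul_left (h : Small C z) (hw : w ∈ C) : Small C (w * z) :=
  mul_comm z w ▸ h.mul_right hw

theorem small_zero : Small C 0 := ⟨C.zero_mem, Or.inl rfl⟩

theorem not_small_of_inv_mem (h0 : z ≠ 0) (hi : z⁻¹ ∈ C) : ¬ Small C z :=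
  fun h => h.2.elim h0 fun h' => h' hi

theorem Small.inv_notMem (h : Small C z) (h0 : z ≠ 0) : z⁻¹ ∉ C := h.2.resolve_left h0

theorem inv_mem_of_not_small (h : z ∈ C) (hs : ¬ Small C z) : z⁻¹ ∈ C := by
  by_contra hi
  exact hs ⟨h, Or.inr hi⟩

theorem ne_zero_of_not_small (hs : ¬ Small C z) : z ≠ 0 := by
  rintro rfl
  exact hs small_zero

theorem Small.notMem_of_inv (h : Small C z⁻¹) (h0 : z ≠ 0) : z ∉ C := by
  have := h.inv_notMem (inv_ne_zero h0)
  rwa [inv_inv] at this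

theorem not_le_of_small_inv {R : Subring K} (hz : z ∈ R) (h0 : z ≠ 0) (h : Small C z⁻¹) :
    ¬ R ≤ C :=
  fun hle => h.notMem_of_inv h0 (hle hz)

theorem small_mul_iff_of_unit (hw : w ∈ C) (hw0 : w ≠ 0) (hwi : w⁻¹ ∈ C) :
    Small C (z * w) ↔ Small C z :=
  ⟨fun h => by simpa [mul_assoc, hw0] using h.mul_right hwi, fun h => h.mul_right hw⟩

end Small

section HasValue

variable {C : Subring K} (hC : IsLocalAlgebra C) {z w : K} {a b : ℂ}

include hC

omit hC in
theorem small_neg (h : Small C z) : Small C (-z) := by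
  have := h.mul_right (C.neg_mem C.one_mem)
  rwa [mul_neg_one] at this

theorem IsLocalAlgebra.small_sub (h : Small C z) (h' : Small C w) : Small C (z - w) := by
  rw [sub_eq_add_neg]
  exact hC.2 _ _ h (small_neg h')

theorem IsLocalAlgebra.not_small_const {c : ℂ} (hc : c ≠ 0) : ¬ Small C (algebraMap ℂ K c) :=
  not_small_of_inv_mem (by simpa using hc) (by rw [← map_inv₀]; exact hC.1 _)

omit hC in
theorem hasValue_const (c : ℂ) : HasValue C (algebraMap ℂ K c) c := by
  unfold HasValue
  rw [sub_self]
  exact small_zero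

omit hC in
theorem hasValue_zero_iff : HasValue C z 0 ↔ Small C z := by simp [HasValue]

theorem HasValue.mem (h : HasValue C z a) : z ∈ C := by
  have := C.add_mem h.1 (hC.1 a)
  rwa [sub_add_cancel] at this

theorem HasValue.add (h : HasValue C z a) (h' : HasValue C w b) : HasValue C (z + w) (a + b) := by
  have := hC.2 _ _ h h'
  unfold HasValue
  convert this using 1
  rw [map_add]; ring

theorem HasValue.sub (h : HasValue C z a) (h' : HasValue C w b) : HasValue C (z - w) (a - b) := by
  have := hC.small_sub h h'
  unfold HasValue
  convert this using 1
  rw [map_sub]; ring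

theorem HasValue.mul (h : HasValue C z a) (h' : HasValue C w b) : HasValue C (z * w) (a * b) := by
  have := hC.2 _ _ (Small.mul_right h (h'.mem hC)) (Small.mul_left h' (hC.1 a))
  unfold HasValue
  convert this using 1
  rw [map_mul]; ring

theorem HasValue.unique (h : HasValue C z a) (h' : HasValue C z b) : a = b := by
  by_contra hne
  have := hC.small_sub h' h
  refine hC.not_small_const (sub_ne_zero.2 hne) ?_
  convert this using 1
  rw [map_sub]; ring

theorem HasValue.not_small (h : HasValue C z a) (ha : a ≠ 0) : ¬ Small C z := fun hs =>
  ha (h.unique hC (hasValue_zero_iff.2 hs))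

theorem HasValue.ne_zero (h : HasValue C z a) (ha : a ≠ 0) : z ≠ 0 :=
  ne_zero_of_not_small (h.not_small hC ha)

theorem HasValue.inv_mem (h : HasValue C z a) (ha : a ≠ 0) : z⁻¹ ∈ C :=
  inv_mem_of_not_small (h.mem hC) (h.not_small hC ha)

theorem HasValue.inv (h : HasValue C z a) (ha : a ≠ 0) : HasValue C z⁻¹ a⁻¹ := by
  have h0 := h.ne_zero hC ha
  have ha' : algebraMap ℂ K a ≠ 0 := by simpa using ha
  -- The identity used is z⁻¹ - a⁻¹ = -(z - a) z⁻¹ a⁻¹.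
  have := small_neg ((Small.mul_right h (h.inv_mem hC ha)).mul_right (hC.1 a⁻¹))
  unfold HasValue
  convert this using 1
  rw [map_inv₀]
  field_simp
  ring

theorem HasValue.pow (h : HasValue C z a) (n : ℕ) : HasValue C (z ^ n) (a ^ n) := by
  induction n with
  | zero => simpa using hasValue_const 1
  | succ n ih => simpa [pow_succ] using ih.mul hC h

theorem HasValue.aeval {u v : K} (hu : HasValue C u a) (hv : HasValue C v b)
    (P : MvPolynomial (Fin 2) ℂ) :
    HasValue C (MvPolynomial.aeval ![u, v] P) (MvPolynomial.aeval ![a, b] P) := by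
  induction P using MvPolynomial.induction_on with
  | C c => simpa using hasValue_const c
  | add p q hp hq => simpa using hp.add hC hq
  | mul_X p i hp =>
    rw [map_mul, map_mul]
    refine hp.mul hC ?_
    fin_cases i
    · simpa using hu
    · simpa using hv

/-- Over ℂ the polynomial splits, and every factor z - a is a unit of C because z takes no constant
value there. -/
theorem IsGeneric.not_small_aeval (h : IsGeneric C z) {Q : Polynomial ℂ} (hQ : Q ≠ 0) :
    Polynomial.aeval z Q ∈ C ∧ ¬ Small C (Polynomial.aeval z Q) := by
  have key : ∀ s : Multiset ℂ, Polynomial.aeval z ((s.map fun a => Polynomial.X - Polynomial.C a).prod)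
      ∈ C ∧ ¬ Small C (Polynomial.aeval z ((s.map fun a => Polynomial.X - Polynomial.C a).prod)) := by
    intro s
    induction s using Multiset.induction_on with
    | empty =>
      refine ⟨by simp, not_small_of_inv_mem (by simp) (by simp)⟩
    | cons a s ih =>
      have ha : z - algebraMap ℂ K a ∈ C := C.sub_mem h.1 (hC.1 a)
      simp only [Multiset.map_cons, Multiset.prod_cons, map_mul, map_sub, Polynomial.aeval_X,
        Polynomial.aeval_C]
      refine ⟨C.mul_mem ha ih.1, fun hs => ih.2 ?_⟩
      have hns : ¬ Small C (z - algebraMap ℂ K a) := h.2 a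
      rw [mul_comm] at hs
      exact (small_mul_iff_of_unit ha (ne_zero_of_not_small hns)
        (inv_mem_of_not_small ha hns)).1 hs
  have hsp := IsAlgClosed.splits Q
  have hl : Q.leadingCoeff ≠ 0 := Polynomial.leadingCoeff_ne_zero.2 hQ
  rw [hsp.eq_prod_roots, map_mul, Polynomial.aeval_C]
  refine ⟨C.mul_mem (hC.1 _) (key Q.roots).1, fun hs => (key Q.roots).2 ?_⟩
  rw [mul_comm] at hs
  exact (small_mul_iff_of_unit (hC.1 _) (by simpa using hl)
    (by rw [← map_inv₀]; exact hC.1 _)).1 hs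

theorem IsGeneric.mem_aeval (h : IsGeneric C z) (Q : Polynomial ℂ) : Polynomial.aeval z Q ∈ C := by
  by_cases hQ : Q = 0
  · simp [hQ]
  · exact (h.not_small_aeval hC hQ).1

theorem IsGeneric.small_aeval_sub {u v : K} (hu : IsGeneric C u) (hv : Small C v)
    (P : MvPolynomial (Fin 2) ℂ) :
    Small C (MvPolynomial.aeval ![u, v] P - Polynomial.aeval u
      (MvPolynomial.aeval ![(Polynomial.X : Polynomial ℂ), (0 : Polynomial ℂ)] P)) := by
  induction P using MvPolynomial.induction_on with
  | C c => simp [small_zero]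
  | add p q hp hq =>
    simp only [map_add]
    convert hC.2 _ _ hp hq using 1
    ring
  | mul_X p i hp =>
    fin_cases i
    · simp only [map_mul, Fin.zero_eta, MvPolynomial.aeval_X, Matrix.cons_val_zero,
        Polynomial.aeval_X, ← sub_mul]
      exact hp.mul_right hu.1
    · simp only [map_mul, Fin.mk_one, MvPolynomial.aeval_X, Matrix.cons_val_one,
        Matrix.cons_val_zero, mul_zero, map_zero, sub_zero]
      refine hv.mul_left ?_
      have := C.add_mem hp.1 (hu.mem_aeval hC
        (MvPolynomial.aeval ![(Polynomial.X : Polynomial ℂ), (0 : Polynomial ℂ)] p))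
      rwa [sub_add_cancel] at this

/-- A denominator Q(u, v) takes the value Q(a, b) ≠ 0 at C, so its inverse lies in C. This replaces
every explicit manipulation of fractions in comparing two coordinate systems. -/
theorem pointRing_le {u v : K} (hu : HasValue C u a) (hv : HasValue C v b) :
    pointRing u v a b ≤ C := by
  rintro _ ⟨P, Q, hQ, -, rfl⟩
  rw [div_eq_mul_inv]
  exact C.mul_mem ((hu.aeval hC hv P).mem hC) ((hu.aeval hC hv Q).inv_mem hC hQ)

/-- Modulo non-units of C, the denominator Q(u, v) equals Q(u, 0), which is a unit by genericity of
u. -/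
theorem lineRing_le {u v : K} (hu : IsGeneric C u) (hv : Small C v) : lineRing u v ≤ C := by
  rintro _ ⟨P, Q, hQ, -, rfl⟩
  have hm : ∀ P, MvPolynomial.aeval ![u, v] P ∈ C := fun P => by
    have := C.add_mem (hu.small_aeval_sub hC hv P).1 (hu.mem_aeval hC
      (MvPolynomial.aeval ![(Polynomial.X : Polynomial ℂ), (0 : Polynomial ℂ)] P))
    rwa [sub_add_cancel] at this
  rw [div_eq_mul_inv]
  refine C.mul_mem (hm P) (inv_mem_of_not_small (hm Q) fun hs => ?_)
  refine (hu.not_small_aeval hC hQ).2 ?_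
  convert hC.small_sub hs (hu.small_aeval_sub hC hv Q) using 1
  ring

theorem IsGeneric.sub_const (h : IsGeneric C z) (c : ℂ) : IsGeneric C (z - algebraMap ℂ K c) := by
  refine ⟨C.sub_mem h.1 (hC.1 c), fun d hd => h.2 (c + d) ?_⟩
  unfold HasValue at *
  convert hd using 1
  rw [map_add]; ring

omit hC in
theorem IsGeneric.not_small (h : IsGeneric C z) : ¬ Small C z := fun hs =>
  h.2 0 (hasValue_zero_iff.2 hs)

theorem IsGeneric.inv (h : IsGeneric C z) : IsGeneric C z⁻¹ := by
  refine ⟨inv_mem_of_not_small h.1 h.not_small, fun c hc => ?_⟩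
  by_cases h0 : c = 0
  · subst h0
    have h1 := (hasValue_zero_iff.1 hc).mul_right h.1
    rw [inv_mul_cancel₀ (ne_zero_of_not_small h.not_small)] at h1
    exact not_small_of_inv_mem one_ne_zero (by simp) h1
  · have := hc.inv hC h0
    rw [inv_inv] at this
    exact h.2 _ this

end HasValue

/-! ### Pairs of generators of the function field. -/

open MvPolynomial in
theorem algebraicIndependent_xK_yK : AlgebraicIndependent ℂ ![xK, yK] := by
  have h := (algebraicIndependent_X (Fin 2) ℂ).map' (f := IsScalarTower.toAlgHom ℂ _ K)
    (IsFractionRing.injective (MvPolynomial (Fin 2) ℂ) K)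
  convert h using 1
  funext i
  fin_cases i <;> rfl

/-- The field K has transcendence degree at least 2, witnessed by x and y. Two elements over which K
is algebraic must then be algebraically independent. -/
theorem Coord.injective {u v : K} (h : Coord u v) :
    Function.Injective (MvPolynomial.aeval ![u, v] : MvPolynomial (Fin 2) ℂ →ₐ[ℂ] K) := by
  have hr : Set.range ![u, v] = {u, v} := by simp [Set.pair_comm]
  have htr : Cardinal.mk (Fin 2) ≤ Algebra.trdeg ℂ K :=
    algebraicIndependent_xK_yK.cardinalMk_le_trdeg
  have halg : Algebra.IsAlgebraic (Algebra.adjoin ℂ (Set.range ![u, v])) K := by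
    refine ⟨fun z => ?_⟩
    have hz : z ∈ IntermediateField.adjoin ℂ (Set.range ![u, v]) := by
      rw [hr, show IntermediateField.adjoin ℂ {u, v} = ⊤ from h]
      trivial
    obtain ⟨r, s, rfl⟩ := (IntermediateField.mem_adjoin_range_iff ℂ _ _).1 hz
    have hmem : ∀ r : MvPolynomial (Fin 2) ℂ, IsAlgebraic (Algebra.adjoin ℂ (Set.range ![u, v]))
        (MvPolynomial.aeval ![u, v] r) := fun r => by
      have hr' : MvPolynomial.aeval ![u, v] r ∈ Algebra.adjoin ℂ (Set.range ![u, v]) := by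
        rw [Algebra.adjoin_range_eq_range_aeval]
        exact ⟨r, rfl⟩
      exact isAlgebraic_algebraMap (⟨_, hr'⟩ : Algebra.adjoin ℂ (Set.range ![u, v]))
    rw [div_eq_mul_inv]
    exact (hmem r).mul (hmem s).inv
  exact (Algebra.IsAlgebraic.isTranscendenceBasis_of_le_trdeg_of_finite ℂ ![u, v] htr).1

theorem coord_xK_yK : Coord xK yK := by
  unfold Coord
  rw [eq_top_iff]
  rintro z -
  have hr : Set.range ![xK, yK] = {xK, yK} := by simp [Set.pair_comm]
  rw [← hr, IntermediateField.mem_adjoin_range_iff]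
  obtain ⟨r, s, -, rfl⟩ := IsFractionRing.div_surjective (A := MvPolynomial (Fin 2) ℂ) z
  have key : ∀ r : MvPolynomial (Fin 2) ℂ, algebraMap _ K r = MvPolynomial.aeval ![xK, yK] r := by
    intro r
    induction r using MvPolynomial.induction_on with
    | C c =>
      rw [MvPolynomial.aeval_C, ← MvPolynomial.algebraMap_eq, ← IsScalarTower.algebraMap_apply]
    | add p q hp hq => simp [hp, hq]
    | mul_X p i hp =>
      rw [map_mul, map_mul, hp, MvPolynomial.aeval_X]
      fin_cases i <;> rfl
  exact ⟨r, s, by rw [key, key]⟩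

/-- Each coordinate system of the blow-ups is obtained from (x, y) by inverting, multiplying,
dividing or translating, and every such step is undone inside the new field. -/
theorem Coord.of_mem {u v u' v' : K} (h : Coord u v)
    (hu : u ∈ IntermediateField.adjoin ℂ {u', v'})
    (hv : v ∈ IntermediateField.adjoin ℂ {u', v'}) : Coord u' v' := by
  unfold Coord at *
  rw [eq_top_iff, ← h, IntermediateField.adjoin_le_iff]
  rintro z (rfl | rfl)
  exacts [hu, hv]

theorem Coord.swap {u v : K} (h : Coord u v) : Coord v u := by
  unfold Coord at *
  rwa [Set.pair_comm]

theorem Coord.ne_zero_left {u v : K} (h : Coord u v) : u ≠ 0 := by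
  intro h0
  have : (MvPolynomial.X 0 : MvPolynomial (Fin 2) ℂ) = 0 := h.injective (by simp [h0])
  exact MvPolynomial.X_ne_zero 0 this

theorem Coord.ne_zero_right {u v : K} (h : Coord u v) : v ≠ 0 := h.swap.ne_zero_left

theorem Coord.sub_const {u v : K} (h : Coord u v) (c : ℂ) : Coord (u - algebraMap ℂ K c) v := by
  refine h.of_mem ?_ (IntermediateField.subset_adjoin _ _ (by simp))
  have h1 := (IntermediateField.adjoin ℂ {u - algebraMap ℂ K c, v}).add_mem
    (IntermediateField.subset_adjoin ℂ _ (by simp : u - algebraMap ℂ K c ∈ _))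
    ((IntermediateField.adjoin ℂ {u - algebraMap ℂ K c, v}).algebraMap_mem c)
  rwa [sub_add_cancel] at h1

theorem Coord.inv_left {u v : K} (h : Coord u v) : Coord u⁻¹ v := by
  refine h.of_mem ?_ (IntermediateField.subset_adjoin _ _ (by simp))
  have h1 := (IntermediateField.adjoin ℂ {u⁻¹, v}).inv_mem
    (IntermediateField.subset_adjoin ℂ _ (by simp : u⁻¹ ∈ _))
  rwa [inv_inv] at h1

theorem Coord.mul_left {u v : K} (h : Coord u v) : Coord (u * v) v := by
  have hv : v ∈ IntermediateField.adjoin ℂ {u * v, v} :=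
    IntermediateField.subset_adjoin _ _ (by simp)
  refine h.of_mem ?_ hv
  have h1 := (IntermediateField.adjoin ℂ {u * v, v}).div_mem
    (IntermediateField.subset_adjoin ℂ _ (by simp : u * v ∈ _)) hv
  rwa [mul_div_cancel_right₀ _ h.ne_zero_right] at h1

theorem Coord.inv_right {u v : K} (h : Coord u v) : Coord u v⁻¹ := h.swap.inv_left.swap

theorem Coord.div_left {u v : K} (h : Coord u v) : Coord (u / v) v := by
  simpa [div_eq_mul_inv] using h.inv_right.mul_left.inv_right

theorem Coord.div_right {u v : K} (h : Coord u v) : Coord u (v / u) := h.swap.div_left.swap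

/-! ### The local rings of points and lines. -/

section FractionsAway

variable {u v : K} {A : Type} [CommRing A] [IsDomain A] [Algebra ℂ A]
  {φ : MvPolynomial (Fin 2) ℂ →ₐ[ℂ] A}

theorem Coord.aeval_ne_zero (h : Coord u v) {P : MvPolynomial (Fin 2) ℂ} (hP : P ≠ 0) :
    MvPolynomial.aeval ![u, v] P ≠ 0 := fun h0 => hP (h.injective (by simpa using h0))

theorem Coord.mem_fractionsAway (h : Coord u v) {P Q : MvPolynomial (Fin 2) ℂ} (hQ : φ Q ≠ 0) :
    MvPolynomial.aeval ![u, v] P / MvPolynomial.aeval ![u, v] Q ∈ fractionsAway u v φ :=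
  ⟨P, Q, hQ, h.aeval_ne_zero (by rintro rfl; simp at hQ), rfl⟩

theorem aeval_mem_fractionsAway (P : MvPolynomial (Fin 2) ℂ) :
    MvPolynomial.aeval ![u, v] P ∈ fractionsAway u v φ :=
  ⟨P, 1, by simp, by simp, by simp⟩

/-- Independence of u and v lets an equation between fractions be cleared to one between
polynomials, to which φ can be applied. As the target of φ is a domain, this identifies the
non-units with the fractions whose numerator lies in ker φ. -/
theorem Coord.small_div_iff (h : Coord u v) {P Q : MvPolynomial (Fin 2) ℂ} (hQ : φ Q ≠ 0) :
    Small (fractionsAway u v φ) (MvPolynomial.aeval ![u, v] P / MvPolynomial.aeval ![u, v] Q) ↔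
      φ P = 0 := by
  constructor
  · intro hs
    by_contra hP
    have hP0 : P ≠ 0 := by rintro rfl; simp at hP
    have hQ0 : Q ≠ 0 := by rintro rfl; simp at hQ
    refine not_small_of_inv_mem
      (div_ne_zero (h.aeval_ne_zero hP0) (h.aeval_ne_zero hQ0)) ?_ hs
    rw [inv_div]
    exact h.mem_fractionsAway hP
  · intro hP
    refine ⟨h.mem_fractionsAway hQ, ?_⟩
    by_cases hP0 : P = 0
    · simp [hP0]
    refine Or.inr ?_
    rintro ⟨P', Q', hQ', hne, he⟩
    rw [inv_div, div_eq_div_iff (h.aeval_ne_zero hP0) hne, ← map_mul, ← map_mul] at he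
    have := congrArg φ (h.injective he)
    rw [map_mul, map_mul, hP, mul_zero] at this
    exact mul_ne_zero hQ hQ' this

theorem Coord.small_aeval_iff (h : Coord u v) {P : MvPolynomial (Fin 2) ℂ} :
    Small (fractionsAway u v φ) (MvPolynomial.aeval ![u, v] P) ↔ φ P = 0 := by
  have := h.small_div_iff (φ := φ) (P := P) (Q := 1) (by simp)
  simpa using this

theorem Coord.isLocalAlgebra_fractionsAway (h : Coord u v) :
    IsLocalAlgebra (fractionsAway u v φ) := by
  refine ⟨fun c => ?_, fun z w hz hw => ?_⟩
  · simpa using aeval_mem_fractionsAway (u := u) (v := v) (φ := φ) (MvPolynomial.C c)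
  · obtain ⟨P, Q, hQ, hne, rfl⟩ := hz.1
    obtain ⟨P', Q', hQ', hne', rfl⟩ := hw.1
    rw [h.small_div_iff hQ] at hz
    rw [h.small_div_iff hQ'] at hw
    rw [div_add_div _ _ hne hne', ← map_mul, ← map_mul, ← map_mul, ← map_add, h.small_div_iff]
    · simp [hz, hw]
    · rw [map_mul]; exact mul_ne_zero hQ hQ'

theorem Coord.isLocalAlgebra_pointRing (h : Coord u v) (a b : ℂ) :
    IsLocalAlgebra (pointRing u v a b) := h.isLocalAlgebra_fractionsAway

theorem Coord.isLocalAlgebra_lineRing (h : Coord u v) :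
    IsLocalAlgebra (lineRing u v) := h.isLocalAlgebra_fractionsAway

theorem Coord.hasValue_left (h : Coord u v) (a b : ℂ) : HasValue (pointRing u v a b) u a := by
  have := h.small_aeval_iff (φ := MvPolynomial.aeval ![a, b])
    (P := MvPolynomial.X 0 - MvPolynomial.C a)
  unfold HasValue pointRing
  simpa using this

theorem Coord.hasValue_right (h : Coord u v) (a b : ℂ) : HasValue (pointRing u v a b) v b := by
  have := h.small_aeval_iff (φ := MvPolynomial.aeval ![a, b])
    (P := MvPolynomial.X 1 - MvPolynomial.C b)
  unfold HasValue pointRing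
  simpa using this

theorem Coord.isGeneric (h : Coord u v) : IsGeneric (lineRing u v) u := by
  have hm := aeval_mem_fractionsAway (u := u) (v := v)
    (φ := MvPolynomial.aeval ![(Polynomial.X : Polynomial ℂ), 0]) (MvPolynomial.X 0)
  rw [MvPolynomial.aeval_X] at hm
  refine ⟨hm, fun c hc => ?_⟩
  have := h.small_aeval_iff (φ := MvPolynomial.aeval ![(Polynomial.X : Polynomial ℂ), 0])
    (P := MvPolynomial.X 0 - MvPolynomial.C c)
  simp only [map_sub, MvPolynomial.aeval_X, MvPolynomial.aeval_C, Matrix.cons_val_zero] at this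
  exact Polynomial.X_sub_C_ne_zero c (this.1 hc)

theorem Coord.small (h : Coord u v) : Small (lineRing u v) v := by
  have := h.small_aeval_iff (φ := MvPolynomial.aeval ![(Polynomial.X : Polynomial ℂ), 0])
    (P := MvPolynomial.X 1)
  unfold lineRing
  simpa using this

theorem pointRing_le_lineRing (u v : K) (a : ℂ) : pointRing u v a 0 ≤ lineRing u v := by
  rintro _ ⟨P, Q, hQ, hne, rfl⟩
  refine ⟨P, Q, fun h0 => hQ ?_, hne, rfl⟩
  have h1 : (Polynomial.aeval a).comp (MvPolynomial.aeval ![(Polynomial.X : Polynomial ℂ), 0]) =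
      MvPolynomial.aeval ![a, (0 : ℂ)] := by
    ext i
    fin_cases i <;> simp
  rw [← h1, AlgHom.comp_apply, h0, map_zero]

end FractionsAway

/-- Only four values have to be computed to recognize the same point in two coordinate systems. -/
theorem pointRing_eq {u v u' v' : K} {a b a' b' : ℂ} (h : Coord u v) (h' : Coord u' v')
    (h1 : HasValue (pointRing u v a b) u' a') (h2 : HasValue (pointRing u v a b) v' b')
    (h3 : HasValue (pointRing u' v' a' b') u a) (h4 : HasValue (pointRing u' v' a' b') v b) :
    pointRing u v a b = pointRing u' v' a' b' :=
  le_antisymm (pointRing_le (h'.isLocalAlgebra_pointRing _ _) h3 h4)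
    (pointRing_le (h.isLocalAlgebra_pointRing _ _) h1 h2)

theorem lineRing_eq {u v u' v' : K} (h : Coord u v) (h' : Coord u' v')
    (h1 : IsGeneric (lineRing u v) u') (h2 : Small (lineRing u v) v')
    (h3 : IsGeneric (lineRing u' v') u) (h4 : Small (lineRing u' v') v) :
    lineRing u v = lineRing u' v' :=
  le_antisymm (lineRing_le h'.isLocalAlgebra_lineRing h3 h4)
    (lineRing_le h.isLocalAlgebra_lineRing h1 h2)

theorem Coord.pointRing_swap {u v : K} (h : Coord u v) (a b : ℂ) :
    pointRing u v a b = pointRing v u b a :=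
  pointRing_eq h h.swap (h.hasValue_right a b) (h.hasValue_left a b) (h.swap.hasValue_right b a)
    (h.swap.hasValue_left b a)

/-! ### Equations of curves and maximal ideals. -/

open MvPolynomial in
theorem exists_sub_aeval_eq_X_mul (P : MvPolynomial (Fin 2) ℂ) : ∃ P' : MvPolynomial (Fin 2) ℂ,
    P - Polynomial.aeval (X 0) (aeval ![(Polynomial.X : Polynomial ℂ), 0] P) = X 1 * P' := by
  induction P using MvPolynomial.induction_on with
  | C c => exact ⟨0, by simp [← MvPolynomial.algebraMap_eq]⟩
  | add p q hp hq =>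
    obtain ⟨p', hp⟩ := hp
    obtain ⟨q', hq⟩ := hq
    exact ⟨p' + q', by rw [mul_add, ← hp, ← hq, map_add, map_add]; ring⟩
  | mul_X p i hp =>
    obtain ⟨p', hp⟩ := hp
    fin_cases i
    · exact ⟨p' * X 0, by
        simp only [map_mul, aeval_X, Fin.zero_eta, Matrix.cons_val_zero, Polynomial.aeval_X,
          ← mul_assoc, ← hp]
        ring⟩
    · exact ⟨p, by simp [mul_comm]⟩

open MvPolynomial in
theorem exists_sub_C_aeval_eq (a b : ℂ) (P : MvPolynomial (Fin 2) ℂ) :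
    ∃ P₁ P₂ : MvPolynomial (Fin 2) ℂ,
      P - C (aeval ![a, b] P) = (X 0 - C a) * P₁ + (X 1 - C b) * P₂ := by
  induction P using MvPolynomial.induction_on with
  | C c => exact ⟨0, 0, by simp⟩
  | add p q hp hq =>
    obtain ⟨p₁, p₂, hp⟩ := hp
    obtain ⟨q₁, q₂, hq⟩ := hq
    refine ⟨p₁ + q₁, p₂ + q₂, ?_⟩
    rw [map_add, map_add]
    linear_combination hp + hq
  | mul_X p i hp =>
    obtain ⟨p₁, p₂, hp⟩ := hp
    fin_cases i
    · refine ⟨p₁ * X 0 + C (aeval ![a, b] p), p₂ * X 0, ?_⟩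
      simp only [map_mul, aeval_X, Fin.zero_eta, Matrix.cons_val_zero]
      linear_combination hp * X 0
    · refine ⟨p₁ * X 1, p₂ * X 1 + C (aeval ![a, b] p), ?_⟩
      simp only [map_mul, aeval_X, Fin.mk_one, Matrix.cons_val_one, Matrix.cons_val_zero]
      linear_combination hp * X 1

theorem Coord.exists_eq_mul_of_small {u v : K} (h : Coord u v) {a : ℂ} {z : K}
    (hz : z ∈ pointRing u v a 0) (hs : Small (lineRing u v) z) :
    ∃ w ∈ pointRing u v a 0, z = v * w := by
  obtain ⟨P, Q, hQ, hne, rfl⟩ := hz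
  -- If Q(X, 0) were zero, Q would be divisible by the second variable and would vanish at (a, 0).
  have hQ' : MvPolynomial.aeval ![(Polynomial.X : Polynomial ℂ), 0] Q ≠ 0 := fun h0 => by
    obtain ⟨Q', hQ'⟩ := exists_sub_aeval_eq_X_mul Q
    rw [h0, map_zero, sub_zero] at hQ'
    rw [hQ'] at hQ
    simp at hQ
  obtain ⟨P', hP'⟩ := exists_sub_aeval_eq_X_mul P
  rw [(h.small_div_iff hQ').1 hs, map_zero, sub_zero] at hP'
  refine ⟨_, h.mem_fractionsAway (P := P') hQ, ?_⟩
  rw [hP', map_mul, MvPolynomial.aeval_X]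
  simp [mul_div_assoc]

theorem Coord.exists_eq_add_of_small {u v : K} (h : Coord u v) {a b : ℂ} {z : K}
    (hs : Small (pointRing u v a b) z) :
    ∃ w ∈ pointRing u v a b, ∃ w' ∈ pointRing u v a b,
      z = (u - algebraMap ℂ K a) * w + (v - algebraMap ℂ K b) * w' := by
  obtain ⟨P, Q, hQ, hne, rfl⟩ := hs.1
  obtain ⟨P₁, P₂, hP⟩ := exists_sub_C_aeval_eq a b P
  rw [(h.small_div_iff hQ).1 hs, map_zero, sub_zero] at hP
  refine ⟨_, h.mem_fractionsAway (P := P₁) hQ, _, h.mem_fractionsAway (P := P₂) hQ, ?_⟩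
  rw [hP]
  simp only [map_add, map_mul, map_sub, MvPolynomial.aeval_X, MvPolynomial.aeval_C,
    Matrix.cons_val_zero, Matrix.cons_val_one]
  ring

/-- The non-units of the local ring C already form an ideal, so passing to the span adds nothing. -/
theorem mem_curveIdeal {R C : Subring K} (hC : IsLocalAlgebra C) (hRC : R ≤ C) (z : R) :
    z ∈ curveIdeal R C ↔ Small C z := by
  rw [curveIdeal, if_pos hRC]
  have hs : ∀ a : R, ((a : K) = 0 ∨ (a : K)⁻¹ ∉ C) ↔ Small C a := fun a =>
    ⟨fun h => ⟨hRC a.2, h⟩, fun h => h.2⟩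
  simp only [hs]
  refine ⟨fun h => ?_, fun h => Ideal.subset_span h⟩
  induction h using Submodule.span_induction with
  | mem x h => exact h
  | zero => exact small_zero
  | add x y _ _ hx hy => exact hC.2 _ _ hx hy
  | smul a x _ hx => exact hx.mul_left (hRC a.2)

theorem isUnit_iff_not_small {R : Subring K} (z : R) : IsUnit z ↔ ¬ Small R z := by
  constructor
  · rintro ⟨e, rfl⟩
    have h1 : ((e : R) : K) * ((e⁻¹ : Rˣ) : R) = 1 := by
      rw [← Subring.coe_mul, Units.mul_inv, Subring.coe_one]
    refine not_small_of_inv_mem (left_ne_zero_of_mul_eq_one h1) ?_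
    rw [inv_eq_of_mul_eq_one_right h1]
    exact Subtype.coe_prop _
  · intro h
    refine IsUnit.of_mul_eq_one ⟨_, inv_mem_of_not_small z.2 h⟩ (Subtype.ext ?_)
    simp [ne_zero_of_not_small h]

theorem mem_pointIdeal {R : Subring K} (hR : IsLocalAlgebra R) (z : R) :
    z ∈ pointIdeal R ↔ Small R z := by
  rw [pointIdeal]
  simp only [isUnit_iff_not_small, not_not]
  refine ⟨fun h => ?_, fun h => Ideal.subset_span h⟩
  induction h using Submodule.span_induction with
  | mem x h => exact h
  | zero => exact small_zero
  | add x y _ _ hx hy => exact hR.2 _ _ hx hy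
  | smul a x _ hx => exact hx.mul_left a.2

theorem Coord.curveIdeal_eq {u v : K} (h : Coord u v) {a : ℂ} (w : pointRing u v a 0)
    (hw : (w : K) = v) : curveIdeal (pointRing u v a 0) (lineRing u v) = Ideal.span {w} := by
  ext z
  rw [mem_curveIdeal h.isLocalAlgebra_lineRing (pointRing_le_lineRing u v a),
    Ideal.mem_span_singleton']
  constructor
  · intro hs
    obtain ⟨w', hw', he⟩ := h.exists_eq_mul_of_small z.2 hs
    exact ⟨⟨w', hw'⟩, Subtype.ext (by simp [hw, he, mul_comm])⟩
  · rintro ⟨c, rfl⟩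
    rw [Subring.coe_mul, hw]
    exact h.small.mul_left (pointRing_le_lineRing u v a c.2)

theorem Coord.pointIdeal_eq {u v : K} (h : Coord u v) {a b : ℂ} (w w' : pointRing u v a b)
    (hw : (w : K) = u - algebraMap ℂ K a) (hw' : (w' : K) = v - algebraMap ℂ K b) :
    pointIdeal (pointRing u v a b) = Ideal.span {w'} ⊔ Ideal.span {w} := by
  have hR := h.isLocalAlgebra_pointRing a b
  refine le_antisymm (fun z hz => ?_) (sup_le ?_ ?_)
  · rw [mem_pointIdeal hR] at hz
    obtain ⟨z₁, hz₁, z₂, hz₂, he⟩ := h.exists_eq_add_of_small hz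
    have : z = ⟨z₂, hz₂⟩ * w' + ⟨z₁, hz₁⟩ * w := Subtype.ext (by
      rw [Subring.coe_add, Subring.coe_mul, Subring.coe_mul, hw, hw', he]
      ring)
    rw [this]
    exact Submodule.add_mem_sup (Ideal.mem_span_singleton'.2 ⟨_, rfl⟩)
      (Ideal.mem_span_singleton'.2 ⟨_, rfl⟩)
  · rw [Ideal.span_singleton_le_iff_mem, mem_pointIdeal hR, hw']
    exact h.hasValue_right a b
  · rw [Ideal.span_singleton_le_iff_mem, mem_pointIdeal hR, hw]
    exact h.hasValue_left a b

/-- Everything outside this ideal is a unit; hence the quotient has length one, which is the local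
contribution of a transversal intersection. -/
theorem IsLocalAlgebra.pointIdeal_isMaximal {R : Subring K} (hR : IsLocalAlgebra R) :
    (pointIdeal R).IsMaximal := by
  rw [Ideal.isMaximal_iff]
  refine ⟨fun h => ?_, fun J x _ hx hxJ => ?_⟩
  · rw [mem_pointIdeal hR] at h
    exact (isUnit_iff_not_small _).1 isUnit_one h
  · rw [mem_pointIdeal hR, ← isUnit_iff_not_small] at hx
    exact J.eq_top_iff_one.1 (J.eq_top_of_isUnit_mem hxJ hx)

theorem IsLocalAlgebra.length_quotient_pointIdeal {R : Subring K} (hR : IsLocalAlgebra R) :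
    Module.length R (R ⧸ pointIdeal R) = 1 := by
  rw [Module.length_eq_one_iff, isSimpleModule_iff_isCoatom]
  exact hR.pointIdeal_isMaximal.out

theorem length_quotient_eq_zero {R : Subring K} {I : Ideal R} (hI : I = ⊤) :
    Module.length R (R ⧸ I) = 0 := by
  rw [Module.length_eq_zero_iff, hI]
  infer_instance

/-! ### Curves that are coordinate axes, and their intersection numbers. -/

/-- The curve `C` is a coordinate axis at the point `R`. -/
def IsAxisAt (R C : Subring K) : Prop :=
  ∃ u v a, Coord u v ∧ R = pointRing u v a 0 ∧ C = lineRing u v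

/-- The curves `C` and `C'` are the coordinate axes at the point `R`. -/
def AreAxesAt (R C C' : Subring K) : Prop :=
  ∃ u v, Coord u v ∧ R = pointRing u v 0 0 ∧ C = lineRing u v ∧ C' = lineRing v u

theorem AreAxesAt.symm {R C C' : Subring K} (h : AreAxesAt R C C') : AreAxesAt R C' C := by
  obtain ⟨u, v, h, rfl, rfl, rfl⟩ := h
  exact ⟨v, u, h.swap, h.pointRing_swap 0 0, rfl, rfl⟩

theorem AreAxesAt.isAxisAt {R C C' : Subring K} (h : AreAxesAt R C C') : IsAxisAt R C := by
  obtain ⟨u, v, h, rfl, rfl, rfl⟩ := h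
  exact ⟨u, v, 0, h, rfl, rfl⟩

theorem IsAxisAt.le {R C : Subring K} (h : IsAxisAt R C) : R ≤ C := by
  obtain ⟨u, v, a, -, rfl, rfl⟩ := h
  exact pointRing_le_lineRing u v a

/-- Along the axis v = 0 the prime ideal is generated by v: it contains v ≠ 0 but not u - a, which
lies in the maximal ideal. -/
theorem isCurveOn_of_isAxisAt {S : Set (Subring K)} {C : Subring K} (hne : ∃ R ∈ S, R ≤ C)
    (hS : ∀ R ∈ S, R ≤ C → IsAxisAt R C) : IsCurveOn S C := by
  refine ⟨hne, fun R hR hRC => ?_⟩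
  obtain ⟨u, v, a, h, rfl, rfl⟩ := hS R hR hRC
  have hL := h.isLocalAlgebra_lineRing
  have hP := h.isLocalAlgebra_pointRing a 0
  have hvm : v ∈ pointRing u v a 0 := (h.hasValue_right a 0).mem hP
  refine ⟨fun h0 => ?_, fun h0 => ?_, fun z hz => ?_⟩
  · have : (⟨v, hvm⟩ : pointRing u v a 0) ∈ curveIdeal (pointRing u v a 0) (lineRing u v) := by
      rw [mem_curveIdeal hL hRC]; exact h.small
    rw [h0, Ideal.mem_bot] at this
    exact h.ne_zero_right (congrArg Subtype.val this)
  · have hum : u - algebraMap ℂ K a ∈ pointRing u v a 0 := (h.hasValue_left a 0).1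
    have : (⟨_, hum⟩ : pointRing u v a 0) ∈ curveIdeal (pointRing u v a 0) (lineRing u v) := by
      rw [h0, mem_pointIdeal hP]; exact h.hasValue_left a 0
    rw [mem_curveIdeal hL hRC] at this
    exact h.isGeneric.2 a this
  · obtain ⟨P, Q, hQ, hne, rfl⟩ := hz
    refine ⟨⟨_, aeval_mem_fractionsAway P⟩, ⟨_, aeval_mem_fractionsAway Q⟩, fun hm => hQ ?_,
      div_mul_cancel₀ _ hne⟩
    rw [mem_curveIdeal hL hRC] at hm
    exact h.small_aeval_iff.1 hm

theorem isSmoothCurve_of_isAxisAt {S : Set (Subring K)} {C : Subring K}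
    (hS : ∀ R ∈ S, R ≤ C → IsAxisAt R C) : IsSmoothCurve S C := by
  intro R hR hRC
  obtain ⟨u, v, a, h, rfl, rfl⟩ := hS R hR hRC
  have hP := h.isLocalAlgebra_pointRing a 0
  refine ⟨⟨_, (h.hasValue_left a 0).1⟩, ?_⟩
  rw [h.curveIdeal_eq ⟨v, (h.hasValue_right a 0).mem hP⟩ rfl]
  exact h.pointIdeal_eq _ _ rfl (by simp)

/-- The residue field is generated by the class of u, since P(u, v)/Q(u, v) and P(u, 0)/Q(u, 0)
differ by a non-unit. -/
theorem Coord.isRationalCurve {u v : K} (h : Coord u v) : IsRationalCurve (lineRing u v) := by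
  have hL := h.isLocalAlgebra_lineRing
  refine ⟨u, h.isGeneric.1, fun Q hQ => ?_, fun z hz => ?_⟩
  · have := h.isGeneric.not_small_aeval hL hQ
    exact ⟨ne_zero_of_not_small this.2, inv_mem_of_not_small this.1 this.2⟩
  · obtain ⟨P, Q, hQ, hne, rfl⟩ := hz
    refine ⟨MvPolynomial.aeval ![(Polynomial.X : Polynomial ℂ), 0] P, _, hQ,
      And.right (?_ : Small (lineRing u v) _)⟩
    have hq := h.isGeneric.not_small_aeval hL hQ
    have hq0 := ne_zero_of_not_small hq.2
    have hQi : (MvPolynomial.aeval ![u, v] Q)⁻¹ ∈ lineRing u v := by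
      have h1 := h.mem_fractionsAway (P := 1) hQ
      rwa [map_one, one_div] at h1
    have hPm := h.isGeneric.mem_aeval hL (MvPolynomial.aeval ![(Polynomial.X : Polynomial ℂ), 0] P)
    have s1 := h.isGeneric.small_aeval_sub hL h.small P
    have s2 := h.isGeneric.small_aeval_sub hL h.small Q
    have hqi := inv_mem_of_not_small hq.1 hq.2
    convert hL.small_sub (s1.mul_right hQi)
      ((s2.mul_right ((lineRing u v).mul_mem hQi hqi)).mul_right hPm) using 1
    field_simp
    ring

theorem Coord.curveIdeal_eq_of_eq {u v : K} (h : Coord u v) {R : Subring K} {a : ℂ}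
    (hR : R = pointRing u v a 0) (w : R) (hw : (w : K) = v) :
    curveIdeal R (lineRing u v) = Ideal.span {w} := by
  subst hR
  exact h.curveIdeal_eq w hw

/-- For two different curves f = 1 works. At a common point the two equations generate the maximal
ideal, so it contributes 1; elsewhere C' has the equation 1 and contributes 0. -/
theorem hasIntersectionNumber_of_areAxesAt {S : Set (Subring K)} {C C' : Subring K}
    (hC : IsLocalAlgebra C) (T : Finset (Subring K)) (hT : ∀ R, R ∈ T ↔ R ∈ S ∧ R ≤ C ∧ R ≤ C')
    (hS : ∀ R ∈ T, AreAxesAt R C C') : HasIntersectionNumber S C C' T.card := by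
  classical
  have key : ∀ R : Subring K, ∃ g : R, R ∈ S → R ≤ C → Ideal.span {g} = curveIdeal R C' ∧
      g ∉ curveIdeal R C ∧
      Module.length R (R ⧸ (curveIdeal R C ⊔ Ideal.span {g})) = if R ∈ T then 1 else 0 := by
    intro R
    by_cases hR : R ∈ T
    · obtain ⟨u, v, h, rfl, rfl, rfl⟩ := hS R hR
      have hP := h.isLocalAlgebra_pointRing 0 0
      have hum := (h.hasValue_left 0 0).mem hP
      have hvm := (h.hasValue_right 0 0).mem hP
      refine ⟨⟨u, hum⟩, fun _ hle => ⟨?_, ?_, ?_⟩⟩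
      · exact (h.swap.curveIdeal_eq_of_eq (h.pointRing_swap 0 0) _ rfl).symm
      · rw [mem_curveIdeal hC hle]
        exact h.isGeneric.not_small
      · rw [if_pos hR, h.curveIdeal_eq ⟨v, hvm⟩ rfl,
          ← h.pointIdeal_eq ⟨u, hum⟩ ⟨v, hvm⟩ (by simp) (by simp)]
        exact hP.length_quotient_pointIdeal
    · refine ⟨1, fun hRS hle => ?_⟩
      have hle' : ¬ R ≤ C' := fun hle' => hR ((hT R).2 ⟨hRS, hle, hle'⟩)
      refine ⟨by rw [curveIdeal, if_neg hle', Ideal.span_singleton_one], ?_, ?_⟩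
      · rw [mem_curveIdeal hC hle]
        exact not_small_of_inv_mem (by simp) (by simp)
      · rw [if_neg hR]
        exact length_quotient_eq_zero (by rw [Ideal.span_singleton_one, sup_top_eq])
  choose g hg using key
  refine ⟨1, g, g, fun _ => 1, one_ne_zero, fun R hRS hle => ⟨(hg R hRS hle).1,
    (hg R hRS hle).2.1, ?_, by simp⟩, ?_⟩
  · rw [mem_curveIdeal hC hle]
    exact not_small_of_inv_mem (by simp) (by simp)
  · have hF : ∀ R : Subring K, (∑ᶠ (_ : R ∈ S ∧ R ≤ C),
        (((Module.length R (R ⧸ (curveIdeal R C ⊔ Ideal.span {g R}))).toNat : ℤ) -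
        ((Module.length R (R ⧸ (curveIdeal R C ⊔ Ideal.span {(1 : R)}))).toNat : ℤ))) =
        if R ∈ T then 1 else 0 := by
      intro R
      by_cases hR : R ∈ S ∧ R ≤ C
      · rw [finsum_eq_if, if_pos hR, (hg R hR.1 hR.2).2.2, length_quotient_eq_zero
          (by rw [Ideal.span_singleton_one, sup_top_eq])]
        split_ifs <;> simp
      · rw [finsum_eq_if, if_neg hR, if_neg fun h => hR ⟨((hT R).1 h).1, ((hT R).1 h).2.1⟩]
    rw [finsum_congr hF, finsum_eq_sum_of_support_subset (s := T) _ (by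
      intro R hR
      by_contra h
      exact hR (if_neg h)), Finset.sum_congr rfl fun R hR => if_pos hR]
    simp

/-- The function f vanishes to first order on C, and its residual factor f/v restricts to C with
simple zeros exactly on T. Thus the divisor C - div f restricts to C as minus the sum of the points
of T. -/
theorem hasIntersectionNumber_self {S : Set (Subring K)} {C : Subring K}
    (T : Finset (Subring K)) (hT : ∀ R ∈ T, R ∈ S ∧ R ≤ C) {f : K} (hf : f ≠ 0)
    (hS : ∀ R ∈ S, R ≤ C → ∃ u v a e, Coord u v ∧ R = pointRing u v a 0 ∧ C = lineRing u v ∧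
      e ∈ R ∧ e ≠ 0 ∧ e⁻¹ ∈ R ∧
      ((R ∈ T ∧ f = v * ((u - algebraMap ℂ K a) * e)) ∨ (R ∉ T ∧ f = v * e))) :
    HasIntersectionNumber S C C (-(T.card : ℤ)) := by
  classical
  have key : ∀ R : Subring K, ∃ g b : R, R ∈ S → R ≤ C → Ideal.span {g} = curveIdeal R C ∧
      1 ∉ curveIdeal R C ∧ b ∉ curveIdeal R C ∧ (g : K) * b = f ∧
      Module.length R (R ⧸ (curveIdeal R C ⊔ Ideal.span {b})) = if R ∈ T then 1 else 0 := by
    intro R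
    by_cases hR : R ∈ S ∧ R ≤ C
    · obtain ⟨u, v, a, e, h, rfl, rfl, heR, he0, heiR, hfe⟩ := hS R hR.1 hR.2
      have hP := h.isLocalAlgebra_pointRing a 0
      have hL := h.isLocalAlgebra_lineRing
      have hvm := (h.hasValue_right a 0).mem hP
      have hum := (h.hasValue_left a 0).1
      have hv1 : Ideal.span {⟨v, hvm⟩} = curveIdeal (pointRing u v a 0) (lineRing u v) :=
        (h.curveIdeal_eq ⟨v, hvm⟩ rfl).symm
      have h1 : (1 : pointRing u v a 0) ∉ curveIdeal (pointRing u v a 0) (lineRing u v) := by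
        rw [mem_curveIdeal hL hR.2]
        exact not_small_of_inv_mem (by simp) (by simp)
      have hunit : IsUnit (⟨e, heR⟩ : pointRing u v a 0) :=
        (isUnit_iff_not_small _).2 (not_small_of_inv_mem he0 heiR)
      rcases hfe with ⟨hRT, hfe⟩ | ⟨hRT, hfe⟩
      · refine ⟨⟨v, hvm⟩, ⟨_, hum⟩ * ⟨e, heR⟩, fun _ _ => ⟨hv1, h1, ?_, hfe.symm, ?_⟩⟩
        · rw [mem_curveIdeal hL hR.2]
          intro hs
          exact h.isGeneric.2 a ((small_mul_iff_of_unit (hR.2 heR) he0 (hR.2 heiR)).1 hs)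
        · rw [if_pos hRT, Ideal.span_singleton_mul_right_unit hunit, ← hv1,
            ← h.pointIdeal_eq ⟨_, hum⟩ ⟨v, hvm⟩ rfl (by simp)]
          exact hP.length_quotient_pointIdeal
      · refine ⟨⟨v, hvm⟩, ⟨e, heR⟩, fun _ _ => ⟨hv1, h1, ?_, hfe.symm, ?_⟩⟩
        · rw [mem_curveIdeal hL hR.2]
          exact not_small_of_inv_mem he0 (hR.2 heiR)
        · rw [if_neg hRT]
          exact length_quotient_eq_zero (by
            rw [Ideal.span_singleton_eq_top.2 hunit, sup_top_eq])
    · exact ⟨1, 1, fun h h' => absurd ⟨h, h'⟩ hR⟩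
  choose g b hg using key
  refine ⟨f, g, fun _ => 1, b, hf, fun R hRS hle => ?_, ?_⟩
  · obtain ⟨h1, h2, h3, h4, -⟩ := hg R hRS hle
    exact ⟨h1, h2, h3, by simpa using h4⟩
  · have hF : ∀ R : Subring K, (∑ᶠ (_ : R ∈ S ∧ R ≤ C),
        (((Module.length R (R ⧸ (curveIdeal R C ⊔ Ideal.span {(1 : R)}))).toNat : ℤ) -
        ((Module.length R (R ⧸ (curveIdeal R C ⊔ Ideal.span {b R}))).toNat : ℤ))) =
        if R ∈ T then -1 else 0 := by
      intro R
      by_cases hR : R ∈ S ∧ R ≤ C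
      · rw [finsum_eq_if, if_pos hR, (hg R hR.1 hR.2).2.2.2.2, length_quotient_eq_zero
          (by rw [Ideal.span_singleton_one, sup_top_eq])]
        split_ifs <;> simp
      · rw [finsum_eq_if, if_neg hR, if_neg fun h => hR (hT R h)]
    rw [finsum_congr hF, finsum_eq_sum_of_support_subset (s := T) _ (by
      intro R hR
      by_contra h
      exact hR (if_neg h)), Finset.sum_congr rfl fun R hR => if_pos hR]
    simp

/-! ### The components of the fibre y = ∞ and the section x = ∞. -/

/-- The functions obtained from `x / y²` by blowing up successively the points with the values
`c 0`, `c 1`, … on the last exceptional curve. -/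
noncomputable def chain (c : ℕ → ℂ) : ℕ → K
  | 0 => xK / yK ^ 2
  | n + 1 => (chain c n - algebraMap ℂ K (c n)) * yK

/-- The fibre component with coordinate `chain c n`. -/
noncomputable def fiberCurve (c : ℕ → ℂ) (n : ℕ) : Subring K := lineRing (chain c n) yK⁻¹

/-- The point with coordinate `a` on the fibre component `fiberCurve c n`. -/
noncomputable def fiberPoint (c : ℕ → ℂ) (n : ℕ) (a : ℂ) : Subring K := pointRing (chain c n) yK⁻¹ a 0

/-- The common point of `fiberCurve c n` and `fiberCurve c (n + 1)`. -/
noncomputable def corner (c : ℕ → ℂ) (n : ℕ) : Subring K :=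
  pointRing (chain c n - algebraMap ℂ K (c n)) (chain c (n + 1))⁻¹ 0 0

/-- The curve `x = ∞`. -/
noncomputable def sectionCurve : Subring K := lineRing yK xK⁻¹

/-- The point `x = ∞`, `y = b`. -/
noncomputable def sectionPoint (b : ℂ) : Subring K := pointRing yK xK⁻¹ b 0

/-- The common point of `sectionCurve` and `fiberCurve c 0`. -/
noncomputable def sectionCorner : Subring K := pointRing (xK / yK ^ 2)⁻¹ yK⁻¹ 0 0

theorem yK_ne_zero : yK ≠ 0 := coord_xK_yK.ne_zero_right

theorem xK_ne_zero : xK ≠ 0 := coord_xK_yK.ne_zero_left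

theorem chain_zero (c : ℕ → ℂ) : chain c 0 = xK / yK ^ 2 := rfl

theorem chain_succ (c : ℕ → ℂ) (n : ℕ) :
    chain c (n + 1) = (chain c n - algebraMap ℂ K (c n)) * yK := rfl

theorem chain_succ_mul_inv (c : ℕ → ℂ) (n : ℕ) :
    chain c (n + 1) * yK⁻¹ = chain c n - algebraMap ℂ K (c n) := by
  rw [chain_succ, mul_inv_cancel_right₀ yK_ne_zero]

theorem coord_chain (c : ℕ → ℂ) (n : ℕ) : Coord (chain c n) yK⁻¹ := by
  induction n with
  | zero =>
    have := coord_xK_yK.div_left.div_left.inv_right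
    rwa [div_div, ← pow_two] at this
  | succ n ih =>
    have := (ih.sub_const (c n)).inv_right.mul_left.inv_right
    rwa [inv_inv] at this

theorem chain_ne_zero (c : ℕ → ℂ) (n : ℕ) : chain c n ≠ 0 := (coord_chain c n).ne_zero_left

theorem chain_sub_ne_zero (c : ℕ → ℂ) (n : ℕ) (a : ℂ) : chain c n - algebraMap ℂ K a ≠ 0 :=
  ((coord_chain c n).sub_const a).ne_zero_left

theorem coord_corner (c : ℕ → ℂ) (n : ℕ) :
    Coord (chain c n - algebraMap ℂ K (c n)) (chain c (n + 1))⁻¹ := by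
  have := ((coord_chain c n).sub_const (c n)).div_right
  rwa [div_eq_mul_inv, ← mul_inv, mul_comm yK, ← chain_succ] at this

theorem coord_section : Coord yK xK⁻¹ := coord_xK_yK.swap.inv_right

theorem coord_sectionCorner : Coord (xK / yK ^ 2)⁻¹ yK⁻¹ := (coord_chain 0 0).inv_left

section Values

variable {C : Subring K} (hC : IsLocalAlgebra C) (hy : Small C yK⁻¹) {c : ℕ → ℂ} {n m : ℕ}

include hC hy

omit hC in
-- Since w_n - c_n = w_{n+1}/y, regularity of a later function forces the value of the earlier one
-- wherever 1/y vanishes.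
theorem hasValue_chain_of_succ_mem (h : chain c (n + 1) ∈ C) : HasValue C (chain c n) (c n) := by
  unfold HasValue
  rw [← chain_succ_mul_inv]
  exact hy.mul_left h

theorem hasValue_chain_of_mem (h : chain c n ∈ C) (hm : m < n) : HasValue C (chain c m) (c m) := by
  induction n with
  | zero => omega
  | succ n ih =>
    have := hasValue_chain_of_succ_mem hy h
    rcases Nat.lt_succ_iff_lt_or_eq.1 hm with h' | rfl
    · exact ih (this.mem hC) h'
    · exact this

/-- The complementary case: where w_n is regular but avoids c_n, the factor y in w_{n+1} produces a
pole. Poles then propagate to all later functions. This dichotomy decides every incidence below. -/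
theorem small_chain_inv_succ (h : chain c n ∈ C) (h' : ¬ HasValue C (chain c n) (c n)) :
    Small C (chain c (n + 1))⁻¹ := by
  rw [chain_succ, mul_inv]
  exact hy.mul_left (inv_mem_of_not_small (C.sub_mem h (hC.1 _)) h')

omit hy in
theorem small_sub_const_inv {z : K} (h0 : z ≠ 0) (h : Small C z⁻¹) (a : ℂ) :
    Small C (z - algebraMap ℂ K a)⁻¹ := by
  -- The factorization z - a = z (1 - a z⁻¹), whose second factor takes the value 1.
  have h1 : HasValue C (1 - algebraMap ℂ K a * z⁻¹) (1 - a * 0) := by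
    have := hasValue_const (C := C) 1
    rw [map_one] at this
    exact this.sub hC ((hasValue_const a).mul hC (hasValue_zero_iff.2 h))
  have h2 := h.mul_right (h1.inv_mem hC (by simp))
  rwa [← mul_inv, mul_sub, mul_one, mul_left_comm, mul_inv_cancel₀ h0, mul_one] at h2

theorem small_chain_inv_of_small_inv (h : Small C (chain c n)⁻¹) (hm : n ≤ m) :
    Small C (chain c m)⁻¹ := by
  induction m, hm using Nat.le_induction with
  | base => exact h
  | succ m _ ih =>
    rw [chain_succ, mul_inv]
    exact (small_sub_const_inv hC (chain_ne_zero c m) ih _).mul_right hy.1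

theorem small_chain_inv_of_not_hasValue (h : chain c n ∈ C)
    (h' : ¬ HasValue C (chain c n) (c n)) (hm : n < m) : Small C (chain c m)⁻¹ :=
  small_chain_inv_of_small_inv hC hy (small_chain_inv_succ hC hy h h') hm

end Values

theorem not_hasValue_of_small_inv {C : Subring K} (hC : IsLocalAlgebra C) {z : K} (h0 : z ≠ 0)
    (h : Small C z⁻¹) (a : ℂ) : ¬ HasValue C z a := fun h' => h.notMem_of_inv h0 (h'.mem hC)

/-- The separating function is (z - a)⁻¹: it vanishes at R, where z has a pole, and has a pole along
C, where z takes the value a. -/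
theorem not_le_of_small_inv_of_hasValue {R C : Subring K} (hR : IsLocalAlgebra R) {z : K}
    (h0 : z ≠ 0) (h : Small R z⁻¹) {a : ℂ} (ha : z - algebraMap ℂ K a ≠ 0)
    (h' : HasValue C z a) : ¬ R ≤ C :=
  not_le_of_small_inv (small_sub_const_inv hR h0 h a).1 (inv_ne_zero ha)
    (by rw [inv_inv]; exact h')

section Fiber

variable (c : ℕ → ℂ) (n : ℕ) (a : ℂ)

theorem isLocalAlgebra_fiberCurve : IsLocalAlgebra (fiberCurve c n) :=
  (coord_chain c n).isLocalAlgebra_lineRing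

theorem isLocalAlgebra_fiberPoint : IsLocalAlgebra (fiberPoint c n a) :=
  (coord_chain c n).isLocalAlgebra_pointRing a 0

theorem isLocalAlgebra_corner : IsLocalAlgebra (corner c n) :=
  (coord_corner c n).isLocalAlgebra_pointRing 0 0

theorem isLocalAlgebra_sectionCurve : IsLocalAlgebra sectionCurve :=
  coord_section.isLocalAlgebra_lineRing

theorem isLocalAlgebra_sectionPoint : IsLocalAlgebra (sectionPoint a) :=
  coord_section.isLocalAlgebra_pointRing a 0

theorem isLocalAlgebra_sectionCorner : IsLocalAlgebra sectionCorner :=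
  coord_sectionCorner.isLocalAlgebra_pointRing 0 0

theorem small_fiberCurve : Small (fiberCurve c n) yK⁻¹ := (coord_chain c n).small

theorem small_fiberPoint : Small (fiberPoint c n a) yK⁻¹ :=
  hasValue_zero_iff.1 ((coord_chain c n).hasValue_right a 0)

theorem hasValue_fiberPoint : HasValue (fiberPoint c n a) (chain c n) a :=
  (coord_chain c n).hasValue_left a 0

theorem hasValue_corner : HasValue (corner c n) (chain c n) (c n) :=
  hasValue_zero_iff.1 ((coord_corner c n).hasValue_left 0 0)

theorem small_inv_corner : Small (corner c n) (chain c (n + 1))⁻¹ :=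
  hasValue_zero_iff.1 ((coord_corner c n).hasValue_right 0 0)

theorem small_corner : Small (corner c n) yK⁻¹ := by
  have := (small_inv_corner c n).mul_right (hasValue_corner c n).1
  rwa [← chain_succ_mul_inv, inv_mul_cancel_left₀ (chain_ne_zero _ _)] at this

theorem small_sectionCorner : Small sectionCorner yK⁻¹ :=
  hasValue_zero_iff.1 (coord_sectionCorner.hasValue_right 0 0)

theorem small_inv_sectionCorner : Small sectionCorner (chain c 0)⁻¹ :=
  hasValue_zero_iff.1 (coord_sectionCorner.hasValue_left 0 0)

theorem small_inv_sectionCurve : Small sectionCurve (chain c 0)⁻¹ := by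
  have h := coord_section.small.mul_right
    (sectionCurve.pow_mem coord_section.isGeneric.1 2)
  rw [chain_zero, inv_div, div_eq_mul_inv, mul_comm]
  exact h

theorem fiberPoint_le : fiberPoint c n a ≤ fiberCurve c n := pointRing_le_lineRing _ _ _

theorem sectionPoint_le : sectionPoint a ≤ sectionCurve := pointRing_le_lineRing _ _ _

theorem inv_chain_succ_mul :
    (chain c (n + 1))⁻¹ * (chain c n - algebraMap ℂ K (c n)) = yK⁻¹ := by
  rw [← chain_succ_mul_inv, inv_mul_cancel_left₀ (chain_ne_zero _ _)]

/-- The relation y⁻¹ = w_{n+1}⁻¹ (w_n - c_n) shows the fibre near the corner as the union of the two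
axes; this component is the axis w_{n+1}⁻¹ = 0. -/
theorem fiberCurve_eq_lineRing : fiberCurve c n =
    lineRing (chain c n - algebraMap ℂ K (c n)) (chain c (n + 1))⁻¹ := by
  have h := coord_corner c n
  have h0 := coord_chain c n
  refine lineRing_eq h0 h ?_ ?_ ?_ ?_
  · exact h0.isGeneric.sub_const h0.isLocalAlgebra_lineRing _
  · exact small_chain_inv_succ h0.isLocalAlgebra_lineRing h0.small h0.isGeneric.1 (h0.isGeneric.2 _)
  · have := h.isGeneric.sub_const h.isLocalAlgebra_lineRing (-(c n))
    simpa using this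
  · exact inv_chain_succ_mul c n ▸ h.small.mul_right h.isGeneric.1

theorem fiberCurve_succ_eq_lineRing : fiberCurve c (n + 1) =
    lineRing (chain c (n + 1))⁻¹ (chain c n - algebraMap ℂ K (c n)) := by
  have h := (coord_corner c n).swap
  have h1 := coord_chain c (n + 1)
  refine lineRing_eq h1 h ?_ ?_ ?_ ?_
  · exact h1.isGeneric.inv h1.isLocalAlgebra_lineRing
  · exact hasValue_chain_of_succ_mem h1.small h1.isGeneric.1
  · have := h.isGeneric.inv h.isLocalAlgebra_lineRing
    rwa [inv_inv] at this
  · exact inv_chain_succ_mul c n ▸ h.small.mul_left h.isGeneric.1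

theorem areAxesAt_corner : AreAxesAt (corner c n) (fiberCurve c n) (fiberCurve c (n + 1)) :=
  ⟨_, _, coord_corner c n, rfl, fiberCurve_eq_lineRing c n, fiberCurve_succ_eq_lineRing c n⟩

theorem fiberCurve_zero_eq_lineRing : fiberCurve c 0 = lineRing (xK / yK ^ 2)⁻¹ yK⁻¹ := by
  have h := coord_sectionCorner
  have h0 := coord_chain c 0
  refine lineRing_eq h0 h ?_ h0.small ?_ h.small
  · exact h0.isGeneric.inv h0.isLocalAlgebra_lineRing
  · have := h.isGeneric.inv h.isLocalAlgebra_lineRing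
    rwa [inv_inv] at this

/-- Near the corner with A₀ the equation x⁻¹ of the section becomes y²/x, because x⁻¹ = (y²/x) y⁻¹
y⁻¹ and y⁻¹ is not constant along it. -/
theorem sectionCurve_eq_lineRing : sectionCurve = lineRing yK⁻¹ (xK / yK ^ 2)⁻¹ := by
  have h := coord_sectionCorner
  refine lineRing_eq coord_section h.swap ?_ ?_ ?_ ?_
  · exact coord_section.isGeneric.inv coord_section.isLocalAlgebra_lineRing
  · exact small_inv_sectionCurve 0
  · have := h.swap.isGeneric.inv h.swap.isLocalAlgebra_lineRing
    rwa [inv_inv] at this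
  · have := (h.swap.small.mul_right h.swap.isGeneric.1).mul_right h.swap.isGeneric.1
    convert this using 1
    have := yK_ne_zero
    have := xK_ne_zero
    field_simp

theorem areAxesAt_sectionCorner : AreAxesAt sectionCorner (fiberCurve c 0) sectionCurve :=
  ⟨_, _, coord_sectionCorner, rfl, fiberCurve_zero_eq_lineRing c, sectionCurve_eq_lineRing⟩

end Fiber

/-! ### Which points lie on which curves. -/

section Incidence

variable {c d : ℕ → ℂ} {n m : ℕ} {a : ℂ}

theorem hasValue_chain_fiberCurve (h : n < m) : HasValue (fiberCurve c m) (chain c n) (c n) :=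
  hasValue_chain_of_mem (isLocalAlgebra_fiberCurve c m) (small_fiberCurve c m)
    (coord_chain c m).isGeneric.1 h

theorem small_chain_inv_fiberCurve (h : m < n) : Small (fiberCurve c m) (chain c n)⁻¹ :=
  small_chain_inv_of_not_hasValue (isLocalAlgebra_fiberCurve c m) (small_fiberCurve c m)
    (coord_chain c m).isGeneric.1 ((coord_chain c m).isGeneric.2 _) h

/-- The function w₀ = x/y² does not depend on the branch. On components beyond the zeroth it has the
constant value d 0 of their own branch, so the functions of the other branch have poles there. -/
theorem small_chain_inv_fiberCurve_of_ne (hcd : c 0 ≠ d 0) (hm : 0 < m) (hn : 0 < n) :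
    Small (fiberCurve d m) (chain c n)⁻¹ := by
  have hd : HasValue (fiberCurve d m) (chain c 0) (d 0) := hasValue_chain_fiberCurve (c := d) hm
  exact small_chain_inv_of_not_hasValue (isLocalAlgebra_fiberCurve d m) (small_fiberCurve d m)
    (hd.mem (isLocalAlgebra_fiberCurve d m))
    (fun h => hcd (h.unique (isLocalAlgebra_fiberCurve d m) hd)) hn

/-- On an earlier component w_n has a pole; on a later one (w_n - c_n)⁻¹ does, and this function is
regular at the point unless the point is the center. The second alternative in `ha` covers
comparisons in which later components do not occur. -/
theorem eq_of_fiberPoint_le (h : fiberPoint c n a ≤ fiberCurve c m) (ha : a ≠ c n ∨ m ≤ n) :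
    m = n := by
  have hF := isLocalAlgebra_fiberPoint c n a
  have hv := hasValue_fiberPoint c n a
  rcases lt_trichotomy m n with hmn | rfl | hmn
  · exact absurd h (not_le_of_small_inv (hv.mem hF) (chain_ne_zero c n)
      (small_chain_inv_fiberCurve hmn))
  · rfl
  · refine absurd h (not_le_of_small_inv (z := (chain c n - algebraMap ℂ K (c n))⁻¹)
      (inv_mem_of_not_small ((fiberPoint c n a).sub_mem (hv.mem hF) (hF.1 _)) fun hs => ?_)
      (inv_ne_zero (chain_sub_ne_zero _ _ _)) ?_)
    · exact ha.resolve_right (by omega) (hv.unique hF hs)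
    · rw [inv_inv]
      exact hasValue_chain_fiberCurve hmn

theorem not_fiberPoint_le (hcd : c 0 ≠ d 0) (hm : 0 < m) (hn : 0 < n) :
    ¬ fiberPoint c n a ≤ fiberCurve d m :=
  not_le_of_small_inv ((hasValue_fiberPoint c n a).mem (isLocalAlgebra_fiberPoint c n a))
    (chain_ne_zero c n) (small_chain_inv_fiberCurve_of_ne hcd hm hn)

theorem eq_of_corner_le (h : corner c n ≤ fiberCurve c m) : m = n ∨ m = n + 1 := by
  have hF := isLocalAlgebra_corner c n
  rcases lt_or_ge m n with hmn | hmn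
  · exact absurd h (not_le_of_small_inv ((hasValue_corner c n).mem hF) (chain_ne_zero c n)
      (small_chain_inv_fiberCurve hmn))
  rcases lt_or_ge (n + 1) m with hmn' | hmn'
  · exact absurd h (not_le_of_small_inv_of_hasValue hF (chain_ne_zero c (n + 1))
      (small_inv_corner c n) (chain_sub_ne_zero _ _ _) (hasValue_chain_fiberCurve hmn'))
  · omega

theorem not_corner_le (hcd : c 0 ≠ d 0) (hm : 0 < m) : ¬ corner c n ≤ fiberCurve d m := by
  have hF := isLocalAlgebra_corner c n
  have hv := hasValue_corner c n
  rcases Nat.eq_zero_or_pos n with rfl | hn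
  -- At n = 0 the function w₀ itself is regular on the other branch, so the pole must come from (w₀
  -- - d 0)⁻¹.
  · refine not_le_of_small_inv (z := (chain c 0 - algebraMap ℂ K (d 0))⁻¹)
      (inv_mem_of_not_small ((corner c 0).sub_mem (hv.mem hF) (hF.1 _)) fun hs => ?_)
      (inv_ne_zero (chain_sub_ne_zero _ _ _)) ?_
    · exact hcd (hv.unique hF hs)
    · rw [inv_inv]
      exact hasValue_chain_fiberCurve (c := d) hm
  · exact not_le_of_small_inv (hv.mem hF) (chain_ne_zero c n)
      (small_chain_inv_fiberCurve_of_ne hcd hm hn)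

theorem eq_zero_of_sectionCorner_le (h : sectionCorner ≤ fiberCurve c m) : m = 0 := by
  by_contra hm
  exact not_le_of_small_inv_of_hasValue isLocalAlgebra_sectionCorner
      (chain_ne_zero c 0) (small_inv_sectionCorner c) (chain_sub_ne_zero _ _ _)
      (hasValue_chain_fiberCurve (Nat.pos_of_ne_zero hm)) h

theorem not_le_fiberCurve_of_yK_mem {R : Subring K} (h : yK ∈ R) : ¬ R ≤ fiberCurve c m :=
  not_le_of_small_inv h yK_ne_zero (small_fiberCurve c m)

theorem not_le_sectionCurve_of_chain_mem {R : Subring K} (h : chain c 0 ∈ R) :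
    ¬ R ≤ sectionCurve :=
  not_le_of_small_inv h (chain_ne_zero c 0) (small_inv_sectionCurve c)

theorem chain_zero_mem_of_hasValue {R : Subring K} (hR : IsLocalAlgebra R) (hy : Small R yK⁻¹)
    (h : HasValue R (chain c n) a) : chain c 0 ∈ R := by
  rcases Nat.eq_zero_or_pos n with rfl | hn
  · exact h.mem hR
  · exact (hasValue_chain_of_mem hR hy (h.mem hR) hn).mem hR

theorem not_fiberPoint_le_sectionCurve : ¬ fiberPoint c n a ≤ sectionCurve :=
  not_le_sectionCurve_of_chain_mem (chain_zero_mem_of_hasValue (isLocalAlgebra_fiberPoint c n a)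
    (small_fiberPoint c n a) (hasValue_fiberPoint c n a))

theorem not_corner_le_sectionCurve : ¬ corner c n ≤ sectionCurve :=
  not_le_sectionCurve_of_chain_mem (chain_zero_mem_of_hasValue (isLocalAlgebra_corner c n)
    (small_corner c n) (hasValue_corner c n))

end Incidence

/-! ### The two branches of centers and the stages of the blow-up. -/

/-- The values determining the centers over `P₂`. -/
noncomputable def seqA (j : ℕ → ℂ) : ℕ → ℂ
  | 3 => 16 * j 1
  | 4 => 32 * j 2
  | 5 => 128 * j 3 - 768 * j 0 * j 1
  | _ => 0

/-- The values determining the centers over `P₁`. -/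
noncomputable def seqB (j : ℕ → ℂ) : ℕ → ℂ
  | 0 => 1 / 4
  | 2 => -12 * j 0
  | _ => 0

theorem seqA_zero_ne_seqB_zero (j : ℕ → ℂ) : seqA j 0 ≠ seqB j 0 := by simp [seqA, seqB]

/-- The branch on which the `k`-th center lies, `2 ≤ k`. -/
noncomputable def centerSeq (j : ℕ → ℂ) (k : ℕ) : ℕ → ℂ := if k < 5 then seqB j else seqA j

/-- The fibre component on which the `k`-th center lies, `2 ≤ k`. -/
def centerIdx (k : ℕ) : ℕ := if k < 5 then k - 2 else k - 4

/-- The `k`-th center, `2 ≤ k`. -/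
noncomputable def centerPoint (j : ℕ → ℂ) (k : ℕ) : Subring K :=
  fiberPoint (centerSeq j k) (centerIdx k) (centerSeq j k (centerIdx k))

theorem chain_one {c : ℕ → ℂ} (hc : c 0 = 0) : chain c 1 = xK / yK := by
  have := yK_ne_zero
  rw [chain_succ, chain_zero, hc, map_zero]
  field_simp
  ring

theorem chain_seqA_two (j : ℕ → ℂ) : chain (seqA j) 2 = xK := by
  rw [chain_succ, chain_one rfl, show seqA j 1 = 0 from rfl, map_zero, sub_zero,
    div_mul_cancel₀ _ yK_ne_zero]

theorem chain_seqA_three (j : ℕ → ℂ) : chain (seqA j) 3 = xK * yK := by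
  rw [chain_succ, chain_seqA_two, show seqA j 2 = 0 from rfl, map_zero, sub_zero]

theorem chain_seqA_four (j : ℕ → ℂ) :
    chain (seqA j) 4 = (xK * yK - 16 * algebraMap ℂ K (j 1)) * yK := by
  rw [chain_succ, chain_seqA_three, show seqA j 3 = 16 * j 1 from rfl, map_mul, map_ofNat]

theorem chain_seqA_five (j : ℕ → ℂ) : chain (seqA j) 5 =
    ((xK * yK - 16 * algebraMap ℂ K (j 1)) * yK - 32 * algebraMap ℂ K (j 2)) * yK := by
  rw [chain_succ, chain_seqA_four, show seqA j 4 = 32 * j 2 from rfl, map_mul, map_ofNat]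

theorem chain_seqA_six (j : ℕ → ℂ) : chain (seqA j) 6 =
    (((xK * yK - 16 * algebraMap ℂ K (j 1)) * yK - 32 * algebraMap ℂ K (j 2)) * yK
      + 768 * algebraMap ℂ K (j 0) * algebraMap ℂ K (j 1) - 128 * algebraMap ℂ K (j 3)) * yK := by
  rw [chain_succ, chain_seqA_five, show seqA j 5 = 128 * j 3 - 768 * j 0 * j 1 from rfl]
  simp only [map_sub, map_mul, map_ofNat]
  ring

theorem chain_seqB_one (j : ℕ → ℂ) : chain (seqB j) 1 = (xK - yK ^ 2 / 4) / yK := by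
  have := yK_ne_zero
  rw [chain_succ, chain_zero, show seqB j 0 = 1 / 4 from rfl, map_div₀, map_one, map_ofNat]
  field_simp

theorem chain_seqB_two (j : ℕ → ℂ) : chain (seqB j) 2 = xK - yK ^ 2 / 4 := by
  rw [chain_succ, chain_seqB_one, show seqB j 1 = 0 from rfl, map_zero, sub_zero,
    div_mul_cancel₀ _ yK_ne_zero]

theorem chain_seqB_three (j : ℕ → ℂ) :
    chain (seqB j) 3 = (xK - yK ^ 2 / 4 + 12 * algebraMap ℂ K (j 0)) * yK := by
  rw [chain_succ, chain_seqB_two, show seqB j 2 = -12 * j 0 from rfl, map_mul, map_neg, map_ofNat]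
  ring

/-- From the third blow-up on, all centers have one form, so a single description of a blow-up
serves for all eight. -/
theorem center_eq (q : ℂ → ℂ) (t : ℂ) (k : Fin 10) (hk : 2 ≤ (k : ℕ)) :
    center q t k = (chain (centerSeq (jet q t) k) (centerIdx k) -
      algebraMap ℂ K (centerSeq (jet q t) k (centerIdx k)), yK⁻¹) := by
  have e : ∀ (z : K) (n : ℕ) (c : ℕ → ℂ), z = chain c n - algebraMap ℂ K (c n) →
      (z, 1 / yK) = (chain c n - algebraMap ℂ K (c n), yK⁻¹) := fun z n c h => by rw [h, one_div]
  fin_cases k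
  · simp at hk
  · simp at hk
  · refine e _ 0 (seqB (jet q t)) ?_
    rw [chain_zero, show seqB (jet q t) 0 = 1 / 4 from rfl, map_div₀, map_one, map_ofNat]
  · refine e _ 1 (seqB (jet q t)) ?_
    rw [chain_seqB_one, show seqB (jet q t) 1 = 0 from rfl, map_zero, sub_zero]
  · refine e _ 2 (seqB (jet q t)) ?_
    rw [chain_seqB_two, show seqB (jet q t) 2 = -12 * jet q t 0 from rfl, map_mul, map_neg,
      map_ofNat, neg_mul, sub_neg_eq_add]
    rfl
  · refine e _ 1 (seqA (jet q t)) ?_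
    rw [chain_one rfl, show seqA (jet q t) 1 = 0 from rfl, map_zero, sub_zero]
  · refine e _ 2 (seqA (jet q t)) ?_
    rw [chain_seqA_two, show seqA (jet q t) 2 = 0 from rfl, map_zero, sub_zero]
  · refine e _ 3 (seqA (jet q t)) ?_
    rw [chain_seqA_three, show seqA (jet q t) 3 = 16 * jet q t 1 from rfl, map_mul, map_ofNat]
    rfl
  · refine e _ 4 (seqA (jet q t)) ?_
    rw [chain_seqA_four, show seqA (jet q t) 4 = 32 * jet q t 2 from rfl, map_mul, map_ofNat]
    rfl
  · refine e _ 5 (seqA (jet q t)) ?_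
    rw [chain_seqA_five, show seqA (jet q t) 5 = 128 * jet q t 3 - 768 * jet q t 0 * jet q t 1
      from rfl, map_sub, map_mul, map_mul, map_mul, map_ofNat, map_ofNat, sub_sub_eq_add_sub]
    rfl

theorem pointRing_sub_const {u v : K} (h : Coord u v) (a : ℂ) :
    pointRing (u - algebraMap ℂ K a) v 0 0 = pointRing u v a 0 := by
  refine pointRing_eq (h.sub_const a) h ?_ ((h.sub_const a).hasValue_right 0 0)
    (hasValue_zero_iff.2 (h.hasValue_left a 0)) (h.hasValue_right a 0)
  have := (h.sub_const a).hasValue_left 0 0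
  rwa [hasValue_zero_iff] at this

/-- With u = w_n - c_n and v = 1/y, the quotient u/v is w_{n+1}. The exceptional curve is thus the
next component, and the origin of the chart (u, v/u) is its point at infinity, the corner. -/
theorem mem_blowUp_chain {S : Set (Subring K)} {c : ℕ → ℂ} {n : ℕ} {R : Subring K} :
    R ∈ blowUp S (chain c n - algebraMap ℂ K (c n)) yK⁻¹ ↔
      (R ∈ S ∧ R ≠ fiberPoint c n (c n)) ∨ (∃ a, R = fiberPoint c (n + 1) a) ∨ R = corner c n := by
  have h1 : (chain c n - algebraMap ℂ K (c n)) / yK⁻¹ = chain c (n + 1) := by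
    rw [chain_succ, div_inv_eq_mul]
  have h2 : yK⁻¹ / (chain c n - algebraMap ℂ K (c n)) = (chain c (n + 1))⁻¹ := by
    rw [← h1, inv_div]
  simp only [blowUp, h1, h2, pointRing_sub_const (coord_chain c n), Set.mem_union, Set.mem_sdiff,
    Set.mem_singleton_iff, Set.mem_ofPred_eq, or_assoc]
  rfl

theorem stage_succ (q : ℂ → ℂ) (t : ℂ) (k : Fin 10) :
    stage q t (k + 1) = blowUp (stage q t k) (center q t k).1 (center q t k).2 := by
  have hk : (k : ℕ) < (List.ofFn (center q t)).length := by simp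
  unfold stage
  rw [List.take_succ_eq_append_getElem hk, List.foldl_append, List.getElem_ofFn]
  rfl

theorem mem_stage_succ (q : ℂ → ℂ) (t : ℂ) {k : ℕ} (hk : 2 ≤ k) (hk' : k < 10) {R : Subring K} :
    R ∈ stage q t (k + 1) ↔ (R ∈ stage q t k ∧ R ≠ centerPoint (jet q t) k) ∨
      (∃ a, R = fiberPoint (centerSeq (jet q t) k) (centerIdx k + 1) a) ∨
      R = corner (centerSeq (jet q t) k) (centerIdx k) := by
  have h := stage_succ q t ⟨k, hk'⟩
  rw [center_eq q t ⟨k, hk'⟩ hk] at h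
  simp only at h
  rw [h, mem_blowUp_chain]
  rfl

theorem mem_stage_of_le (q : ℂ → ℂ) (t : ℂ) {k l : ℕ} (hk : 2 ≤ k) (hkl : k ≤ l) (hl : l ≤ 10)
    {R : Subring K} (h : R ∈ stage q t k)
    (hR : ∀ m, k ≤ m → m < l → R ≠ centerPoint (jet q t) m) : R ∈ stage q t l := by
  induction l, hkl using Nat.le_induction with
  | base => exact h
  | succ l hkl ih =>
    refine (mem_stage_succ q t (hk.trans hkl) (by omega)).2 (Or.inl ⟨ih (by omega) ?_, ?_⟩)
    · exact fun m h1 h2 => hR m h1 (by omega)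
    · exact hR l hkl (by omega)

/-- Points are sorted by the blow-up that created them last; it remains to record that no later
center removed them. -/
theorem mem_stage_cases (q : ℂ → ℂ) (t : ℂ) {l : ℕ} (hkl : 2 ≤ l) (hl : l ≤ 10)
    {R : Subring K} (h : R ∈ stage q t l) :
    (R ∈ stage q t 2 ∧ ∀ m, 2 ≤ m → m < l → R ≠ centerPoint (jet q t) m) ∨
    ∃ m, 2 ≤ m ∧ m < l ∧ ((∃ a, R = fiberPoint (centerSeq (jet q t) m) (centerIdx m + 1) a) ∨
      R = corner (centerSeq (jet q t) m) (centerIdx m)) ∧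
      ∀ m', m < m' → m' < l → R ≠ centerPoint (jet q t) m' := by
  induction l, hkl using Nat.le_induction with
  | base => exact Or.inl ⟨h, fun m h1 h2 => by omega⟩
  | succ l hkl ih =>
    have hlast : ∀ {P : ℕ → Prop}, (∀ m, P m → m < l → R ≠ centerPoint (jet q t) m) →
        R ≠ centerPoint (jet q t) l →
        ∀ m, P m → m < l + 1 → R ≠ centerPoint (jet q t) m := fun h1 h2 m hm hm' => by
      rcases Nat.lt_succ_iff_lt_or_eq.1 hm' with h | rfl
      exacts [h1 m hm h, h2]
    rcases (mem_stage_succ q t hkl (by omega)).1 h with ⟨h1, h2⟩ | h1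
    · rcases ih (by omega) h1 with ⟨h3, h4⟩ | ⟨m, h3, h4, h5, h6⟩
      · exact Or.inl ⟨h3, hlast h4 h2⟩
      · exact Or.inr ⟨m, h3, by omega, h5, hlast h6 h2⟩
    · exact Or.inr ⟨l, hkl, by omega, h1, fun m' h2 h3 => by omega⟩

/-! ### The first two blow-ups -/

theorem coord_xy_inv : Coord (xK / yK) yK⁻¹ := by
  rw [← chain_one (c := 0) rfl]
  exact coord_chain 0 1

theorem coord_inv_yx : Coord xK⁻¹ (yK / xK) := coord_xK_yK.div_right.inv_left

theorem coord_yx_inv : Coord (yK / xK) yK⁻¹ := by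
  have := coord_xy_inv.inv_left
  rwa [inv_div] at this

theorem ne_of_mem_of_small_inv {R R' : Subring K} {z : K} (h : z ∈ R) (h0 : z ≠ 0)
    (h' : Small R' z⁻¹) : R ≠ R' := by
  rintro rfl
  exact h'.notMem_of_inv h0 h

theorem pointRing_inv_yx_eq_plane {a : ℂ} (ha : a ≠ 0) (b : ℂ) :
    pointRing xK⁻¹ (yK / xK) a b = pointRing xK yK a⁻¹ (b * a⁻¹) := by
  have h := coord_inv_yx
  have h' := coord_xK_yK
  have hR := h.isLocalAlgebra_pointRing a b
  have hR' := h'.isLocalAlgebra_pointRing a⁻¹ (b * a⁻¹)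
  have hx := (h.hasValue_left a b).inv hR ha
  rw [inv_inv] at hx
  have hx' := (h'.hasValue_left a⁻¹ (b * a⁻¹)).inv hR' (inv_ne_zero ha)
  rw [inv_inv] at hx'
  have hy := (h.hasValue_right a b).mul hR hx
  rw [div_mul_cancel₀ _ xK_ne_zero] at hy
  have hy' := (h'.hasValue_right a⁻¹ (b * a⁻¹)).mul hR' hx'
  rw [← div_eq_mul_inv yK, inv_mul_cancel_right₀ ha] at hy'
  exact pointRing_eq h h' hx hy hx' hy'

theorem pointRing_inv_yx_eq_line {b : ℂ} (hb : b ≠ 0) :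
    pointRing xK⁻¹ (yK / xK) 0 b = pointRing (xK / yK) yK⁻¹ b⁻¹ 0 := by
  have h := coord_inv_yx
  have h' := coord_xy_inv
  have hR := h.isLocalAlgebra_pointRing 0 b
  have hR' := h'.isLocalAlgebra_pointRing b⁻¹ 0
  have hx := (h.hasValue_right 0 b).inv hR hb
  rw [inv_div] at hx
  have hx' := (h'.hasValue_left b⁻¹ 0).inv hR' (inv_ne_zero hb)
  rw [inv_div, inv_inv] at hx'
  have hy := (h.hasValue_left 0 b).mul hR hx
  rw [zero_mul, div_eq_mul_inv xK, inv_mul_cancel_left₀ xK_ne_zero] at hy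
  have hy' := (h'.hasValue_right b⁻¹ 0).mul hR' hx'
  rw [zero_mul, div_eq_mul_inv yK, inv_mul_cancel_left₀ yK_ne_zero] at hy'
  exact pointRing_eq h h' hx hy hy' hx'

theorem pointRing_xy_inv_eq_plane (a : ℂ) {b : ℂ} (hb : b ≠ 0) :
    pointRing (xK / yK) yK⁻¹ a b = pointRing xK yK (a * b⁻¹) b⁻¹ := by
  have h := coord_xy_inv
  have h' := coord_xK_yK
  have hR := h.isLocalAlgebra_pointRing a b
  have hR' := h'.isLocalAlgebra_pointRing (a * b⁻¹) b⁻¹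
  have hy := (h.hasValue_right a b).inv hR hb
  rw [inv_inv] at hy
  have hy' := (h'.hasValue_right (a * b⁻¹) b⁻¹).inv hR' (inv_ne_zero hb)
  rw [inv_inv] at hy'
  have hx := (h.hasValue_left a b).mul hR hy
  rw [div_mul_cancel₀ _ yK_ne_zero] at hx
  have hx' := (h'.hasValue_left (a * b⁻¹) b⁻¹).mul hR' hy'
  rw [← div_eq_mul_inv xK, inv_mul_cancel_right₀ hb] at hx'
  exact pointRing_eq h h' hx hy hx' hy'

/-- The plane is the disjoint union of the affine plane, the line at infinity in the coordinate x/y,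
and its one remaining point, which is the first center. -/
theorem mem_projectivePlane {R : Subring K} : R ∈ projectivePlane ↔
    (∃ a b, R = pointRing xK yK a b) ∨ R = pointRing xK⁻¹ (yK / xK) 0 0 ∨
      ∃ a, R = pointRing (xK / yK) yK⁻¹ a 0 := by
  simp only [projectivePlane, affinePlane, one_div, Set.mem_union, Set.mem_ofPred_eq, or_assoc]
  constructor
  · rintro (h | ⟨a, b, rfl⟩ | ⟨a, b, rfl⟩)
    · exact Or.inl h
    · by_cases ha : a = 0
      · subst ha
        by_cases hb : b = 0
        · subst hb
          exact Or.inr (Or.inl rfl)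
        · exact Or.inr (Or.inr ⟨_, pointRing_inv_yx_eq_line hb⟩)
      · exact Or.inl ⟨_, _, pointRing_inv_yx_eq_plane ha b⟩
    · by_cases hb : b = 0
      · subst hb
        exact Or.inr (Or.inr ⟨a, rfl⟩)
      · exact Or.inl ⟨_, _, pointRing_xy_inv_eq_plane a hb⟩
  · rintro (h | h | ⟨a, h⟩)
    · exact Or.inl h
    · exact Or.inr (Or.inl ⟨0, 0, h⟩)
    · exact Or.inr (Or.inr ⟨a, 0, h⟩)

theorem pointRing_inv_y_eq_sectionPoint {b : ℂ} (hb : b ≠ 0) :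
    pointRing yK⁻¹ (yK / xK) b 0 = sectionPoint b⁻¹ := by
  have h := coord_yx_inv.swap
  have h' := coord_section
  have hR := h.isLocalAlgebra_pointRing b 0
  have hR' := h'.isLocalAlgebra_pointRing b⁻¹ 0
  have hy := (h.hasValue_left b 0).inv hR hb
  rw [inv_inv] at hy
  have hy' := (h'.hasValue_left b⁻¹ 0).inv hR' (inv_ne_zero hb)
  rw [inv_inv] at hy'
  have hx := (h.hasValue_right b 0).mul hR (h.hasValue_left b 0)
  rw [zero_mul, mul_comm, div_eq_mul_inv, inv_mul_cancel_left₀ yK_ne_zero] at hx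
  have hx' := (h'.hasValue_left b⁻¹ 0).mul hR' (h'.hasValue_right b⁻¹ 0)
  rw [mul_zero, ← div_eq_mul_inv] at hx'
  exact pointRing_eq h h' hy hx hy' hx'

theorem pointRing_inv_chain_eq (c : ℕ → ℂ) {a : ℂ} (ha : a ≠ 0) :
    pointRing (xK / yK ^ 2)⁻¹ yK⁻¹ a 0 = fiberPoint c 0 a⁻¹ := by
  have h := coord_sectionCorner
  have h' := coord_chain c 0
  have hy := (h.hasValue_left a 0).inv (h.isLocalAlgebra_pointRing a 0) ha
  rw [inv_inv] at hy
  have hy' := (h'.hasValue_left a⁻¹ 0).inv (h'.isLocalAlgebra_pointRing a⁻¹ 0) (inv_ne_zero ha)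
  rw [inv_inv] at hy'
  exact pointRing_eq h h' hy (h.hasValue_right _ _) hy' (h'.hasValue_right _ _)

theorem mem_stage_zero (q : ℂ → ℂ) (t : ℂ) {R : Subring K} : R ∈ stage q t 0 ↔
    (∃ a b, R = pointRing xK yK a b) ∨ R = pointRing xK⁻¹ (yK / xK) 0 0 ∨
      ∃ a, R = fiberPoint (seqA (jet q t)) 1 a := by
  unfold fiberPoint
  rw [chain_one rfl]
  exact mem_projectivePlane

theorem mem_stage_one (q : ℂ → ℂ) (t : ℂ) {R : Subring K} : R ∈ stage q t 1 ↔
    (∃ a b, R = pointRing xK yK a b) ∨ (∃ a, R = fiberPoint (seqA (jet q t)) 1 a) ∨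
      (∃ b, R = sectionPoint b) ∨ R = pointRing (yK / xK) yK⁻¹ 0 0 := by
  have hx := xK_ne_zero
  have hy := yK_ne_zero
  have hc : center q t 0 = (xK⁻¹, yK / xK) := by simp [center]
  have h1 : stage q t 1 = blowUp (stage q t 0) _ _ := stage_succ q t 0
  rw [hc] at h1
  have e1 : xK⁻¹ / (yK / xK) = yK⁻¹ := by field_simp
  have e2 : yK / xK / xK⁻¹ = yK := by field_simp
  have e3 : pointRing xK⁻¹ yK 0 0 = sectionPoint 0 := coord_section.swap.pointRing_swap 0 0
  have e4 := coord_yx_inv.swap.pointRing_swap 0 0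
  rw [h1]
  simp only [blowUp, e1, e2, e3, Set.mem_union, Set.mem_sdiff,
    Set.mem_singleton_iff, Set.mem_ofPred_eq, or_assoc]
  rw [mem_stage_zero]
  have hp1 := coord_inv_yx.hasValue_left 0 0
  have hp2 := coord_inv_yx.hasValue_right 0 0
  rw [hasValue_zero_iff] at hp1 hp2
  constructor
  · rintro (⟨h | h | h, h'⟩ | ⟨b, rfl⟩ | h)
    · exact Or.inl h
    · exact absurd h h'
    · exact Or.inr (Or.inl h)
    · by_cases hb : b = 0
      · subst hb
        exact Or.inr (Or.inr (Or.inr e4))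
      · exact Or.inr (Or.inr (Or.inl ⟨_, pointRing_inv_y_eq_sectionPoint hb⟩))
    · exact Or.inr (Or.inr (Or.inl ⟨0, h⟩))
  · rintro (⟨a, b, rfl⟩ | ⟨a, rfl⟩ | ⟨b, rfl⟩ | rfl)
    · exact Or.inl ⟨Or.inl ⟨a, b, rfl⟩, ne_of_mem_of_small_inv
        ((coord_xK_yK.hasValue_left a b).mem (coord_xK_yK.isLocalAlgebra_pointRing a b)) hx hp1⟩
    · refine Or.inl ⟨Or.inr (Or.inr ⟨a, rfl⟩), ne_of_mem_of_small_inv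
        ((hasValue_fiberPoint _ 1 a).mem (isLocalAlgebra_fiberPoint _ _ _))
        (chain_ne_zero _ _) ?_⟩
      rw [chain_one rfl, inv_div]
      exact hp2
    · by_cases hb : b = 0
      · subst hb
        exact Or.inr (Or.inr rfl)
      · refine Or.inr (Or.inl ⟨b⁻¹, ?_⟩)
        rw [pointRing_inv_y_eq_sectionPoint (inv_ne_zero hb), inv_inv]
    · exact Or.inr (Or.inl ⟨0, e4.symm⟩)

/-- The new curve A₀ has the coordinate y²/x in one chart. Its value 0 is the corner with the
section, its value ∞ the corner with the line at infinity; that is why the coordinate a = 0 of x/y²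
is excluded. -/
theorem mem_stage_two (q : ℂ → ℂ) (t : ℂ) {R : Subring K} : R ∈ stage q t 2 ↔
    (∃ a b, R = pointRing xK yK a b) ∨ (∃ a, R = fiberPoint (seqA (jet q t)) 1 a) ∨
      (∃ b, R = sectionPoint b) ∨ (∃ a, a ≠ 0 ∧ R = fiberPoint (seqA (jet q t)) 0 a) ∨
      R = sectionCorner ∨ R = corner (seqA (jet q t)) 0 := by
  have hx := xK_ne_zero
  have hy := yK_ne_zero
  have hc : center q t 1 = (yK / xK, yK⁻¹) := by simp [center]
  have h1 : stage q t 2 = blowUp (stage q t 1) _ _ := stage_succ q t 1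
  rw [hc] at h1
  have e1 : yK / xK / yK⁻¹ = (xK / yK ^ 2)⁻¹ := by field_simp
  have e2 : yK⁻¹ / (yK / xK) = xK / yK ^ 2 := by field_simp
  have e3 : pointRing (yK / xK) (xK / yK ^ 2) 0 0 = corner (seqA (jet q t)) 0 := by
    have := (coord_corner (seqA (jet q t)) 0).swap.pointRing_swap 0 0
    rw [chain_one rfl, inv_div] at this
    rw [corner, chain_one rfl, inv_div, ← this]
    simp [seqA, chain_zero]
  rw [h1]
  simp only [blowUp, e1, e2, e3, Set.mem_union, Set.mem_sdiff,
    Set.mem_singleton_iff, Set.mem_ofPred_eq, or_assoc]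
  rw [mem_stage_one]
  have hp1 := coord_yx_inv.hasValue_left 0 0
  have hp2 := coord_yx_inv.hasValue_right 0 0
  rw [hasValue_zero_iff] at hp1 hp2
  constructor
  · rintro (⟨h | h | h | h, h'⟩ | ⟨b, rfl⟩ | h)
    · exact Or.inl h
    · exact Or.inr (Or.inl h)
    · exact Or.inr (Or.inr (Or.inl h))
    · exact absurd h h'
    · by_cases hb : b = 0
      · subst hb
        exact Or.inr (Or.inr (Or.inr (Or.inr (Or.inl rfl))))
      · exact Or.inr (Or.inr (Or.inr (Or.inl ⟨_, inv_ne_zero hb, pointRing_inv_chain_eq _ hb⟩)))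
    · exact Or.inr (Or.inr (Or.inr (Or.inr (Or.inr h))))
  · rintro (⟨a, b, rfl⟩ | ⟨a, rfl⟩ | ⟨b, rfl⟩ | ⟨a, ha, rfl⟩ | rfl | rfl)
    · exact Or.inl ⟨Or.inl ⟨a, b, rfl⟩, ne_of_mem_of_small_inv
        ((coord_xK_yK.hasValue_right a b).mem (coord_xK_yK.isLocalAlgebra_pointRing a b)) hy hp2⟩
    · refine Or.inl ⟨Or.inr (Or.inl ⟨a, rfl⟩), ne_of_mem_of_small_inv
        ((hasValue_fiberPoint _ 1 a).mem (isLocalAlgebra_fiberPoint _ _ _))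
        (chain_ne_zero _ _) ?_⟩
      rw [chain_one rfl, inv_div]
      exact hp1
    · exact Or.inl ⟨Or.inr (Or.inr (Or.inl ⟨b, rfl⟩)), ne_of_mem_of_small_inv
        ((coord_section.hasValue_left b 0).mem (isLocalAlgebra_sectionPoint b)) hy hp2⟩
    · refine Or.inr (Or.inl ⟨a⁻¹, ?_⟩)
      rw [pointRing_inv_chain_eq (seqA (jet q t)) (inv_ne_zero ha), inv_inv]
    · exact Or.inr (Or.inl ⟨0, rfl⟩)
    · exact Or.inr (Or.inr rfl)

/-! ### The points of the surface -/

theorem not_hasValue_chain {R : Subring K} (hR : IsLocalAlgebra R) (hy : Small R yK⁻¹)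
    {c : ℕ → ℂ} {n m : ℕ} {a : ℂ} (h : HasValue R (chain c n) a) (ha : a ≠ c n) (hm : n ≤ m) :
    ¬ HasValue R (chain c m) (c m) := by
  have h' : ¬ HasValue R (chain c n) (c n) := fun h' => ha (h.unique hR h')
  rcases hm.eq_or_lt with rfl | hm
  · exact h'
  · exact not_hasValue_of_small_inv hR (chain_ne_zero _ _)
      (small_chain_inv_of_not_hasValue hR hy (h.mem hR) h' hm) _

theorem ne_fiberPoint_of_not_hasValue {R : Subring K} {c : ℕ → ℂ} {m : ℕ}
    (h : ¬ HasValue R (chain c m) (c m)) : R ≠ fiberPoint c m (c m) := by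
  rintro rfl
  exact h (hasValue_fiberPoint _ _ _)

/-- Points of one branch are not touched by the centers of the other: x/y² takes the value c 0
there, hence avoids d 0, and the functions after it have poles. -/
theorem ne_fiberPoint_of_ne_zero {R : Subring K} (hR : IsLocalAlgebra R) (hy : Small R yK⁻¹)
    {c d : ℕ → ℂ} (hcd : c 0 ≠ d 0) {n m : ℕ} (h : HasValue R (chain c n) (c n)) :
    R ≠ fiberPoint d m (d m) := by
  refine ne_fiberPoint_of_not_hasValue (not_hasValue_chain hR hy (n := 0) (a := c 0) ?_ hcd
    m.zero_le)
  rcases Nat.eq_zero_or_pos n with rfl | hn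
  · exact h
  · exact hasValue_chain_of_mem (c := c) hR hy (h.mem hR) hn

theorem hasValue_chain_zero_fiberPoint (c : ℕ → ℂ) {n : ℕ} (hn : 0 < n) (a : ℂ) :
    HasValue (fiberPoint c n a) (chain c 0) (c 0) :=
  hasValue_chain_of_mem (isLocalAlgebra_fiberPoint c n a) (small_fiberPoint c n a)
    ((hasValue_fiberPoint c n a).mem (isLocalAlgebra_fiberPoint c n a)) hn

theorem ne_centerPoint_of_yK_mem {R : Subring K} (h : yK ∈ R) (j : ℕ → ℂ) (m : ℕ) :
    R ≠ centerPoint j m :=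
  ne_of_mem_of_small_inv h yK_ne_zero (small_fiberPoint _ _ _)

section Surface

variable (q : ℂ → ℂ) (t : ℂ)

/-- On each component only the center is missing, having been replaced by the corner with the next
component. The bounds 6 and 3 belong to the last exceptional curves, on which nothing is blown up.
A₀ is the common start of both branches and therefore lacks two values. -/
theorem surface_cases {R : Subring K} (h : R ∈ surface q t) :
    (∃ a b, R = pointRing xK yK a b) ∨ (∃ b, R = sectionPoint b) ∨ R = sectionCorner ∨
    (∃ n a, n ≤ 6 ∧ (n < 6 → a ≠ seqA (jet q t) n) ∧ (n = 0 → a ≠ seqB (jet q t) 0) ∧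
      R = fiberPoint (seqA (jet q t)) n a) ∨
    (∃ n a, 0 < n ∧ n ≤ 3 ∧ (n < 3 → a ≠ seqB (jet q t) n) ∧
      R = fiberPoint (seqB (jet q t)) n a) ∨
    (∃ n ≤ 5, R = corner (seqA (jet q t)) n) ∨ (∃ n ≤ 2, R = corner (seqB (jet q t)) n) := by
  rcases mem_stage_cases q t (by norm_num) le_rfl h with ⟨h1, h2⟩ | ⟨m, hm, hm', h1, h2⟩
  · rcases (mem_stage_two q t).1 h1 with h | ⟨a, rfl⟩ | h | ⟨a, ha, rfl⟩ | h | h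
    · exact Or.inl h
    · refine Or.inr (Or.inr (Or.inr (Or.inl ⟨1, a, by norm_num, fun _ => ?_, by norm_num, rfl⟩)))
      rintro rfl
      -- The point x/y = 0 of the line at infinity is the center with index 5.
      exact h2 5 (by norm_num) (by norm_num) rfl
    · exact Or.inr (Or.inl h)
    · refine Or.inr (Or.inr (Or.inr (Or.inl ⟨0, a, by norm_num, fun _ => ha, fun _ => ?_, rfl⟩)))
      rintro rfl
      -- The point x/y² = 1/4 of A₀ is the center with index 2.
      exact h2 2 (by norm_num) (by norm_num) rfl
    · exact Or.inr (Or.inr (Or.inl h))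
    · exact Or.inr (Or.inr (Or.inr (Or.inr (Or.inr (Or.inl ⟨0, by norm_num, h⟩)))))
  · have h3 : ∀ a, R = fiberPoint (centerSeq (jet q t) m) (centerIdx m + 1) a → m ≠ 4 → m ≠ 9 →
        a ≠ centerSeq (jet q t) m (centerIdx m + 1) := by
      rintro a rfl h4 h9 rfl
      refine h2 (m + 1) (by omega) (by omega) ?_
      unfold centerPoint centerSeq centerIdx
      by_cases h5 : m < 5
      · have h6 : m + 1 < 5 := by omega
        simp only [h5, h6, if_true]
        rw [show m + 1 - 2 = m - 2 + 1 by omega]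
      · have h6 : ¬ m + 1 < 5 := by omega
        simp only [h5, h6, if_false]
        rw [show m + 1 - 4 = m - 4 + 1 by omega]
    by_cases h5 : m < 5
    · simp only [centerSeq, centerIdx, if_pos h5] at h1 h3
      rcases h1 with ⟨a, h1⟩ | h1
      · exact Or.inr (Or.inr (Or.inr (Or.inr (Or.inl ⟨m - 2 + 1, a, by omega, by omega,
          fun hlt => h3 a h1 (by omega) (by omega), h1⟩))))
      · exact Or.inr (Or.inr (Or.inr (Or.inr (Or.inr (Or.inr ⟨m - 2, by omega, h1⟩)))))
    · simp only [centerSeq, centerIdx, if_neg h5] at h1 h3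
      rcases h1 with ⟨a, h1⟩ | h1
      · exact Or.inr (Or.inr (Or.inr (Or.inl ⟨m - 4 + 1, a, by omega,
          fun hlt => h3 a h1 (by omega) (by omega), by omega, h1⟩)))
      · exact Or.inr (Or.inr (Or.inr (Or.inr (Or.inr (Or.inl ⟨m - 4, by omega, h1⟩)))))

theorem plane_mem_surface (a b : ℂ) : pointRing xK yK a b ∈ surface q t :=
  mem_stage_of_le q t le_rfl (by norm_num) le_rfl ((mem_stage_two q t).2 (Or.inl ⟨a, b, rfl⟩))
    fun m _ _ => ne_centerPoint_of_yK_mem ((coord_xK_yK.hasValue_right a b).mem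
      (coord_xK_yK.isLocalAlgebra_pointRing a b)) _ _

theorem sectionPoint_mem_surface (b : ℂ) : sectionPoint b ∈ surface q t :=
  mem_stage_of_le q t le_rfl (by norm_num) le_rfl
    ((mem_stage_two q t).2 (Or.inr (Or.inr (Or.inl ⟨b, rfl⟩))))
    fun m _ _ => ne_centerPoint_of_yK_mem ((coord_section.hasValue_left b 0).mem
      (isLocalAlgebra_sectionPoint b)) _ _

theorem sectionCorner_mem_surface : sectionCorner ∈ surface q t :=
  mem_stage_of_le q t le_rfl (by norm_num) le_rfl
    ((mem_stage_two q t).2 (Or.inr (Or.inr (Or.inr (Or.inr (Or.inl rfl))))))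
    fun m _ _ => ne_fiberPoint_of_not_hasValue (not_hasValue_of_small_inv
      isLocalAlgebra_sectionCorner (chain_ne_zero _ _)
      (small_chain_inv_of_small_inv isLocalAlgebra_sectionCorner small_sectionCorner
        (small_inv_sectionCorner _) (Nat.zero_le _)) _)

theorem fiberPoint_zero_mem_surface {a : ℂ} (hA : a ≠ seqA (jet q t) 0)
    (hB : a ≠ seqB (jet q t) 0) : fiberPoint (seqA (jet q t)) 0 a ∈ surface q t :=
  mem_stage_of_le q t le_rfl (by norm_num) le_rfl
    ((mem_stage_two q t).2 (Or.inr (Or.inr (Or.inr (Or.inl ⟨a, hA, rfl⟩)))))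
    fun m _ _ => by
      refine ne_fiberPoint_of_not_hasValue (not_hasValue_chain (n := 0) (a := a)
        (isLocalAlgebra_fiberPoint _ _ _) (small_fiberPoint _ _ _)
        (hasValue_fiberPoint (seqA (jet q t)) 0 a) ?_ (Nat.zero_le _))
      unfold centerSeq
      split_ifs
      exacts [hB, hA]

theorem fiberPoint_seqB_mem_surface {n : ℕ} {a : ℂ} (h0 : 0 < n) (hn : n ≤ 3)
    (ha : n < 3 → a ≠ seqB (jet q t) n) : fiberPoint (seqB (jet q t)) n a ∈ surface q t := by
  have hF := isLocalAlgebra_fiberPoint (seqB (jet q t)) n a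
  have hy := small_fiberPoint (seqB (jet q t)) n a
  refine mem_stage_of_le q t (k := n + 1 + 1) (by omega) (by omega) le_rfl
    ((mem_stage_succ q t (k := n + 1) (by omega) (by omega)).2 (Or.inr (Or.inl ⟨a, ?_⟩)))
    fun m h1 h2 => ?_
  · rw [centerSeq, centerIdx, if_pos (by omega), if_pos (by omega),
      show n + 1 - 2 + 1 = n by omega]
  · unfold centerPoint centerSeq centerIdx
    split_ifs with h5
    · exact ne_fiberPoint_of_not_hasValue (not_hasValue_chain hF hy
        (hasValue_fiberPoint _ n a) (ha (by omega)) (by omega))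
    · exact ne_fiberPoint_of_ne_zero (n := 0) hF hy (seqA_zero_ne_seqB_zero _).symm
        (hasValue_chain_zero_fiberPoint _ h0 a)

theorem fiberPoint_seqA_mem_stage_two (a : ℂ) : fiberPoint (seqA (jet q t)) 1 a ∈ stage q t 2 :=
  (mem_stage_two q t).2 (Or.inr (Or.inl ⟨a, rfl⟩))

theorem fiberPoint_seqA_mem_stage {n : ℕ} (a : ℂ) (h0 : 0 < n) (hn : n ≤ 6) :
    fiberPoint (seqA (jet q t)) n a ∈ stage q t (n + 4) := by
  rcases Nat.lt_or_ge 1 n with h1 | h1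
  · refine (mem_stage_succ q t (k := n + 3) (by omega) (by omega)).2 (Or.inr (Or.inl ⟨a, ?_⟩))
    rw [centerSeq, centerIdx, if_neg (by omega), if_neg (by omega),
      show n + 3 - 4 + 1 = n by omega]
  · obtain rfl : n = 1 := by omega
    -- For n = 1 the component is the line at infinity, present from the start; the centers with
    -- indices 2, 3, 4 lie on the other branch and do not touch it.
    refine mem_stage_of_le q t le_rfl (by norm_num) (by norm_num)
      (fiberPoint_seqA_mem_stage_two q t a) fun m h1 h2 => ?_
    unfold centerPoint centerSeq centerIdx
    rw [if_pos h2, if_pos h2]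
    exact ne_fiberPoint_of_ne_zero (n := 0) (isLocalAlgebra_fiberPoint _ _ _)
      (small_fiberPoint _ _ _) (seqA_zero_ne_seqB_zero _)
      (hasValue_chain_zero_fiberPoint _ h0 a)

theorem fiberPoint_seqA_mem_surface {n : ℕ} {a : ℂ} (h0 : 0 < n) (hn : n ≤ 6)
    (ha : n < 6 → a ≠ seqA (jet q t) n) : fiberPoint (seqA (jet q t)) n a ∈ surface q t := by
  refine mem_stage_of_le q t (k := n + 4) (by omega) (by omega) le_rfl
    (fiberPoint_seqA_mem_stage q t a h0 hn) fun m h1 h2 => ?_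
  unfold centerPoint centerSeq centerIdx
  rw [if_neg (by omega), if_neg (by omega)]
  exact ne_fiberPoint_of_not_hasValue (not_hasValue_chain (isLocalAlgebra_fiberPoint _ _ _)
    (small_fiberPoint _ _ _) (hasValue_fiberPoint _ n a) (ha (by omega)) (by omega))

theorem corner_seqB_mem_surface {n : ℕ} (hn : n ≤ 2) : corner (seqB (jet q t)) n ∈ surface q t := by
  have hF := isLocalAlgebra_corner (seqB (jet q t)) n
  have hy := small_corner (seqB (jet q t)) n
  refine mem_stage_of_le q t (k := n + 2 + 1) (by omega) (by omega) le_rfl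
    ((mem_stage_succ q t (k := n + 2) (by omega) (by omega)).2 (Or.inr (Or.inr ?_)))
    fun m h1 h2 => ?_
  · rw [centerSeq, centerIdx, if_pos (by omega), if_pos (by omega), Nat.add_sub_cancel]
  · unfold centerPoint centerSeq centerIdx
    split_ifs with h5
    · exact ne_fiberPoint_of_not_hasValue (not_hasValue_of_small_inv hF (chain_ne_zero _ _)
        (small_chain_inv_of_small_inv hF hy (small_inv_corner _ n) (by omega)) _)
    · exact ne_fiberPoint_of_ne_zero hF hy (seqA_zero_ne_seqB_zero _).symm (hasValue_corner _ n)

theorem corner_seqA_mem_surface {n : ℕ} (hn : n ≤ 5) : corner (seqA (jet q t)) n ∈ surface q t := by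
  have hF := isLocalAlgebra_corner (seqA (jet q t)) n
  have hy := small_corner (seqA (jet q t)) n
  have hne : ∀ m, n + 5 ≤ m ∨ m < 5 ∨ n = 0 → corner (seqA (jet q t)) n ≠ centerPoint (jet q t) m := by
    intro m hm
    unfold centerPoint centerSeq centerIdx
    split_ifs with h5
    · exact ne_fiberPoint_of_ne_zero hF hy (seqA_zero_ne_seqB_zero _) (hasValue_corner _ n)
    · exact ne_fiberPoint_of_not_hasValue (not_hasValue_of_small_inv hF (chain_ne_zero _ _)
        (small_chain_inv_of_small_inv hF hy (small_inv_corner _ n) (by omega)) _)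
  rcases Nat.eq_zero_or_pos n with rfl | h0
  · exact mem_stage_of_le q t le_rfl (by norm_num) le_rfl
      ((mem_stage_two q t).2 (Or.inr (Or.inr (Or.inr (Or.inr (Or.inr rfl))))))
      fun m h1 h2 => hne m (Or.inr (Or.inr rfl))
  · refine mem_stage_of_le q t (k := n + 4 + 1) (by omega) (by omega) le_rfl
      ((mem_stage_succ q t (k := n + 4) (by omega) (by omega)).2 (Or.inr (Or.inr ?_)))
      fun m h1 h2 => hne m (Or.inl h1)
    rw [centerSeq, centerIdx, if_neg (by omega), if_neg (by omega), Nat.add_sub_cancel]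

theorem pointRing_center_mem_stage (k : Fin 10) :
    pointRing (center q t k).1 (center q t k).2 0 0 ∈ stage q t k := by
  rcases Nat.lt_or_ge 1 k with hk | hk
  · have hk2 : 2 ≤ (k : ℕ) := hk
    rw [center_eq q t k hk2]
    simp only
    rw [pointRing_sub_const (coord_chain _ _)]
    change centerPoint (jet q t) k ∈ _
    unfold centerPoint centerSeq centerIdx
    split_ifs with h5
    · rcases hk2.eq_or_lt with h2 | h2
      · rw [← h2]
        refine (mem_stage_two q t).2 (Or.inr (Or.inr (Or.inr (Or.inl ⟨_, ?_, rfl⟩))))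
        exact (seqA_zero_ne_seqB_zero (jet q t)).symm
      · obtain ⟨m, hm⟩ : ∃ m, (k : ℕ) = m + 1 := ⟨k - 1, by omega⟩
        rw [hm]
        refine (mem_stage_succ q t (by omega) (by omega)).2
          (Or.inr (Or.inl ⟨seqB (jet q t) (m + 1 - 2), ?_⟩))
        rw [centerSeq, centerIdx, if_pos (by omega), if_pos (by omega),
          show m + 1 - 2 = m - 2 + 1 by omega]
    · have := fiberPoint_seqA_mem_stage q t (n := k - 4) (seqA (jet q t) (k - 4)) (by omega)
        (by omega)
      rwa [Nat.sub_add_cancel (by omega)] at this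
  · have : k = 0 ∨ k = 1 := by omega
    rcases this with rfl | rfl
    · simp only [center, one_div]
      exact (mem_stage_zero q t).2 (Or.inr (Or.inl rfl))
    · simp only [center, one_div]
      exact (mem_stage_one q t).2 (Or.inr (Or.inr (Or.inr rfl)))

end Surface

/-! ### Self-intersection numbers of the components and of the section. -/

theorem hasIntersectionNumber_self_of_ne {S : Set (Subring K)} {C R₁ R₂ : Subring K} {f : K}
    (hf : f ≠ 0) (h₁ : R₁ ∈ S ∧ R₁ ≤ C) (h₂ : R₂ ∈ S ∧ R₂ ≤ C) (hne : R₁ ≠ R₂)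
    (hS : ∀ R ∈ S, R ≤ C → ∃ u v a e, Coord u v ∧ R = pointRing u v a 0 ∧ C = lineRing u v ∧
      e ∈ R ∧ e ≠ 0 ∧ e⁻¹ ∈ R ∧ (((R = R₁ ∨ R = R₂) ∧ f = v * ((u - algebraMap ℂ K a) * e)) ∨
        ((R ≠ R₁ ∧ R ≠ R₂) ∧ f = v * e))) :
    HasIntersectionNumber S C C (-2) := by
  classical
  have := hasIntersectionNumber_self (S := S) (C := C) {R₁, R₂} (by
    intro R hR
    rcases Finset.mem_insert.1 hR with rfl | hR
    · exact h₁
    · rw [Finset.mem_singleton.1 hR]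
      exact h₂) hf (by simpa only [Finset.mem_insert, Finset.mem_singleton, not_or] using hS)
  rwa [Finset.card_pair hne] at this

theorem corner_ne_corner_succ (c : ℕ → ℂ) (n : ℕ) : corner c n ≠ corner c (n + 1) := fun h => by
  have := eq_of_corner_le (h ▸ (areAxesAt_corner c n).isAxisAt.le :
    corner c (n + 1) ≤ fiberCurve c n)
  omega

theorem corner_ne_corner_of_ne {c d : ℕ → ℂ} (h : c 0 ≠ d 0) (n m : ℕ) :
    corner c n ≠ corner d m := fun he =>
  not_corner_le h m.succ_pos (he ▸ (areAxesAt_corner d m).symm.isAxisAt.le :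
    corner c n ≤ fiberCurve d (m + 1))

/-- A corner lies on two consecutive components, whereas a point with coordinate a ≠ c n lies on
only one of its branch. -/
theorem fiberPoint_ne_corner {c : ℕ → ℂ} {n : ℕ} {a : ℂ} (ha : a ≠ c n) (m : ℕ) :
    fiberPoint c n a ≠ corner c m := fun he => by
  have h1 := eq_of_fiberPoint_le (he ▸ (areAxesAt_corner c m).isAxisAt.le) (Or.inl ha)
  have h2 := eq_of_fiberPoint_le (he ▸ (areAxesAt_corner c m).symm.isAxisAt.le) (Or.inl ha)
  omega

theorem sectionCorner_ne_corner (c : ℕ → ℂ) (n : ℕ) : sectionCorner ≠ corner c n := fun he =>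
  not_corner_le_sectionCurve (he ▸ (areAxesAt_sectionCorner c).symm.isAxisAt.le)

theorem corner_eq_swap (c : ℕ → ℂ) (n : ℕ) :
    corner c n = pointRing (chain c (n + 1))⁻¹ (chain c n - algebraMap ℂ K (c n)) 0 0 :=
  (coord_corner c n).pointRing_swap 0 0

theorem yK_inv_eq_corner (c : ℕ → ℂ) (n : ℕ) : yK⁻¹ =
    (chain c (n + 1))⁻¹ * ((chain c n - algebraMap ℂ K (c n) - algebraMap ℂ K 0) * 1) := by
  rw [map_zero, sub_zero, mul_one, inv_chain_succ_mul]

theorem yK_inv_eq_corner' (c : ℕ → ℂ) (n : ℕ) : yK⁻¹ =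
    (chain c n - algebraMap ℂ K (c n)) * (((chain c (n + 1))⁻¹ - algebraMap ℂ K 0) * 1) := by
  rw [map_zero, sub_zero, mul_one, mul_comm, inv_chain_succ_mul]

/-- Take f = 1/y. It is an equation of the component at its ordinary points, and at each of the two
corners it is the product of the equations of the component and of its neighbour. -/
theorem hasIntersectionNumber_fiberCurve_succ {S : Set (Subring K)} {c : ℕ → ℂ} {n : ℕ}
    (h₁ : corner c n ∈ S) (h₂ : corner c (n + 1) ∈ S)
    (hS : ∀ R ∈ S, R ≤ fiberCurve c (n + 1) → (∃ a, a ≠ c (n + 1) ∧ R = fiberPoint c (n + 1) a) ∨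
      R = corner c n ∨ R = corner c (n + 1)) :
    HasIntersectionNumber S (fiberCurve c (n + 1)) (fiberCurve c (n + 1)) (-2) := by
  refine hasIntersectionNumber_self_of_ne (inv_ne_zero yK_ne_zero)
    ⟨h₁, (areAxesAt_corner c n).symm.isAxisAt.le⟩
    ⟨h₂, (areAxesAt_corner c (n + 1)).isAxisAt.le⟩ (corner_ne_corner_succ c n) fun R hR hle => ?_
  rcases hS R hR hle with ⟨a, ha, rfl⟩ | rfl | rfl
  · exact ⟨_, _, a, 1, coord_chain c (n + 1), rfl, rfl, Subring.one_mem _, one_ne_zero, by simp,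
      Or.inr ⟨⟨fiberPoint_ne_corner ha _, fiberPoint_ne_corner ha _⟩, (mul_one _).symm⟩⟩
  · exact ⟨_, _, 0, 1, (coord_corner c n).swap, corner_eq_swap c n,
      fiberCurve_succ_eq_lineRing c n, Subring.one_mem _, one_ne_zero, by simp,
      Or.inl ⟨Or.inl rfl, yK_inv_eq_corner' c n⟩⟩
  · exact ⟨_, _, 0, 1, coord_corner c (n + 1), rfl,
      fiberCurve_eq_lineRing c (n + 1), Subring.one_mem _, one_ne_zero, by simp,
      Or.inl ⟨Or.inr rfl, yK_inv_eq_corner c (n + 1)⟩⟩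

theorem hasIntersectionNumber_fiberCurve_zero {S : Set (Subring K)} {c d : ℕ → ℂ}
    (hcd : c 0 ≠ d 0) (h₁ : corner c 0 ∈ S) (h₂ : corner d 0 ∈ S)
    (hS : ∀ R ∈ S, R ≤ fiberCurve c 0 → (∃ a, a ≠ c 0 ∧ a ≠ d 0 ∧ R = fiberPoint c 0 a) ∨
      R = corner c 0 ∨ R = corner d 0 ∨ R = sectionCorner) :
    HasIntersectionNumber S (fiberCurve c 0) (fiberCurve c 0) (-2) := by
  refine hasIntersectionNumber_self_of_ne (inv_ne_zero yK_ne_zero)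
    ⟨h₁, (areAxesAt_corner c 0).isAxisAt.le⟩
    ⟨h₂, (areAxesAt_corner d 0).isAxisAt.le⟩ (corner_ne_corner_of_ne hcd 0 0) fun R hR hle => ?_
  rcases hS R hR hle with ⟨a, ha, ha', rfl⟩ | rfl | rfl | rfl
  · exact ⟨_, _, a, 1, coord_chain c 0, rfl, rfl, Subring.one_mem _, one_ne_zero, by simp,
      Or.inr ⟨⟨fiberPoint_ne_corner ha _, fiberPoint_ne_corner (c := d) ha' _⟩,
        (mul_one _).symm⟩⟩
  · exact ⟨_, _, 0, 1, coord_corner c 0, rfl,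
      fiberCurve_eq_lineRing c 0, Subring.one_mem _, one_ne_zero, by simp,
      Or.inl ⟨Or.inl rfl, yK_inv_eq_corner c 0⟩⟩
  · exact ⟨_, _, 0, 1, coord_corner d 0, rfl,
      fiberCurve_eq_lineRing d 0, Subring.one_mem _, one_ne_zero, by simp,
      Or.inl ⟨Or.inr rfl, yK_inv_eq_corner d 0⟩⟩
  -- The section is not part of the fibre, so at this corner 1/y is just the equation of A₀ and
  -- nothing is counted.
  · exact ⟨_, _, 0, 1, coord_sectionCorner, rfl, fiberCurve_zero_eq_lineRing c,
      Subring.one_mem _, one_ne_zero, by simp,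
      Or.inr ⟨⟨sectionCorner_ne_corner _ _, sectionCorner_ne_corner _ _⟩, (mul_one _).symm⟩⟩

theorem yK_mem_sectionPoint (b : ℂ) : yK ∈ sectionPoint b :=
  (coord_section.hasValue_left b 0).mem (isLocalAlgebra_sectionPoint b)

theorem sectionCorner_ne_sectionPoint (b : ℂ) : sectionCorner ≠ sectionPoint b :=
  (ne_of_mem_of_small_inv (yK_mem_sectionPoint b) yK_ne_zero small_sectionCorner).symm

theorem sectionPoint_injective : Function.Injective sectionPoint := fun a b h => by
  have h1 := coord_section.hasValue_left a 0
  have h2 := coord_section.hasValue_left b 0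
  change HasValue (sectionPoint a) _ _ at h1
  change HasValue (sectionPoint b) _ _ at h2
  rw [h] at h1
  exact h1.unique (isLocalAlgebra_sectionPoint b) h2

/-- The equation x⁻¹ must be corrected by a function of y with a double pole at y = ∞, where the
equation is y²/x. Any quadratic polynomial with two distinct zeros would do; y(y - 1) yields the two
counted points y = 0 and y = 1. -/
theorem hasIntersectionNumber_sectionCurve {S : Set (Subring K)}
    (h : ∀ b, sectionPoint b ∈ S)
    (hS : ∀ R ∈ S, R ≤ sectionCurve → (∃ b, R = sectionPoint b) ∨ R = sectionCorner) :
    HasIntersectionNumber S sectionCurve sectionCurve (-2) := by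
  have hx := xK_ne_zero
  have hy := yK_ne_zero
  have hy1 : yK - 1 ≠ 0 := by
    have := (coord_xK_yK.swap.sub_const 1).ne_zero_left
    rwa [map_one] at this
  refine hasIntersectionNumber_self_of_ne (f := xK⁻¹ * (yK * (yK - 1)))
    (mul_ne_zero (inv_ne_zero hx) (mul_ne_zero hy hy1))
    ⟨h 0, sectionPoint_le 0⟩ ⟨h 1, sectionPoint_le 1⟩
    (fun he => zero_ne_one (sectionPoint_injective he)) fun R hR hle => ?_
  rcases hS R hR hle with ⟨b, rfl⟩ | rfl
  · have hL := isLocalAlgebra_sectionPoint b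
    have hv : HasValue (sectionPoint b) yK b := coord_section.hasValue_left b 0
    have hv1 : HasValue (sectionPoint b) (yK - 1) (b - 1) := by
      have := hv.sub hL (hasValue_const 1)
      rwa [map_one] at this
    by_cases h0 : b = 0
    · have hb : b - 1 ≠ 0 := by simp [h0]
      refine ⟨_, _, b, yK - 1, coord_section, rfl, rfl, hv1.mem hL, hv1.ne_zero hL hb,
        hv1.inv_mem hL hb, Or.inl ⟨Or.inl (by rw [h0]), ?_⟩⟩
      rw [h0, map_zero, sub_zero]
    by_cases h1 : b = 1
    · refine ⟨_, _, b, yK, coord_section, rfl, rfl, hv.mem hL, hv.ne_zero hL h0,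
        hv.inv_mem hL h0, Or.inl ⟨Or.inr (by rw [h1]), ?_⟩⟩
      rw [h1, map_one, mul_comm yK]
    · have hv2 := hv.mul hL hv1
      have hb : b * (b - 1) ≠ 0 := mul_ne_zero h0 (sub_ne_zero.2 h1)
      exact ⟨_, _, b, _, coord_section, rfl, rfl, hv2.mem hL, hv2.ne_zero hL hb,
        hv2.inv_mem hL hb, Or.inr ⟨⟨sectionPoint_injective.ne h0, sectionPoint_injective.ne h1⟩,
          rfl⟩⟩
  -- Here x⁻¹y(y - 1) = (y²/x)(1 - y⁻¹), and the last factor has the value 1.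
  · have hL := isLocalAlgebra_sectionCorner
    have hv : HasValue sectionCorner (1 - yK⁻¹) (1 - 0) := by
      have := (hasValue_const (C := sectionCorner) 1).sub hL
        (hasValue_zero_iff.2 small_sectionCorner)
      rwa [map_one] at this
    have hb : (1 - 0 : ℂ) ≠ 0 := by norm_num
    refine ⟨_, _, 0, 1 - yK⁻¹, coord_sectionCorner.swap,
      coord_sectionCorner.pointRing_swap 0 0, sectionCurve_eq_lineRing, hv.mem hL,
      hv.ne_zero hL hb, hv.inv_mem hL hb, Or.inr ⟨⟨sectionCorner_ne_sectionPoint _,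
        sectionCorner_ne_sectionPoint _⟩, ?_⟩⟩
    field_simp

/-! ### The nine boundary curves as fibre components and section. -/

section Boundary

variable (q : ℂ → ℂ) (t : ℂ)

theorem exceptionalCurve_center (k : Fin 10) (hk : 2 ≤ (k : ℕ)) :
    exceptionalCurve (center q t k).1 (center q t k).2 =
      fiberCurve (centerSeq (jet q t) k) (centerIdx k + 1) := by
  rw [center_eq q t k hk, exceptionalCurve, div_inv_eq_mul, ← chain_succ]
  rfl

theorem exceptionalCurve_center_one :
    exceptionalCurve (center q t 1).1 (center q t 1).2 = fiberCurve (seqA (jet q t)) 0 := by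
  have hx := xK_ne_zero
  have hy := yK_ne_zero
  rw [fiberCurve_zero_eq_lineRing]
  simp only [center, exceptionalCurve, one_div, Matrix.cons_val_one, Matrix.cons_val_zero]
  congr 1
  field_simp

theorem exceptionalCurve_center_zero :
    exceptionalCurve (center q t 0).1 (center q t 0).2 = sectionCurve := by
  have hx := xK_ne_zero
  have hy := yK_ne_zero
  have e : xK⁻¹ / (yK / xK) = yK⁻¹ := by field_simp
  simp only [center, exceptionalCurve, one_div, Matrix.cons_val_zero, e]
  have h := coord_section
  have h' := coord_yx_inv.swap
  refine (lineRing_eq h h' (h.isGeneric.inv h.isLocalAlgebra_lineRing) ?_ ?_ ?_).symm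
  · have := h.small.mul_left h.isGeneric.1
    rwa [← div_eq_mul_inv] at this
  · have := h'.isGeneric.inv h'.isLocalAlgebra_lineRing
    rwa [inv_inv] at this
  · have := h'.small.mul_left h'.isGeneric.1
    rwa [div_eq_mul_inv, inv_mul_cancel_left₀ hy] at this

/-- The nodes 0, …, 7 run through A₅, …, A₁, A₀, B₁, B₂, with the line at infinity as A₁. Node 5 is
A₀ and belongs to both branches. -/
theorem boundaryCurve_cases (i : Fin 9) :
    ((i : ℕ) ≤ 5 ∧ boundaryCurve q t i = fiberCurve (seqA (jet q t)) (5 - i)) ∨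
    (5 ≤ (i : ℕ) ∧ (i : ℕ) ≤ 7 ∧ boundaryCurve q t i = fiberCurve (seqB (jet q t)) (i - 5)) ∨
    ((i : ℕ) = 8 ∧ boundaryCurve q t i = sectionCurve) := by
  fin_cases i
  · exact Or.inl ⟨by norm_num, exceptionalCurve_center q t 8 (by norm_num)⟩
  · exact Or.inl ⟨by norm_num, exceptionalCurve_center q t 7 (by norm_num)⟩
  · exact Or.inl ⟨by norm_num, exceptionalCurve_center q t 6 (by norm_num)⟩
  · exact Or.inl ⟨by norm_num, exceptionalCurve_center q t 5 (by norm_num)⟩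
  · refine Or.inl ⟨by norm_num, ?_⟩
    change lineRing (xK / yK) (1 / yK) = lineRing (chain (seqA (jet q t)) 1) yK⁻¹
    rw [chain_one rfl, one_div]
  · exact Or.inl ⟨by norm_num, exceptionalCurve_center_one q t⟩
  · exact Or.inr (Or.inl ⟨by norm_num, by norm_num, exceptionalCurve_center q t 2 (by norm_num)⟩)
  · exact Or.inr (Or.inl ⟨by norm_num, by norm_num, exceptionalCurve_center q t 3 (by norm_num)⟩)
  · exact Or.inr (Or.inr ⟨by norm_num, exceptionalCurve_center_zero q t⟩)

theorem boundaryCurve_of_le_five {i : Fin 9} (hi : (i : ℕ) ≤ 5) :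
    boundaryCurve q t i = fiberCurve (seqA (jet q t)) (5 - i) := by
  rcases boundaryCurve_cases q t i with ⟨-, h⟩ | ⟨h5, -, h⟩ | ⟨h8, -⟩
  · exact h
  · rw [h, show (i : ℕ) - 5 = 0 by omega, show 5 - (i : ℕ) = 0 by omega]
    rfl
  · omega

theorem boundaryCurve_of_five_le {i : Fin 9} (hi : 5 ≤ (i : ℕ)) (hi' : (i : ℕ) ≤ 7) :
    boundaryCurve q t i = fiberCurve (seqB (jet q t)) (i - 5) := by
  rcases boundaryCurve_cases q t i with ⟨h5, h⟩ | ⟨-, -, h⟩ | ⟨h8, -⟩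
  · rw [h, show (i : ℕ) - 5 = 0 by omega, show 5 - (i : ℕ) = 0 by omega]
    rfl
  · exact h
  · omega

theorem boundaryCurve_eight : boundaryCurve q t 8 = sectionCurve :=
  exceptionalCurve_center_zero q t

theorem isLocalAlgebra_boundaryCurve (i : Fin 9) : IsLocalAlgebra (boundaryCurve q t i) := by
  rcases boundaryCurve_cases q t i with ⟨-, h⟩ | ⟨-, -, h⟩ | ⟨-, h⟩ <;> rw [h]
  exacts [isLocalAlgebra_fiberCurve _ _, isLocalAlgebra_fiberCurve _ _,
    isLocalAlgebra_sectionCurve]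

/-! ### The boundary curves through the points of the surface -/

variable {q t} {i : Fin 9} {n : ℕ} {a b : ℂ}

theorem plane_not_le_boundaryCurve : ¬ pointRing xK yK a b ≤ boundaryCurve q t i := by
  have hR := coord_xK_yK.isLocalAlgebra_pointRing a b
  have hy := (coord_xK_yK.hasValue_right a b).mem hR
  have hx := (coord_xK_yK.hasValue_left a b).mem hR
  rcases boundaryCurve_cases q t i with ⟨-, h⟩ | ⟨-, -, h⟩ | ⟨-, h⟩ <;> rw [h]
  · exact not_le_fiberCurve_of_yK_mem hy
  · exact not_le_fiberCurve_of_yK_mem hy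
  · exact not_le_of_small_inv hx xK_ne_zero coord_section.small

theorem sectionPoint_le_boundaryCurve (hle : sectionPoint b ≤ boundaryCurve q t i) :
    (i : ℕ) = 8 := by
  rcases boundaryCurve_cases q t i with ⟨-, h⟩ | ⟨-, -, h⟩ | ⟨h8, h⟩
  · exact absurd (h ▸ hle) (not_le_fiberCurve_of_yK_mem (yK_mem_sectionPoint b))
  · exact absurd (h ▸ hle) (not_le_fiberCurve_of_yK_mem (yK_mem_sectionPoint b))
  · exact h8

theorem sectionCorner_le_boundaryCurve (hle : sectionCorner ≤ boundaryCurve q t i) :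
    (i : ℕ) = 5 ∨ (i : ℕ) = 8 := by
  rcases boundaryCurve_cases q t i with ⟨_, h⟩ | ⟨_, _, h⟩ | ⟨h8, h⟩
  · have := eq_zero_of_sectionCorner_le (h ▸ hle)
    omega
  · have := eq_zero_of_sectionCorner_le (h ▸ hle)
    omega
  · exact Or.inr h8

/-- For n = 6 the conclusion is impossible: points of the last exceptional curve other than its
corner lie on no boundary curve. -/
theorem fiberPoint_seqA_le_boundaryCurve (hn : n ≤ 6) (hA : n < 6 → a ≠ seqA (jet q t) n)
    (hB : n = 0 → a ≠ seqB (jet q t) 0)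
    (hle : fiberPoint (seqA (jet q t)) n a ≤ boundaryCurve q t i) : (i : ℕ) + n = 5 := by
  rcases boundaryCurve_cases q t i with ⟨_, h⟩ | ⟨_, _, h⟩ | ⟨h8, h⟩
  · have := eq_of_fiberPoint_le (h ▸ hle) (by
      by_cases h6 : n < 6
      · exact Or.inl (hA h6)
      · exact Or.inr (by omega))
    omega
  · rcases Nat.eq_zero_or_pos n with rfl | h0
    · have := eq_of_fiberPoint_le (c := seqB (jet q t)) (n := 0) (h ▸ hle) (Or.inl (hB rfl))
      omega
    · rcases Nat.eq_zero_or_pos ((i : ℕ) - 5) with h5 | h5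
      · rw [h5] at h
        have := eq_of_fiberPoint_le (c := seqA (jet q t)) (m := 0) (h ▸ hle) (Or.inr n.zero_le)
        omega
      · exact absurd (h ▸ hle) (not_fiberPoint_le (seqA_zero_ne_seqB_zero _) h5 h0)
  · exact absurd (h ▸ hle) not_fiberPoint_le_sectionCurve

/-- For n = 3 the conclusion would give the node 8, which is the section; users rule this out
separately, since x/y² is regular at the point. -/
theorem fiberPoint_seqB_le_boundaryCurve (h0 : 0 < n) (hn : n ≤ 3)
    (hB : n < 3 → a ≠ seqB (jet q t) n)
    (hle : fiberPoint (seqB (jet q t)) n a ≤ boundaryCurve q t i) : (i : ℕ) = 5 + n := by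
  rcases boundaryCurve_cases q t i with ⟨_, h⟩ | ⟨_, _, h⟩ | ⟨h8, h⟩
  · rcases Nat.eq_zero_or_pos (5 - (i : ℕ)) with h5 | h5
    · rw [h5] at h
      have := eq_of_fiberPoint_le (c := seqB (jet q t)) (m := 0) (h ▸ hle) (Or.inr n.zero_le)
      omega
    · exact absurd (h ▸ hle) (not_fiberPoint_le (seqA_zero_ne_seqB_zero _).symm h5 h0)
  · have := eq_of_fiberPoint_le (h ▸ hle) (by
      by_cases h3 : n < 3
      · exact Or.inl (hB h3)
      · exact Or.inr (by omega))
    omega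
  · exact absurd (h ▸ hle) not_fiberPoint_le_sectionCurve

theorem corner_seqA_le_boundaryCurve (hle : corner (seqA (jet q t)) n ≤ boundaryCurve q t i) :
    (i : ℕ) + n = 5 ∨ (i : ℕ) + n = 4 := by
  rcases boundaryCurve_cases q t i with ⟨_, h⟩ | ⟨_, _, h⟩ | ⟨h8, h⟩
  · have := eq_of_corner_le (h ▸ hle)
    omega
  · rcases Nat.eq_zero_or_pos ((i : ℕ) - 5) with h5 | h5
    · rw [h5] at h
      have := eq_of_corner_le (c := seqA (jet q t)) (m := 0) (h ▸ hle)
      omega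
    · exact absurd (h ▸ hle) (not_corner_le (seqA_zero_ne_seqB_zero _) h5)
  · exact absurd (h ▸ hle) not_corner_le_sectionCurve

theorem corner_seqB_le_boundaryCurve (hle : corner (seqB (jet q t)) n ≤ boundaryCurve q t i) :
    ((i : ℕ) = 5 + n ∨ (i : ℕ) = 6 + n) ∧ (i : ℕ) ≤ 7 := by
  rcases boundaryCurve_cases q t i with ⟨_, h⟩ | ⟨_, _, h⟩ | ⟨h8, h⟩
  · rcases Nat.eq_zero_or_pos (5 - (i : ℕ)) with h5 | h5
    · rw [h5] at h
      have := eq_of_corner_le (c := seqB (jet q t)) (m := 0) (h ▸ hle)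
      omega
    · exact absurd (h ▸ hle) (not_corner_le (seqA_zero_ne_seqB_zero _).symm h5)
  · have := eq_of_corner_le (h ▸ hle)
    omega
  · exact absurd (h ▸ hle) not_corner_le_sectionCurve

end Boundary

/-! ### The configuration of the boundary curves -/

/-- The nodes of the Dynkin diagram at the ends of its `k`-th edge. -/
def edge : Fin 8 → Fin 9 × Fin 9 :=
  ![(0, 1), (1, 2), (2, 3), (3, 4), (4, 5), (5, 6), (6, 7), (5, 8)]

/-- The common point of the boundary curves at the ends of the `k`-th edge. -/
noncomputable def edgePoint (j : ℕ → ℂ) : Fin 8 → Subring K :=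
  ![corner (seqA j) 4, corner (seqA j) 3, corner (seqA j) 2, corner (seqA j) 1,
    corner (seqA j) 0, corner (seqB j) 0, corner (seqB j) 1, sectionCorner]

/-- The edges with the ends `i` and `k`. -/
def edges (i k : Fin 9) : Finset (Fin 8) :=
  Finset.univ.filter fun e => (i, k) = edge e ∨ (k, i) = edge e

section Configuration

variable (q : ℂ → ℂ) (t : ℂ)

theorem edgePoint_mem_surface (k : Fin 8) : edgePoint (jet q t) k ∈ surface q t := by
  fin_cases k
  exacts [corner_seqA_mem_surface q t (by norm_num), corner_seqA_mem_surface q t (by norm_num),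
    corner_seqA_mem_surface q t (by norm_num), corner_seqA_mem_surface q t (by norm_num),
    corner_seqA_mem_surface q t (by norm_num), corner_seqB_mem_surface q t (by norm_num),
    corner_seqB_mem_surface q t (by norm_num), sectionCorner_mem_surface q t]

theorem areAxesAt_edgePoint (k : Fin 8) : AreAxesAt (edgePoint (jet q t) k)
    (boundaryCurve q t (edge k).1) (boundaryCurve q t (edge k).2) := by
  have hA : ∀ (i i' : Fin 9), (i : ℕ) + 1 = i' → (i' : ℕ) ≤ 5 →
      AreAxesAt (corner (seqA (jet q t)) (4 - i)) (boundaryCurve q t i) (boundaryCurve q t i') := by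
    intro i i' h h'
    rw [boundaryCurve_of_le_five q t h', boundaryCurve_of_le_five q t (by omega),
      show 5 - (i : ℕ) = 4 - i + 1 by omega, show 5 - (i' : ℕ) = 4 - i by omega]
    exact (areAxesAt_corner _ _).symm
  have hB : ∀ (i i' : Fin 9), (i : ℕ) + 1 = i' → 5 ≤ (i : ℕ) → (i' : ℕ) ≤ 7 →
      AreAxesAt (corner (seqB (jet q t)) (i - 5)) (boundaryCurve q t i) (boundaryCurve q t i') := by
    intro i i' h h' h''
    rw [boundaryCurve_of_five_le q t h' (by omega), boundaryCurve_of_five_le q t (by omega) h'',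
      show (i' : ℕ) - 5 = i - 5 + 1 by omega]
    exact areAxesAt_corner _ _
  fin_cases k
  · exact hA 0 1 rfl (by norm_num)
  · exact hA 1 2 rfl (by norm_num)
  · exact hA 2 3 rfl (by norm_num)
  · exact hA 3 4 rfl (by norm_num)
  · exact hA 4 5 rfl (by norm_num)
  · exact hB 5 6 rfl (by norm_num) (by norm_num)
  · exact hB 6 7 rfl (by norm_num) (by norm_num)
  · change AreAxesAt sectionCorner (boundaryCurve q t 5) (boundaryCurve q t 8)
    rw [boundaryCurve_eight, boundaryCurve_of_le_five q t (i := 5) (by norm_num)]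
    exact areAxesAt_sectionCorner _

variable {q t}

/-- Only corners lie on two boundary curves. The corners of the last exceptional curves with A₅ and
B₂ lie on a single one and give no edge. -/
theorem exists_edge_of_le {R : Subring K} (hR : R ∈ surface q t) {i k : Fin 9} (hik : i ≠ k)
    (hi : R ≤ boundaryCurve q t i) (hk : R ≤ boundaryCurve q t k) :
    ∃ e ∈ edges i k, R = edgePoint (jet q t) e := by
  have hik' : (i : ℕ) ≠ k := fun h => hik (Fin.ext h)
  have key : ∀ e : Fin 8, R = edgePoint (jet q t) e →
      ((i : ℕ) = (edge e).1 ∧ (k : ℕ) = (edge e).2 ∨ (k : ℕ) = (edge e).1 ∧ (i : ℕ) = (edge e).2) →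
      ∃ e ∈ edges i k, R = edgePoint (jet q t) e := by
    intro e he h
    refine ⟨e, ?_, he⟩
    simpa [edges, Prod.ext_iff, Fin.ext_iff] using h
  rcases surface_cases q t hR with ⟨a, b, rfl⟩ | ⟨b, rfl⟩ | rfl | ⟨n, a, h1, h2, h3, rfl⟩ |
    ⟨n, a, h0, h1, h2, rfl⟩ | ⟨n, h1, rfl⟩ | ⟨n, h1, rfl⟩
  · exact absurd hi plane_not_le_boundaryCurve
  · have := sectionPoint_le_boundaryCurve hi
    have := sectionPoint_le_boundaryCurve hk
    omega
  · have := sectionCorner_le_boundaryCurve hi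
    have := sectionCorner_le_boundaryCurve hk
    exact key 7 rfl (by simp [edge]; omega)
  · have := fiberPoint_seqA_le_boundaryCurve h1 h2 h3 hi
    have := fiberPoint_seqA_le_boundaryCurve h1 h2 h3 hk
    omega
  · have := fiberPoint_seqB_le_boundaryCurve h0 h1 h2 hi
    have := fiberPoint_seqB_le_boundaryCurve h0 h1 h2 hk
    omega
  · have h4 := corner_seqA_le_boundaryCurve hi
    have h5 := corner_seqA_le_boundaryCurve hk
    interval_cases n
    · exact key 4 rfl (by simp [edge]; omega)
    · exact key 3 rfl (by simp [edge]; omega)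
    · exact key 2 rfl (by simp [edge]; omega)
    · exact key 1 rfl (by simp [edge]; omega)
    · exact key 0 rfl (by simp [edge]; omega)
    · omega
  · have h4 := corner_seqB_le_boundaryCurve hi
    have h5 := corner_seqB_le_boundaryCurve hk
    interval_cases n
    · exact key 5 rfl (by simp [edge]; omega)
    · exact key 6 rfl (by simp [edge]; omega)
    · omega

theorem areAxesAt_of_mem_edges {i k : Fin 9} {e : Fin 8} (he : e ∈ edges i k) :
    AreAxesAt (edgePoint (jet q t) e) (boundaryCurve q t i) (boundaryCurve q t k) := by
  have h := areAxesAt_edgePoint q t e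
  rcases (Finset.mem_filter.1 he).2 with h' | h' <;> rw [← h'] at h
  exacts [h, h.symm]

theorem hasIntersectionNumber_boundaryCurve_of_ne {i k : Fin 9} (hik : i ≠ k) :
    HasIntersectionNumber (surface q t) (boundaryCurve q t i) (boundaryCurve q t k)
      (-(affineE8 i k)) := by
  classical
  -- The off-diagonal Cartan matrix entries are compared with the list of edges; since there is at
  -- most one edge, counting edges is the same as counting their points.
  have hcard : ∀ i k : Fin 9, (edges i k).card ≤ 1 ∧ (i ≠ k → -(affineE8 i k) = (edges i k).card) := by
    decide
  have h := hasIntersectionNumber_of_areAxesAt (S := surface q t)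
    (C' := boundaryCurve q t k) (isLocalAlgebra_boundaryCurve q t i)
    ((edges i k).image (edgePoint (jet q t))) (fun R => ?_) fun R hR => ?_
  · rwa [Finset.card_image_of_injOn ((Finset.card_le_one_iff_subsingleton.1 (hcard i k).1).injOn _),
      ← (hcard i k).2 hik] at h
  · rw [Finset.mem_image]
    constructor
    · rintro ⟨e, he, rfl⟩
      exact ⟨edgePoint_mem_surface q t e, (areAxesAt_of_mem_edges he).isAxisAt.le,
        (areAxesAt_of_mem_edges he).symm.isAxisAt.le⟩
    · rintro ⟨hR, h1, h2⟩
      obtain ⟨e, he, h⟩ := exists_edge_of_le hR hik h1 h2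
      exact ⟨e, he, h.symm⟩
  · obtain ⟨e, he, rfl⟩ := Finset.mem_image.1 hR
    exact areAxesAt_of_mem_edges he

theorem boundaryCurve_point_cases {R : Subring K} (hR : R ∈ surface q t) {i : Fin 9}
    (hle : R ≤ boundaryCurve q t i) :
    ((i : ℕ) < 5 ∧ ((∃ a, a ≠ seqA (jet q t) (5 - i) ∧ R = fiberPoint (seqA (jet q t)) (5 - i) a) ∨
      R = corner (seqA (jet q t)) (4 - i) ∨ R = corner (seqA (jet q t)) (4 - i + 1))) ∨
    ((i : ℕ) = 5 ∧ ((∃ a, a ≠ seqA (jet q t) 0 ∧ a ≠ seqB (jet q t) 0 ∧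
      R = fiberPoint (seqA (jet q t)) 0 a) ∨
      R = corner (seqA (jet q t)) 0 ∨ R = corner (seqB (jet q t)) 0 ∨ R = sectionCorner)) ∨
    ((5 < (i : ℕ) ∧ (i : ℕ) ≤ 7) ∧
      ((∃ a, a ≠ seqB (jet q t) (i - 5) ∧ R = fiberPoint (seqB (jet q t)) (i - 5) a) ∨
      R = corner (seqB (jet q t)) (i - 6) ∨ R = corner (seqB (jet q t)) (i - 6 + 1))) ∨
    ((i : ℕ) = 8 ∧ ((∃ b, R = sectionPoint b) ∨ R = sectionCorner)) := by
  rcases surface_cases q t hR with ⟨a, b, rfl⟩ | ⟨b, rfl⟩ | rfl | ⟨n, a, h1, h2, h3, rfl⟩ |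
    ⟨n, a, h0, h1, h2, rfl⟩ | ⟨n, h1, rfl⟩ | ⟨n, h1, rfl⟩
  · exact absurd hle plane_not_le_boundaryCurve
  · exact Or.inr (Or.inr (Or.inr ⟨sectionPoint_le_boundaryCurve hle, Or.inl ⟨b, rfl⟩⟩))
  · rcases sectionCorner_le_boundaryCurve hle with h | h
    · exact Or.inr (Or.inl ⟨h, Or.inr (Or.inr (Or.inr rfl))⟩)
    · exact Or.inr (Or.inr (Or.inr ⟨h, Or.inr rfl⟩))
  · have h := fiberPoint_seqA_le_boundaryCurve h1 h2 h3 hle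
    rcases Nat.eq_zero_or_pos n with rfl | hn
    · exact Or.inr (Or.inl ⟨by omega, Or.inl ⟨a, h2 (by norm_num), h3 rfl, rfl⟩⟩)
    · obtain rfl : n = 5 - i := by omega
      exact Or.inl ⟨by omega, Or.inl ⟨a, h2 (by omega), rfl⟩⟩
  · have h := fiberPoint_seqB_le_boundaryCurve h0 h1 h2 hle
    have hi : 5 < (i : ℕ) ∧ (i : ℕ) ≤ 7 := by
      by_contra h8
      obtain rfl : n = 3 := by omega
      obtain rfl : i = 8 := Fin.ext h
      rw [boundaryCurve_eight] at hle
      exact not_fiberPoint_le_sectionCurve hle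
    obtain rfl : n = i - 5 := by omega
    exact Or.inr (Or.inr (Or.inl ⟨hi, Or.inl ⟨a, h2 (by omega), rfl⟩⟩))
  · have h := corner_seqA_le_boundaryCurve hle
    by_cases h5 : (i : ℕ) = 5
    · obtain rfl : n = 0 := by omega
      exact Or.inr (Or.inl ⟨h5, Or.inr (Or.inl rfl)⟩)
    · refine Or.inl ⟨by omega, Or.inr ?_⟩
      rcases h with h | h
      · exact Or.inr (by rw [show 4 - (i : ℕ) + 1 = n by omega])
      · exact Or.inl (by rw [show 4 - (i : ℕ) = n by omega])
  · have h := corner_seqB_le_boundaryCurve hle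
    by_cases h5 : (i : ℕ) = 5
    · obtain rfl : n = 0 := by omega
      exact Or.inr (Or.inl ⟨h5, Or.inr (Or.inr (Or.inl rfl))⟩)
    · refine Or.inr (Or.inr (Or.inl ⟨by omega, Or.inr ?_⟩))
      rcases h.1 with h | h
      · exact Or.inr (by rw [show (i : ℕ) - 6 + 1 = n by omega])
      · exact Or.inl (by rw [show (i : ℕ) - 6 = n by omega])

theorem hasIntersectionNumber_boundaryCurve_self (i : Fin 9) :
    HasIntersectionNumber (surface q t) (boundaryCurve q t i) (boundaryCurve q t i) (-2) := by
  have hpt := fun R (hR : R ∈ surface q t) (hle : R ≤ boundaryCurve q t i) =>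
    boundaryCurve_point_cases hR hle
  rcases Nat.lt_or_ge i 5 with h5 | h5
  · rw [boundaryCurve_of_le_five q t h5.le, show 5 - (i : ℕ) = 4 - i + 1 by omega] at hpt ⊢
    refine hasIntersectionNumber_fiberCurve_succ (corner_seqA_mem_surface q t (by omega))
      (corner_seqA_mem_surface q t (by omega)) fun R hR hle => ?_
    rcases hpt R hR hle with h | h | h | h
    · exact h.2
    all_goals omega
  rcases h5.eq_or_lt with h5 | h5
  · rw [boundaryCurve_of_le_five q t h5.ge, ← h5] at hpt ⊢
    refine hasIntersectionNumber_fiberCurve_zero (seqA_zero_ne_seqB_zero (jet q t))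
      (corner_seqA_mem_surface q t (by norm_num)) (corner_seqB_mem_surface q t (by norm_num))
      fun R hR hle => ?_
    rcases hpt R hR hle with h | h | h | h
    · omega
    · exact h.2
    all_goals omega
  rcases Nat.lt_or_ge i 8 with h8 | h8
  · rw [boundaryCurve_of_five_le q t h5.le (by omega), show (i : ℕ) - 5 = i - 6 + 1 by omega]
      at hpt ⊢
    refine hasIntersectionNumber_fiberCurve_succ (corner_seqB_mem_surface q t (by omega))
      (corner_seqB_mem_surface q t (by omega)) fun R hR hle => ?_
    rcases hpt R hR hle with h | h | h | h
    · omega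
    · omega
    · exact h.2
    · omega
  · obtain rfl : i = 8 := by omega
    rw [boundaryCurve_eight] at hpt ⊢
    refine hasIntersectionNumber_sectionCurve (sectionPoint_mem_surface q t) fun R hR hle => ?_
    rcases hpt R hR hle with h | h | h | h
    · simp at h
    · simp at h
    · simp at h
    · exact h.2

theorem isAxisAt_fiberPoint (c : ℕ → ℂ) (n : ℕ) (a : ℂ) :
    IsAxisAt (fiberPoint c n a) (fiberCurve c n) := ⟨_, _, a, coord_chain c n, rfl, rfl⟩

theorem isAxisAt_boundaryCurve {R : Subring K} (hR : R ∈ surface q t) {i : Fin 9}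
    (hle : R ≤ boundaryCurve q t i) : IsAxisAt R (boundaryCurve q t i) := by
  rcases boundaryCurve_point_cases hR hle with ⟨hi, h⟩ | ⟨hi, h⟩ | ⟨hi, h⟩ | ⟨hi, h⟩
  · rw [boundaryCurve_of_le_five q t hi.le]
    rcases h with ⟨a, -, rfl⟩ | rfl | rfl
    · exact isAxisAt_fiberPoint _ _ _
    · rw [show 5 - (i : ℕ) = 4 - i + 1 by omega]
      exact (areAxesAt_corner _ _).symm.isAxisAt
    · rw [show 5 - (i : ℕ) = 4 - i + 1 by omega]
      exact (areAxesAt_corner _ _).isAxisAt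
  · rw [boundaryCurve_of_le_five q t hi.le, hi]
    rcases h with ⟨a, -, -, rfl⟩ | rfl | rfl | rfl
    · exact isAxisAt_fiberPoint _ _ _
    · exact (areAxesAt_corner _ _).isAxisAt
    · exact (areAxesAt_corner (seqB (jet q t)) 0).isAxisAt
    · exact (areAxesAt_sectionCorner _).isAxisAt
  · rw [boundaryCurve_of_five_le q t hi.1.le hi.2]
    rcases h with ⟨a, -, rfl⟩ | rfl | rfl
    · exact isAxisAt_fiberPoint _ _ _
    · rw [show (i : ℕ) - 5 = i - 6 + 1 by omega]
      exact (areAxesAt_corner _ _).symm.isAxisAt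
    · rw [show (i : ℕ) - 5 = i - 6 + 1 by omega]
      exact (areAxesAt_corner _ _).isAxisAt
  · obtain rfl : i = 8 := Fin.ext hi
    rw [boundaryCurve_eight]
    rcases h with ⟨b, rfl⟩ | rfl
    · exact ⟨_, _, b, coord_section, rfl, rfl⟩
    · exact (areAxesAt_sectionCorner 0).symm.isAxisAt

variable (q t)

/-- Such a point shows both that the curve is not empty and that it differs from the other eight. -/
theorem exists_mem_surface_le_only (i : Fin 9) : ∃ R ∈ surface q t, R ≤ boundaryCurve q t i ∧
    ∀ k, R ≤ boundaryCurve q t k → k = i := by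
  -- On each non-branching component c_n + 1 serves as a coordinate different from that of the
  -- center.
  have hsucc : ∀ z : ℂ, z + 1 ≠ z := fun z h => by simp at h
  rcases Nat.lt_or_ge i 5 with h5 | h5
  · refine ⟨fiberPoint (seqA (jet q t)) (5 - i) (seqA (jet q t) (5 - i) + 1),
      fiberPoint_seqA_mem_surface q t (by omega) (by omega) fun _ => hsucc _, ?_, fun k hk => ?_⟩
    · rw [boundaryCurve_of_le_five q t h5.le]
      exact fiberPoint_le _ _ _
    · have := fiberPoint_seqA_le_boundaryCurve (by omega) (fun _ => hsucc _) (by omega) hk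
      omega
  rcases h5.eq_or_lt with h5 | h5
  · have hA : (1 : ℂ) ≠ seqA (jet q t) 0 := by simp [seqA]
    have hB : (1 : ℂ) ≠ seqB (jet q t) 0 := by norm_num [seqB]
    refine ⟨fiberPoint (seqA (jet q t)) 0 1, fiberPoint_zero_mem_surface q t hA hB, ?_,
      fun k hk => ?_⟩
    · rw [boundaryCurve_of_le_five q t h5.ge, ← h5]
      exact fiberPoint_le _ _ _
    · have := fiberPoint_seqA_le_boundaryCurve (by omega) (fun _ => hA) (fun _ => hB) hk
      omega
  rcases Nat.lt_or_ge i 8 with h8 | h8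
  · refine ⟨fiberPoint (seqB (jet q t)) (i - 5) (seqB (jet q t) (i - 5) + 1),
      fiberPoint_seqB_mem_surface q t (by omega) (by omega) fun _ => hsucc _, ?_, fun k hk => ?_⟩
    · rw [boundaryCurve_of_five_le q t h5.le (by omega)]
      exact fiberPoint_le _ _ _
    · have := fiberPoint_seqB_le_boundaryCurve (by omega) (by omega) (fun _ => hsucc _) hk
      omega
  · obtain rfl : i = 8 := by omega
    refine ⟨sectionPoint 0, sectionPoint_mem_surface q t 0, ?_, fun k hk => ?_⟩
    · rw [boundaryCurve_eight]
      exact sectionPoint_le 0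
    · exact Fin.ext (sectionPoint_le_boundaryCurve hk)

theorem isE8AffineConfiguration : IsE8AffineConfiguration (surface q t) (boundaryCurve q t) := by
  refine ⟨fun i k hik => ?_, fun i => ?_, fun i k => ?_⟩
  · obtain ⟨R, -, hle, honly⟩ := exists_mem_surface_le_only q t i
    exact (honly k (hik ▸ hle)).symm
  · obtain ⟨R, hR, hle, -⟩ := exists_mem_surface_le_only q t i
    refine ⟨isCurveOn_of_isAxisAt ⟨R, hR, hle⟩ fun R hR hle => isAxisAt_boundaryCurve hR hle,
      isSmoothCurve_of_isAxisAt fun R hR hle => isAxisAt_boundaryCurve hR hle, ?_⟩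
    obtain ⟨u, v, a, h, -, h'⟩ := isAxisAt_boundaryCurve hR hle
    rw [h']
    exact h.isRationalCurve
  · by_cases hik : i = k
    · subst hik
      have : affineE8 i i = 2 := by revert i; decide
      rw [this]
      exact hasIntersectionNumber_boundaryCurve_self i
    · exact hasIntersectionNumber_boundaryCurve_of_ne hik

end Configuration

/-! ### The chart transformations and their inverses. -/

section Charts

variable {F : Type} [Field F] (j : ℕ → F)

/-- The inverse `(x_i, y_i) ↦ (x, y)` of the birational transformation `chartMap j i`. -/
def chartInv (i : Fin 3) (a b : F) : F × F :=
  ![(a, b), (a * b + 1 / (4 * b ^ 2) - 12 * j 0, 1 / b),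
    (b * (16 * j 1 + b * (32 * j 2 + b * (128 * j 3 - 768 * j 0 * j 1 + b * a))), 1 / b)] i

theorem chartInv_snd_ne_zero (i : Fin 3) (a : F) {b : F} (hb : b ≠ 0) :
    (chartInv j i a b).2 ≠ 0 := by
  fin_cases i <;> simpa [chartInv] using hb

theorem chartMap_snd_ne_zero (i : Fin 3) (x : F) {y : F} (hy : y ≠ 0) :
    (chartMap j i x y).2 ≠ 0 := by
  fin_cases i <;> simpa [chartMap] using hy

theorem chartMap_chartInv [CharZero F] (i : Fin 3) (a : F) {b : F} (hb : b ≠ 0) :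
    chartMap j i (chartInv j i a b).1 (chartInv j i a b).2 = (a, b) := by
  fin_cases i
  · rfl
  · simp only [chartMap, chartInv, Fin.mk_one, Matrix.cons_val_one, Matrix.cons_val_zero,
      one_div_one_div, Prod.mk.injEq, and_true]
    field_simp
    ring
  · simp only [chartMap, chartInv, Fin.reduceFinMk, Matrix.cons_val, one_div_one_div,
      Prod.mk.injEq, and_true]
    field_simp
    ring

theorem chartInv_chartMap [CharZero F] (i : Fin 3) (x : F) {y : F} (hy : y ≠ 0) :
    chartInv j i (chartMap j i x y).1 (chartMap j i x y).2 = (x, y) := by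
  fin_cases i
  · rfl
  · simp only [chartMap, chartInv, Fin.mk_one, Matrix.cons_val_one, Matrix.cons_val_zero,
      one_div_one_div, Prod.mk.injEq, and_true]
    field_simp
    ring
  · simp only [chartMap, chartInv, Fin.reduceFinMk, Matrix.cons_val, one_div_one_div,
      Prod.mk.injEq, and_true]
    field_simp
    ring

end Charts

/-! ### Analyticity of the coordinate changes. -/

theorem analyticAt_jet {B : Set ℂ} (hB : IsOpen B) {q : ℂ → ℂ} (hq : DifferentiableOn ℂ q B)
    (k : ℕ) {t : ℂ} (ht : t ∈ B) : AnalyticAt ℂ (fun t => jet q t k) t := by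
  have := (hq.analyticOnNhd hB t ht).iterated_deriv k
  rw [← iteratedDeriv_eq_iterate] at this
  exact this

/-- The coordinate change between the charts `i` and `k`. -/
noncomputable def transition (q : ℂ → ℂ) (i k : Fin 3) (p : ℂ × ℂ × ℂ) : ℂ × ℂ :=
  chartMap (jet q p.2.2) k (chartInv (jet q p.2.2) i p.1 p.2.1).1
    (chartInv (jet q p.2.2) i p.1 p.2.1).2

section Analytic

variable {B : Set ℂ} (hB : IsOpen B) {q : ℂ → ℂ} (hq : DifferentiableOn ℂ q B)

include hB hq

theorem analyticAt_chartMap {E : Type} [NormedAddCommGroup E] [NormedSpace ℂ E] {f g h : E → ℂ}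
    {p : E} (hf : AnalyticAt ℂ f p) (hg : AnalyticAt ℂ g p) (hh : AnalyticAt ℂ h p)
    (hy : g p ≠ 0) (ht : h p ∈ B) (k : Fin 3) :
    AnalyticAt ℂ (fun z => chartMap (jet q (h z)) k (f z) (g z)) p := by
  have hj : ∀ k, AnalyticAt ℂ (fun z => jet q (h z) k) p := fun k =>
    (analyticAt_jet hB hq k ht).comp hh
  have h0 := hj 0
  have h1 := hj 1
  have h2 := hj 2
  have h3 := hj 3
  fin_cases k <;> simp only [chartMap, Fin.zero_eta, Fin.mk_one, Fin.reduceFinMk,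
    Matrix.cons_val, Matrix.cons_val_zero, Matrix.cons_val_one] <;>
    fun_prop (disch := assumption)

theorem analyticAt_chartInv {E : Type} [NormedAddCommGroup E] [NormedSpace ℂ E] {f g h : E → ℂ}
    {p : E} (hf : AnalyticAt ℂ f p) (hg : AnalyticAt ℂ g p) (hh : AnalyticAt ℂ h p)
    (hb : g p ≠ 0) (ht : h p ∈ B) (k : Fin 3) :
    AnalyticAt ℂ (fun z => chartInv (jet q (h z)) k (f z) (g z)) p := by
  have hj : ∀ k, AnalyticAt ℂ (fun z => jet q (h z) k) p := fun k =>
    (analyticAt_jet hB hq k ht).comp hh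
  have h0 := hj 0
  have h1 := hj 1
  have h2 := hj 2
  have h3 := hj 3
  have hb' : 4 * g p ^ 2 ≠ 0 := by simpa using hb
  fin_cases k <;> simp only [chartInv, Fin.zero_eta, Fin.mk_one, Fin.reduceFinMk,
    Matrix.cons_val, Matrix.cons_val_zero, Matrix.cons_val_one] <;>
    fun_prop (disch := assumption)

theorem analyticAt_transition {p : ℂ × ℂ × ℂ} (hb : p.2.1 ≠ 0) (ht : p.2.2 ∈ B) (i k : Fin 3) :
    AnalyticAt ℂ (transition q i k) p := by
  have h2 : AnalyticAt ℂ (fun z : ℂ × ℂ × ℂ => z.2.1) p :=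
    AnalyticAt.comp (g := Prod.fst) analyticAt_fst analyticAt_snd
  have h3 : AnalyticAt ℂ (fun z : ℂ × ℂ × ℂ => z.2.2) p :=
    AnalyticAt.comp (g := Prod.snd) analyticAt_snd analyticAt_snd
  have h := analyticAt_chartInv hB hq (f := fun z : ℂ × ℂ × ℂ => z.1) analyticAt_fst h2 h3 hb ht i
  exact analyticAt_chartMap hB hq (AnalyticAt.comp (g := Prod.fst) analyticAt_fst h)
    (AnalyticAt.comp (g := Prod.snd) analyticAt_snd h) h3 (chartInv_snd_ne_zero _ i _ hb) ht k

end Analytic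

/-! ### The glued manifold. -/

section Gluing

variable {B : Set ℂ} {q : ℂ → ℂ}

theorem glueRel_iff {i k : Fin 3} {a b a' b' : ℂ} {t t' : B} :
    glueRel B q (i, a, b, t) (k, a', b', t') ↔
      t = t' ∧ b ≠ 0 ∧ transition q i k (a, b, t) = (a', b') := by
  unfold glueRel transition
  simp only
  constructor
  · rintro ⟨rfl, x, y, hy, h, h'⟩
    have h1 := congrArg Prod.fst h
    have h2 := congrArg Prod.snd h
    simp only at h1 h2
    refine ⟨rfl, ?_, ?_⟩
    · rw [h2]
      exact chartMap_snd_ne_zero _ _ _ hy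
    · rw [h1, h2, chartInv_chartMap _ _ _ hy, h']
  · rintro ⟨rfl, hb, h⟩
    exact ⟨rfl, _, _, chartInv_snd_ne_zero (jet q t) i a hb,
      (chartMap_chartInv (jet q t) i a hb).symm, h.symm⟩

theorem glueRel_symm {p p' : Fin 3 × (ℂ × ℂ × B)} (h : glueRel B q p p') : glueRel B q p' p := by
  obtain ⟨h1, x, y, hy, h2, h3⟩ := h
  exact ⟨h1.symm, x, y, hy, h3, h2⟩

theorem glueRel_trans {p p' p'' : Fin 3 × (ℂ × ℂ × B)} (h : glueRel B q p p')
    (h' : glueRel B q p' p'') : glueRel B q p p'' := by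
  obtain ⟨h1, x, y, hy, h2, h3⟩ := h
  obtain ⟨h1', x', y', hy', h2', h3'⟩ := h'
  have e := chartInv_chartMap (jet q p'.2.2.2) p'.1 x hy
  rw [← h3, h2', chartInv_chartMap _ _ _ hy'] at e
  obtain ⟨rfl, rfl⟩ := Prod.mk.inj e
  exact ⟨h1.trans h1', _, _, hy, h2, h3'⟩

/-- The relation is symmetric and transitive but not reflexive at points with y_j = 0, for j = 1, 2
as well as j = 0, so equality has to be added by hand. -/
theorem mk_eq_mk_iff {p p' : Fin 3 × (ℂ × ℂ × B)} :
    (Quot.mk _ p : GluedSpace B q) = Quot.mk _ p' ↔ p = p' ∨ glueRel B q p p' := by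
  constructor
  · intro h
    have := Quot.eqvGen_exact h
    clear h
    induction this with
    | rel x y h => exact Or.inr h
    | refl x => exact Or.inl rfl
    | symm x y _ ih =>
      rcases ih with rfl | h
      exacts [Or.inl rfl, Or.inr (glueRel_symm h)]
    | trans x y z _ _ ih ih' =>
      rcases ih with rfl | h
      · exact ih'
      · rcases ih' with rfl | h'
        exacts [Or.inr h, Or.inr (glueRel_trans h h')]
  · rintro (rfl | h)
    exacts [rfl, Quot.sound h]

theorem transition_self (i : Fin 3) {a b t : ℂ} (hb : b ≠ 0) :
    transition q i i (a, b, t) = (a, b) := chartMap_chartInv (jet q t) i a hb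

theorem chartIncl_eq_iff {i k : Fin 3} {a b a' b' : ℂ} {t t' : B} :
    chartIncl B q i (a, b, t) = chartIncl B q k (a', b', t') ↔
      (i = k ∧ a = a' ∧ b = b' ∧ t = t') ∨
        (t = t' ∧ b ≠ 0 ∧ transition q i k (a, b, t) = (a', b')) := by
  unfold chartIncl
  rw [mk_eq_mk_iff, glueRel_iff]
  simp only [Prod.mk.injEq]

theorem chartIncl_transition (i k : Fin 3) (a : ℂ) {b : ℂ} (hb : b ≠ 0) (t : B) :
    chartIncl B q i (a, b, t) = chartIncl B q k
      ((transition q i k (a, b, t)).1, (transition q i k (a, b, t)).2, t) :=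
  chartIncl_eq_iff.2 (Or.inr ⟨rfl, hb, rfl⟩)

theorem chartIncl_injective (i : Fin 3) : Function.Injective (chartIncl B q i) := by
  rintro ⟨a, b, t⟩ ⟨a', b', t'⟩ h
  rcases chartIncl_eq_iff.1 h with ⟨-, rfl, rfl, rfl⟩ | ⟨rfl, hb, h⟩
  · rfl
  · rw [transition_self i hb] at h
    obtain ⟨rfl, rfl⟩ := Prod.mk.inj h
    rfl

theorem continuous_chartIncl (i : Fin 3) : Continuous (chartIncl B q i) :=
  continuous_quot_mk.comp (by fun_prop)

theorem isOpenMap_chartIncl (hB : IsOpen B) (hq : DifferentiableOn ℂ q B) (i : Fin 3) :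
    IsOpenMap (chartIncl B q i) := by
  intro U hU
  -- In the k-th copy the points identified with points of U are those of U itself, if k = i, and
  -- those with y_k ≠ 0 that the coordinate change maps into U.
  have hpre : Quot.mk (glueRel B q) ⁻¹' (chartIncl B q i '' U) =
      ⋃ k : Fin 3, {k} ×ˢ ({p | i = k ∧ p ∈ U} ∪ ({p | p.2.1 ≠ 0} ∩
        (fun p : ℂ × ℂ × B => ((transition q k i (p.1, p.2.1, p.2.2)).1,
          (transition q k i (p.1, p.2.1, p.2.2)).2, p.2.2)) ⁻¹' U)) := by
    ext ⟨k, a, b, t⟩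
    simp only [Set.mem_preimage, Set.mem_image, Set.mem_iUnion, Set.mem_prod, Set.mem_singleton_iff,
      Set.mem_union, Set.mem_inter_iff, Set.mem_ofPred_eq]
    constructor
    · rintro ⟨⟨a', b', t'⟩, hp, h⟩
      refine ⟨k, rfl, ?_⟩
      rcases chartIncl_eq_iff.1 h.symm with ⟨rfl, rfl, rfl, rfl⟩ | ⟨rfl, hb, h⟩
      · exact Or.inl ⟨rfl, hp⟩
      · exact Or.inr ⟨hb, by rw [h]; exact hp⟩
    · rintro ⟨k, rfl, ⟨rfl, hp⟩ | ⟨hb, hp⟩⟩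
      · exact ⟨_, hp, rfl⟩
      · exact ⟨_, hp, (chartIncl_transition k i a hb t).symm⟩
  refine isOpen_coinduced.2 ?_
  rw [hpre]
  refine isOpen_iUnion fun k => (isOpen_discrete _).prod (IsOpen.union ?_ ?_)
  · by_cases hik : i = k
    · simpa [hik] using hU
    · simp [hik]
  · have ho : IsOpen {p : ℂ × ℂ × B | p.2.1 ≠ 0} :=
      isOpen_ne_fun (by fun_prop) continuous_const
    refine ContinuousOn.isOpen_inter_preimage ?_ ho hU
    intro p hp
    have h1 : ContinuousAt (fun p : ℂ × ℂ × B => transition q k i (p.1, p.2.1, p.2.2)) p :=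
      ContinuousAt.comp (f := fun p : ℂ × ℂ × B => ((p.1, p.2.1, (p.2.2 : ℂ)) : ℂ × ℂ × ℂ))
        (analyticAt_transition hB hq (p := (p.1, p.2.1, (p.2.2 : ℂ))) hp p.2.2.2 k i).continuousAt
        (by fun_prop)
    exact (ContinuousAt.prodMk h1.fst (h1.snd.prodMk (by fun_prop))).continuousWithinAt

theorem isOpenEmbedding_chartIncl (hB : IsOpen B) (hq : DifferentiableOn ℂ q B) (i : Fin 3) :
    Topology.IsOpenEmbedding (chartIncl B q i) :=
  .of_continuous_injective_isOpenMap (continuous_chartIncl i) (chartIncl_injective i)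
    (isOpenMap_chartIncl hB hq i)

theorem exists_disjoint_of_continuous (hB : IsOpen B) (hq : DifferentiableOn ℂ q B) {i k : Fin 3}
    {f g : ℂ × ℂ × B → ℝ} (hf : Continuous f) (hg : Continuous g) {p p' : ℂ × ℂ × B} {c c' : ℝ}
    (hp : f p < c) (hp' : g p' < c')
    (hfg : ∀ x x', f x < c → g x' < c' → chartIncl B q i x ≠ chartIncl B q k x') :
    ∃ u v : Set (GluedSpace B q), IsOpen u ∧ IsOpen v ∧ chartIncl B q i p ∈ u ∧
      chartIncl B q k p' ∈ v ∧ Disjoint u v := by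
  refine ⟨_, _, isOpenMap_chartIncl hB hq i _ (isOpen_lt hf continuous_const),
    isOpenMap_chartIncl hB hq k _ (isOpen_lt hg continuous_const), ⟨p, hp, rfl⟩, ⟨p', hp', rfl⟩,
    Set.disjoint_left.2 ?_⟩
  rintro _ ⟨x, hx, rfl⟩ ⟨x', hx', h⟩
  exact hfg x x' hx hx' h.symm

/-- A chart 0 point with y ≠ 0 is moved into chart k. Otherwise y is small near it, while y_k = 1/y
is bounded near the other point. -/
theorem exists_disjoint_zero (hB : IsOpen B) (hq : DifferentiableOn ℂ q B) {k : Fin 3}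
    (hk : k ≠ 0) {p p' : ℂ × ℂ × B} (hne : chartIncl B q 0 p ≠ chartIncl B q k p') :
    ∃ u v : Set (GluedSpace B q), IsOpen u ∧ IsOpen v ∧ chartIncl B q 0 p ∈ u ∧
      chartIncl B q k p' ∈ v ∧ Disjoint u v := by
  obtain ⟨a, b, t⟩ := p
  by_cases hb : b = 0
  · subst hb
    have hpos : 0 < ‖p'.2.1‖ + 1 := by positivity
    refine exists_disjoint_of_continuous hB hq (f := fun x => ‖x.2.1‖) (g := fun x => ‖x.2.1‖)
      (c := (‖p'.2.1‖ + 1)⁻¹) (c' := ‖p'.2.1‖ + 1) (by fun_prop) (by fun_prop) (by simpa using hpos)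
      (lt_add_one _) ?_
    rintro ⟨a, b, t⟩ ⟨a', b', t'⟩ h1 h2 h
    simp only at h1 h2
    rcases chartIncl_eq_iff.1 h with ⟨h0, -⟩ | ⟨rfl, hb, h⟩
    · exact hk h0.symm
    · have hb' : b' = b⁻¹ := by
        have : (transition q 0 k (a, b, t)).2 = b' := congrArg Prod.snd h
        rw [← this]
        fin_cases k
        · exact absurd rfl hk
        · simp [transition, chartMap, chartInv]
        · simp [transition, chartMap, chartInv]
      have hb0 : 0 < ‖b‖ := norm_pos_iff.2 hb
      rw [hb', norm_inv, inv_lt_comm₀ hb0 hpos] at h2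
      exact lt_asymm h1 h2
  · rw [chartIncl_transition 0 k a hb] at hne ⊢
    exact separated_by_isOpenEmbedding (isOpenEmbedding_chartIncl hB hq k)
      (fun h => hne (congrArg _ h))

/-- If one of the points has y_j ≠ 0, both lie in a common chart. Otherwise both are at y = ∞, where
x/y² is a continuous function in either chart with the different values 1/4 and 0. -/
theorem exists_disjoint_one_two (hB : IsOpen B) (hq : DifferentiableOn ℂ q B)
    {p p' : ℂ × ℂ × B} (hne : chartIncl B q 1 p ≠ chartIncl B q 2 p') :
    ∃ u v : Set (GluedSpace B q), IsOpen u ∧ IsOpen v ∧ chartIncl B q 1 p ∈ u ∧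
      chartIncl B q 2 p' ∈ v ∧ Disjoint u v := by
  obtain ⟨a, b, t⟩ := p
  obtain ⟨a', b', t'⟩ := p'
  by_cases hb : b = 0
  · by_cases hb' : b' = 0
    · subst hb hb'
      have hj : ∀ k, Continuous fun x : ℂ × ℂ × B => jet q x.2.2 k := fun k =>
        continuous_iff_continuousAt.2 fun x =>
          ContinuousAt.comp (f := fun x : ℂ × ℂ × B => (x.2.2 : ℂ))
            (analyticAt_jet hB hq k x.2.2.2).continuousAt (by fun_prop)
      have h0 := hj 0
      have h1 := hj 1
      have h2 := hj 2
      have h3 := hj 3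
      -- The two norms are those of x/y² - 1/4 in chart 1 and of x/y² in chart 2, written without
      -- denominators; both being less than 1/8 contradicts their difference 1/4.
      refine exists_disjoint_of_continuous hB hq
        (f := fun x => ‖x.2.1 ^ 2 * (x.1 * x.2.1 - 12 * jet q x.2.2 0)‖)
        (g := fun x => ‖x.2.1 ^ 3 * (16 * jet q x.2.2 1 + x.2.1 * (32 * jet q x.2.2 2 + x.2.1 *
          (128 * jet q x.2.2 3 - 768 * jet q x.2.2 0 * jet q x.2.2 1 + x.2.1 * x.1)))‖)
        (c := 1 / 8) (c' := 1 / 8) (by fun_prop) (by fun_prop) (by simp) (by simp) ?_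
      rintro ⟨a, b, t⟩ ⟨a', b', t'⟩ h1 h2 h
      simp only at h1 h2
      rcases chartIncl_eq_iff.1 h with ⟨h0, -⟩ | ⟨rfl, hb, h⟩
      · simp at h0
      · have hq1 := chartInv_chartMap (jet q t) 2 (chartInv (jet q t) 1 a b).1
          (chartInv_snd_ne_zero (jet q t) 1 a hb)
        change chartInv (jet q t) 2 (transition q 1 2 (a, b, t)).1 (transition q 1 2 (a, b, t)).2 =
          _ at hq1
        rw [h] at hq1
        have e1 := congrArg Prod.fst hq1
        have e2 : 1 / b' = 1 / b := congrArg Prod.snd hq1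
        simp only [chartInv, Matrix.cons_val, Matrix.cons_val_one, Matrix.cons_val_zero] at e1
        have e3 : b' = b := by simpa using e2
        subst e3
        have e4 : b' ^ 3 * (16 * jet q t 1 + b' * (32 * jet q t 2 + b' *
            (128 * jet q t 3 - 768 * jet q t 0 * jet q t 1 + b' * a'))) =
            b' ^ 2 * (a * b' - 12 * jet q t 0) + 1 / 4 := by
          have : b' ^ 2 * (1 / (4 * b' ^ 2)) = 1 / 4 := by field_simp
          linear_combination b' ^ 2 * e1 + this
        rw [e4] at h2
        have h3 := norm_sub_le (b' ^ 2 * (a * b' - 12 * jet q t 0) + 1 / 4)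
          (b' ^ 2 * (a * b' - 12 * jet q t 0))
        rw [add_sub_cancel_left] at h3
        norm_num at h1 h2 h3
        linarith
    · rw [chartIncl_transition 2 1 a' hb'] at hne ⊢
      exact separated_by_isOpenEmbedding (isOpenEmbedding_chartIncl hB hq 1)
        (fun h => hne (congrArg _ h))
  · rw [chartIncl_transition 1 2 a hb] at hne ⊢
    exact separated_by_isOpenEmbedding (isOpenEmbedding_chartIncl hB hq 2)
      (fun h => hne (congrArg _ h))

theorem t2Space_gluedSpace (hB : IsOpen B) (hq : DifferentiableOn ℂ q B) :
    T2Space (GluedSpace B q) := by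
  have hsymm : ∀ {x y : GluedSpace B q}, (∃ u v : Set (GluedSpace B q), IsOpen u ∧ IsOpen v ∧
      x ∈ u ∧ y ∈ v ∧ Disjoint u v) → ∃ u v : Set (GluedSpace B q), IsOpen u ∧ IsOpen v ∧
      y ∈ u ∧ x ∈ v ∧ Disjoint u v := by
    rintro x y ⟨u, v, hu, hv, hx, hy, h⟩
    exact ⟨v, u, hv, hu, hy, hx, h.symm⟩
  refine ⟨fun x y hxy => ?_⟩
  induction x using Quot.inductionOn with | _ p
  induction y using Quot.inductionOn with | _ p'
  obtain ⟨i, p⟩ := p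
  obtain ⟨k, p'⟩ := p'
  change chartIncl B q i p ≠ chartIncl B q k p' at hxy
  change ∃ u v : Set (GluedSpace B q), IsOpen u ∧ IsOpen v ∧ chartIncl B q i p ∈ u ∧
    chartIncl B q k p' ∈ v ∧ Disjoint u v
  by_cases hik : i = k
  · subst hik
    exact separated_by_isOpenEmbedding (isOpenEmbedding_chartIncl hB hq i)
      (fun h => hxy (congrArg _ h))
  by_cases hi : i = 0
  · subst hi
    exact exists_disjoint_zero hB hq (Ne.symm hik) hxy
  by_cases hk : k = 0
  · subst hk
    exact hsymm (exists_disjoint_zero hB hq hik hxy.symm)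
  have : i = 1 ∧ k = 2 ∨ i = 2 ∧ k = 1 := by omega
  rcases this with ⟨rfl, rfl⟩ | ⟨rfl, rfl⟩
  · exact exists_disjoint_one_two hB hq hxy
  · exact hsymm (exists_disjoint_one_two hB hq hxy.symm)

theorem isManifoldGluing (hB : IsOpen B) (hq : DifferentiableOn ℂ q B) : IsManifoldGluing B q := by
  refine ⟨t2Space_gluedSpace hB hq, isOpenEmbedding_chartIncl hB hq, fun i k => ?_⟩
  by_cases hik : i = k
  · subst hik
    -- The formula for the coordinate change has 1/b in it, so at b = 0 the identity must be given
    -- directly.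
    refine ⟨fun p => (p.1, p.2.1), fun a b a' b' t t' h => ?_⟩
    obtain ⟨rfl, rfl, rfl⟩ := by simpa using chartIncl_injective i h
    exact ⟨rfl, analyticAt_fst.prod
      (AnalyticAt.comp (g := Prod.fst) analyticAt_fst analyticAt_snd), rfl⟩
  · refine ⟨transition q i k, fun a b a' b' t t' h => ?_⟩
    rcases chartIncl_eq_iff.1 h with ⟨h0, -⟩ | ⟨rfl, hb, h⟩
    · exact absurd h0 hik
    · exact ⟨rfl, analyticAt_transition hB hq hb t.2 i k, h⟩

end Gluing

/-! ### The points of the surface in the three charts. -/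

section Charts

variable (q : ℂ → ℂ) (t : ℂ)

theorem chartFunctions_one : chartFunctions q t 1 = (chain (seqB (jet q t)) 3, yK⁻¹) := by
  rw [chain_seqB_three, ← one_div]
  rfl

theorem chartFunctions_two : chartFunctions q t 2 = (chain (seqA (jet q t)) 6, yK⁻¹) := by
  rw [chain_seqA_six, ← one_div]
  rfl

theorem pointRing_chain_succ (c : ℕ → ℂ) (n : ℕ) (a : ℂ) {b : ℂ} (hb : b ≠ 0) :
    pointRing (chain c (n + 1)) yK⁻¹ a b = pointRing (chain c n) yK⁻¹ (a * b + c n) b := by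
  have h := coord_chain c (n + 1)
  have h' := coord_chain c n
  have hR := h.isLocalAlgebra_pointRing a b
  have hR' := h'.isLocalAlgebra_pointRing (a * b + c n) b
  have hy := h'.hasValue_right (a * b + c n) b
  refine pointRing_eq h h' ?_ (h.hasValue_right a b) ?_ hy
  · have := ((h.hasValue_left a b).mul hR (h.hasValue_right a b)).add hR (hasValue_const (c n))
    rwa [chain_succ_mul_inv, sub_add_cancel] at this
  · have := ((h'.hasValue_left (a * b + c n) b).sub hR' (hasValue_const (c n))).mul hR'
      (hy.inv hR' hb)
    rwa [inv_inv, ← chain_succ, add_sub_cancel_right, mul_inv_cancel_right₀ hb] at this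

/-- Away from y⁻¹ = 0, passing from w_{n+1} to w_n is an affine change of coordinate, and induction
descends to x/y² and thence to the affine plane. -/
theorem exists_pointRing_chain_eq_plane (c : ℕ → ℂ) (n : ℕ) (a : ℂ) {b : ℂ} (hb : b ≠ 0) :
    ∃ x y, y ≠ 0 ∧ pointRing (chain c n) yK⁻¹ a b = pointRing xK yK x y := by
  induction n generalizing a with
  | zero =>
    have h : chain (fun _ => (0 : ℂ)) 1 = xK / yK := chain_one rfl
    have e := pointRing_chain_succ (fun _ => 0) 0 (a * b⁻¹) hb
    rw [h, pointRing_xy_inv_eq_plane _ hb, inv_mul_cancel_right₀ hb, add_zero] at e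
    exact ⟨_, _, inv_ne_zero hb, e.symm⟩
  | succ n ih =>
    rw [pointRing_chain_succ c n a hb]
    exact ih _

theorem coord_chartFunctions (i : Fin 3) :
    Coord (chartFunctions q t i).1 (chartFunctions q t i).2 := by
  fin_cases i
  · exact coord_xK_yK
  · change Coord (chartFunctions q t 1).1 (chartFunctions q t 1).2
    rw [chartFunctions_one]
    exact coord_chain _ 3
  · change Coord (chartFunctions q t 2).1 (chartFunctions q t 2).2
    rw [chartFunctions_two]
    exact coord_chain _ 6

theorem hasValue_chartFunctions (i : Fin 3) (x : ℂ) {y : ℂ} (hy : y ≠ 0) :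
    HasValue (pointRing xK yK x y) (chartFunctions q t i).1 (chartMap (jet q t) i x y).1 ∧
      HasValue (pointRing xK yK x y) (chartFunctions q t i).2 (chartMap (jet q t) i x y).2 := by
  have h := coord_xK_yK
  have hR := h.isLocalAlgebra_pointRing x y
  have hx := h.hasValue_left x y
  have hy' := h.hasValue_right x y
  have hi := hy'.inv hR hy
  have hc := fun c => hasValue_const (C := pointRing xK yK x y) c
  have h4 : HasValue (pointRing xK yK x y) 4 4 := by
    have := hc 4
    rwa [map_ofNat] at this
  have h12 : HasValue (pointRing xK yK x y) 12 12 := by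
    have := hc 12
    rwa [map_ofNat] at this
  have h16 : HasValue (pointRing xK yK x y) 16 16 := by
    have := hc 16
    rwa [map_ofNat] at this
  have h32 : HasValue (pointRing xK yK x y) 32 32 := by
    have := hc 32
    rwa [map_ofNat] at this
  have h768 : HasValue (pointRing xK yK x y) 768 768 := by
    have := hc 768
    rwa [map_ofNat] at this
  have h128 : HasValue (pointRing xK yK x y) 128 128 := by
    have := hc 128
    rwa [map_ofNat] at this
  fin_cases i
  · exact ⟨hx, hy'⟩
  · refine ⟨?_, by simpa [chartFunctions, chartMap] using hi⟩
    have := ((hx.sub hR ((hy'.pow hR 2).mul hR (h4.inv hR (by norm_num)))).add hR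
      (h12.mul hR (hc (jet q t 0)))).mul hR hy'
    simpa [chartFunctions, chartMap, jetK, div_eq_mul_inv] using this
  · refine ⟨?_, by simpa [chartFunctions, chartMap] using hi⟩
    have := ((((((((hx.mul hR hy').sub hR (h16.mul hR (hc (jet q t 1)))).mul hR hy').sub hR
      (h32.mul hR (hc (jet q t 2)))).mul hR hy').add hR
      ((h768.mul hR (hc (jet q t 0))).mul hR (hc (jet q t 1)))).sub hR
      (h128.mul hR (hc (jet q t 3)))).mul hR hy')
    simpa [chartFunctions, chartMap, jetK] using this

/-- The point of the surface at time `t` with coordinates `a`, `b` in the chart `i`. -/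
noncomputable def chartPoint (i : Fin 3) (a b : ℂ) : Subring K :=
  pointRing (chartFunctions q t i).1 (chartFunctions q t i).2 a b

theorem chartPoint_one_zero (a : ℂ) : chartPoint q t 1 a 0 = fiberPoint (seqB (jet q t)) 3 a := by
  rw [chartPoint, chartFunctions_one]
  rfl

theorem chartPoint_two_zero (a : ℂ) : chartPoint q t 2 a 0 = fiberPoint (seqA (jet q t)) 6 a := by
  rw [chartPoint, chartFunctions_two]
  rfl

/-- Once the point is known to lie in the affine plane, comparing the values of the chart functions
there determines x and y. -/
theorem chartPoint_eq_plane (i : Fin 3) (a : ℂ) {b : ℂ} (hb : b ≠ 0) :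
    chartPoint q t i a b = pointRing xK yK (chartInv (jet q t) i a b).1
      (chartInv (jet q t) i a b).2 := by
  have key : ∃ x y, y ≠ 0 ∧ chartPoint q t i a b = pointRing xK yK x y := by
    unfold chartPoint
    fin_cases i
    · exact ⟨a, b, hb, rfl⟩
    · change ∃ x y, y ≠ 0 ∧
        pointRing (chartFunctions q t 1).1 (chartFunctions q t 1).2 a b = pointRing xK yK x y
      rw [chartFunctions_one]
      exact exists_pointRing_chain_eq_plane _ 3 a hb
    · change ∃ x y, y ≠ 0 ∧
        pointRing (chartFunctions q t 2).1 (chartFunctions q t 2).2 a b = pointRing xK yK x y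
      rw [chartFunctions_two]
      exact exists_pointRing_chain_eq_plane _ 6 a hb
  obtain ⟨x, y, hy, h⟩ := key
  have hR := coord_xK_yK.isLocalAlgebra_pointRing x y
  obtain ⟨h1, h2⟩ := hasValue_chartFunctions q t i x hy
  have h1' := (coord_chartFunctions q t i).hasValue_left a b
  have h2' := (coord_chartFunctions q t i).hasValue_right a b
  change HasValue (chartPoint q t i a b) _ _ at h1' h2'
  rw [h] at h1' h2' ⊢
  rw [h1'.unique hR h1, h2'.unique hR h2, chartInv_chartMap _ _ _ hy]

theorem chartPoint_chartMap (i : Fin 3) (x : ℂ) {y : ℂ} (hy : y ≠ 0) :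
    chartPoint q t i (chartMap (jet q t) i x y).1 (chartMap (jet q t) i x y).2 =
      pointRing xK yK x y := by
  rw [chartPoint_eq_plane _ _ _ _ (chartMap_snd_ne_zero _ _ _ hy), chartInv_chartMap _ _ _ hy]

theorem chartPoint_cases (i : Fin 3) (a b : ℂ) :
    (∃ x y, chartPoint q t i a b = pointRing xK yK x y) ∨
      chartPoint q t i a b = fiberPoint (seqB (jet q t)) 3 a ∨
      chartPoint q t i a b = fiberPoint (seqA (jet q t)) 6 a := by
  by_cases hb : b = 0
  · subst hb
    fin_cases i
    · exact Or.inl ⟨a, 0, rfl⟩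
    · exact Or.inr (Or.inl (chartPoint_one_zero q t a))
    · exact Or.inr (Or.inr (chartPoint_two_zero q t a))
  · exact Or.inl ⟨_, _, chartPoint_eq_plane q t i a hb⟩

theorem chartPoint_mem (i : Fin 3) (a b : ℂ) : chartPoint q t i a b ∈ surface q t ∧
    ∀ k, ¬ chartPoint q t i a b ≤ boundaryCurve q t k := by
  rcases chartPoint_cases q t i a b with ⟨x, y, h⟩ | h | h <;> rw [h]
  · exact ⟨plane_mem_surface q t x y, fun k => plane_not_le_boundaryCurve⟩
  · refine ⟨fiberPoint_seqB_mem_surface q t (by norm_num) le_rfl (by simp), fun k hk => ?_⟩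
    have h8 := fiberPoint_seqB_le_boundaryCurve (by norm_num) le_rfl (by simp) hk
    obtain rfl : k = 8 := Fin.ext h8
    rw [boundaryCurve_eight] at hk
    exact not_fiberPoint_le_sectionCurve hk
  · refine ⟨fiberPoint_seqA_mem_surface q t (by norm_num) le_rfl (by simp), fun k hk => ?_⟩
    have := fiberPoint_seqA_le_boundaryCurve le_rfl (by simp) (by simp) hk
    omega

theorem plane_injective {a b a' b' : ℂ} (h : pointRing xK yK a b = pointRing xK yK a' b') :
    a = a' ∧ b = b' := by
  have hR := coord_xK_yK.isLocalAlgebra_pointRing a b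
  have h1 := coord_xK_yK.hasValue_left a' b'
  have h2 := coord_xK_yK.hasValue_right a' b'
  rw [← h] at h1 h2
  exact ⟨(coord_xK_yK.hasValue_left a b).unique hR h1, (coord_xK_yK.hasValue_right a b).unique hR h2⟩

theorem plane_ne_fiberPoint (x y : ℂ) (c : ℕ → ℂ) (n : ℕ) (a : ℂ) :
    pointRing xK yK x y ≠ fiberPoint c n a :=
  ne_of_mem_of_small_inv ((coord_xK_yK.hasValue_right x y).mem
    (coord_xK_yK.isLocalAlgebra_pointRing x y)) yK_ne_zero (small_fiberPoint c n a)

theorem fiberPoint_injective (c : ℕ → ℂ) (n : ℕ) : Function.Injective (fiberPoint c n) :=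
  fun a b h => by
    have h' := hasValue_fiberPoint c n b
    rw [← h] at h'
    exact (hasValue_fiberPoint c n a).unique (isLocalAlgebra_fiberPoint c n a) h'

theorem fiberPoint_ne_fiberPoint {c d : ℕ → ℂ} (hcd : c 0 ≠ d 0) {n m : ℕ} (hn : 0 < n) (hm : 0 < m)
    (a b : ℂ) : fiberPoint c n a ≠ fiberPoint d m b := fun h => by
  have h' : HasValue (fiberPoint d m b) (chain c 0) (d 0) := hasValue_chain_zero_fiberPoint d hm b
  rw [← h] at h'
  exact hcd ((hasValue_chain_zero_fiberPoint c hn a).unique (isLocalAlgebra_fiberPoint c n a) h')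

/-- Every entry in the list of points other than the affine plane and the two last exceptional
curves without their corners is on a boundary curve, which is named in each case. -/
theorem exists_chartPoint_eq {R : Subring K} (hR : R ∈ surface q t)
    (hb : ∀ i, ¬ R ≤ boundaryCurve q t i) : ∃ i a b, R = chartPoint q t i a b := by
  rcases surface_cases q t hR with ⟨a, b, rfl⟩ | ⟨b, rfl⟩ | rfl | ⟨n, a, hn, -, -, rfl⟩ |
    ⟨n, a, h0, hn, -, rfl⟩ | ⟨n, hn, rfl⟩ | ⟨n, hn, rfl⟩
  · exact ⟨0, a, b, rfl⟩
  · refine absurd ?_ (hb 8)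
    rw [boundaryCurve_eight]
    exact sectionPoint_le b
  · refine absurd ?_ (hb 8)
    rw [boundaryCurve_eight]
    exact (areAxesAt_sectionCorner 0).symm.isAxisAt.le
  · rcases Nat.lt_or_ge n 6 with h6 | h6
    · refine absurd ?_ (hb ⟨5 - n, by omega⟩)
      rw [boundaryCurve_of_le_five q t (by simp), show 5 - (5 - n) = n by omega]
      exact fiberPoint_le _ _ _
    · obtain rfl : n = 6 := le_antisymm hn h6
      exact ⟨2, a, 0, (chartPoint_two_zero q t a).symm⟩
  · rcases Nat.lt_or_ge n 3 with h3 | h3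
    · refine absurd ?_ (hb ⟨5 + n, by omega⟩)
      rw [boundaryCurve_of_five_le q t (by simp) (by simp; omega),
        show 5 + n - 5 = n by omega]
      exact fiberPoint_le _ _ _
    · obtain rfl : n = 3 := le_antisymm hn h3
      exact ⟨1, a, 0, (chartPoint_one_zero q t a).symm⟩
  · refine absurd ?_ (hb ⟨5 - n, by omega⟩)
    rw [boundaryCurve_of_le_five q t (by simp), show 5 - (5 - n) = n by omega]
    exact (areAxesAt_corner _ n).isAxisAt.le
  · refine absurd ?_ (hb ⟨5 + n, by omega⟩)
    rw [boundaryCurve_of_five_le q t (by simp) (by simp; omega), show 5 + n - 5 = n by omega]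
    exact (areAxesAt_corner _ n).isAxisAt.le

end Charts

/-! ### The bijection with the phase space. -/

section PhaseSpace

variable (B : Set ℂ) (q : ℂ → ℂ)

/-- The point of the phase space corresponding to a point of the glued space. -/
noncomputable def toPhaseSpace : GluedSpace B q → PhaseSpace B q :=
  Quot.lift (fun p => ⟨(p.2.2.2, chartPoint q p.2.2.2 p.1 p.2.1 p.2.2.1),
    chartPoint_mem q p.2.2.2 p.1 p.2.1 p.2.2.1⟩) (by
    rintro ⟨i, a, b, t⟩ ⟨k, a', b', t'⟩ ⟨h, x, y, hy, h1, h2⟩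
    simp only at h h1 h2
    subst h
    obtain rfl := congrArg Prod.fst h1
    obtain rfl := congrArg Prod.snd h1
    obtain rfl := congrArg Prod.fst h2
    obtain rfl := congrArg Prod.snd h2
    refine Subtype.ext ?_
    simp only [chartPoint_chartMap q t _ x hy])

variable {B q}

theorem toPhaseSpace_chartIncl (i : Fin 3) (a b : ℂ) (t : B) :
    (toPhaseSpace B q (chartIncl B q i (a, b, t))).1 = (t, chartPoint q t i a b) := rfl

/-- These three classes go to the affine plane, to B₃ and to A₆ respectively, which are disjoint;
injectivity can thus be checked class by class. -/
theorem gluedSpace_cases (z : GluedSpace B q) :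
    (∃ a b t, z = chartIncl B q 0 (a, b, t)) ∨ (∃ a t, z = chartIncl B q 1 (a, 0, t)) ∨
      ∃ a t, z = chartIncl B q 2 (a, 0, t) := by
  induction z using Quot.inductionOn with | _ p
  obtain ⟨i, a, b, t⟩ := p
  change (∃ a' b' t', chartIncl B q i (a, b, t) = _) ∨ (∃ a' t', chartIncl B q i (a, b, t) = _) ∨
    ∃ a' t', chartIncl B q i (a, b, t) = _
  by_cases hb : b = 0
  · subst hb
    fin_cases i
    · exact Or.inl ⟨_, _, _, rfl⟩
    · exact Or.inr (Or.inl ⟨_, _, rfl⟩)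
    · exact Or.inr (Or.inr ⟨_, _, rfl⟩)
  · exact Or.inl ⟨_, _, _, chartIncl_transition i 0 a hb t⟩

theorem toPhaseSpace_injective : Function.Injective (toPhaseSpace B q) := by
  intro z w h
  have h' := congrArg Subtype.val h
  rcases gluedSpace_cases z with ⟨a, b, t, rfl⟩ | ⟨a, t, rfl⟩ | ⟨a, t, rfl⟩ <;>
  rcases gluedSpace_cases w with ⟨a', b', t', rfl⟩ | ⟨a', t', rfl⟩ | ⟨a', t', rfl⟩ <;>
  rw [toPhaseSpace_chartIncl, toPhaseSpace_chartIncl] at h' <;>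
  obtain ⟨rfl, h'⟩ := Prod.mk.inj h' <;>
  try simp only [chartPoint_one_zero, chartPoint_two_zero] at h'
  · obtain ⟨rfl, rfl⟩ := plane_injective h'
    rfl
  · exact absurd h' (plane_ne_fiberPoint _ _ _ _ _)
  · exact absurd h' (plane_ne_fiberPoint _ _ _ _ _)
  · exact absurd h'.symm (plane_ne_fiberPoint _ _ _ _ _)
  · rw [fiberPoint_injective _ _ h']
  · exact absurd h'.symm (fiberPoint_ne_fiberPoint (seqA_zero_ne_seqB_zero _) (by norm_num)
      (by norm_num) _ _)
  · exact absurd h'.symm (plane_ne_fiberPoint _ _ _ _ _)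
  · exact absurd h' (fiberPoint_ne_fiberPoint (seqA_zero_ne_seqB_zero _) (by norm_num)
      (by norm_num) _ _)
  · rw [fiberPoint_injective _ _ h']

theorem toPhaseSpace_surjective : Function.Surjective (toPhaseSpace B q) := by
  rintro ⟨⟨t, R⟩, hR, hb⟩
  obtain ⟨i, a, b, h⟩ := exists_chartPoint_eq q t hR hb
  exact ⟨chartIncl B q i (a, b, t), Subtype.ext (Prod.ext rfl h.symm)⟩

end PhaseSpace

end InceXXVI

/-! ### Polynomials with holomorphic coefficients. -/

open MvPolynomial in
-- Multiplying by b and letting b tend to 0 leaves only c, by continuity of polynomials.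
theorem MvPolynomial.eq_zero_of_eval_eq_add_div {P Q : MvPolynomial (Fin 2) ℂ} {a c : ℂ}
    (h : ∀ b : ℂ, b ≠ 0 → eval ![a, b] P = eval ![a, b] Q + c / b) : c = 0 := by
  have hv : Continuous fun b : ℂ => ![a, b] := by
    refine continuous_pi fun i => ?_
    fin_cases i <;> simp <;> fun_prop
  have hc : Continuous fun b : ℂ => b * (eval ![a, b] P - eval ![a, b] Q) :=
    continuous_id.mul (((MvPolynomial.continuous_eval P).comp hv).sub
      ((MvPolynomial.continuous_eval Q).comp hv))
  have h1 : Filter.Tendsto (fun b : ℂ => b * (eval ![a, b] P - eval ![a, b] Q))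
      (nhdsWithin 0 {0}ᶜ) (nhds 0) := by
    have := (hc.tendsto 0).mono_left (nhdsWithin_le_nhds (s := {0}ᶜ))
    rwa [zero_mul] at this
  have h2 : Filter.Tendsto (fun b : ℂ => b * (eval ![a, b] P - eval ![a, b] Q))
      (nhdsWithin 0 {0}ᶜ) (nhds c) := by
    refine tendsto_const_nhds.congr' ?_
    filter_upwards [self_mem_nhdsWithin] with b hb
    rw [h b hb, add_sub_cancel_left, mul_div_cancel₀ _ hb]
  exact tendsto_nhds_unique h2 h1

namespace InceXXVI

section Holomorphic

variable {B : Set ℂ}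

/-- The ring of the functions that are holomorphic on `B`. -/
def holomorphicOn (B : Set ℂ) : Subring (ℂ → ℂ) where
  carrier := {f | AnalyticOnNhd ℂ f B}
  mul_mem' h h' := h.mul h'
  one_mem' := analyticOnNhd_const
  add_mem' h h' := h.add h'
  zero_mem' := analyticOnNhd_const
  neg_mem' h := h.neg

/-- A constant function on `B`. -/
def constOn (B : Set ℂ) (c : ℂ) : holomorphicOn B := ⟨fun _ => c, analyticOnNhd_const⟩

/-- The `k`-th derivative of `q`, as a holomorphic function on `B`. -/
noncomputable def jetOn (hB : IsOpen B) {q : ℂ → ℂ} (hq : DifferentiableOn ℂ q B) (k : ℕ) :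
    holomorphicOn B := ⟨fun t => jet q t k, fun _ ht => analyticAt_jet hB hq k ht⟩

/-- The value of a polynomial with holomorphic coefficients. -/
noncomputable def evalAt (B : Set ℂ) (a b t : ℂ) : MvPolynomial (Fin 2) (holomorphicOn B) →+* ℂ :=
  (MvPolynomial.eval ![a, b]).comp ((MvPolynomial.map (Pi.evalRingHom (fun _ : ℂ => ℂ) t)).comp
    (MvPolynomial.map (holomorphicOn B).subtype))

variable (a b t : ℂ)

theorem evalAt_X_zero : evalAt B a b t (MvPolynomial.X 0) = a := by simp [evalAt]

theorem evalAt_X_one : evalAt B a b t (MvPolynomial.X 1) = b := by simp [evalAt]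

theorem evalAt_constOn (c : ℂ) : evalAt B a b t (MvPolynomial.C (constOn B c)) = c := by
  simp [evalAt, constOn]

theorem evalAt_jetOn (hB : IsOpen B) {q : ℂ → ℂ} (hq : DifferentiableOn ℂ q B) (k : ℕ) :
    evalAt B a b t (MvPolynomial.C (jetOn hB hq k)) = jet q t k := by
  simp [evalAt, jetOn]

theorem isPolynomialInChart_of_evalAt {q : ℂ → ℂ} {i : Fin 3}
    (P Q : MvPolynomial (Fin 2) (holomorphicOn B))
    (h : ∀ x y t : ℂ, y ≠ 0 → t ∈ B →
      fderiv ℂ (chartMapTime q i) (x, y, t) (systemField q (x, y, t)) =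
        (evalAt B (chartMapTime q i (x, y, t)).1 (chartMapTime q i (x, y, t)).2 t P,
          evalAt B (chartMapTime q i (x, y, t)).1 (chartMapTime q i (x, y, t)).2 t Q)) :
    IsPolynomialInChart B q i := by
  refine ⟨MvPolynomial.map (holomorphicOn B).subtype P,
    MvPolynomial.map (holomorphicOn B).subtype Q, fun m => ?_, h⟩
  rw [MvPolynomial.coeff_map, MvPolynomial.coeff_map]
  exact ⟨(P.coeff m).2, (Q.coeff m).2⟩

end Holomorphic

/-! ### The system in the three charts and the condition on q. -/

section System

variable {B : Set ℂ} (hB : IsOpen B) {q : ℂ → ℂ} (hq : DifferentiableOn ℂ q B)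

theorem jet_zero (q : ℂ → ℂ) (t : ℂ) : jet q t 0 = q t := congrFun iteratedDeriv_zero t

theorem jet_one (q : ℂ → ℂ) (t : ℂ) : jet q t 1 = deriv q t := congrFun iteratedDeriv_one t

include hB hq

theorem hasDerivAt_jet {t : ℂ} (ht : t ∈ B) (k : ℕ) :
    HasDerivAt (fun t => jet q t k) (jet q t (k + 1)) t := by
  have := (analyticAt_jet hB hq k ht).differentiableAt.hasDerivAt
  unfold jet at this ⊢
  rwa [iteratedDeriv_succ]

/-- The total derivative along the vector field is the derivative along the straight line through
the point with that direction, so one-variable calculus suffices. -/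
theorem fderiv_chartMapTime (i : Fin 3) (x : ℂ) {y t : ℂ} (hy : y ≠ 0) (ht : t ∈ B) {v w : ℂ}
    {D : ℂ × ℂ}
    (hD : HasDerivAt (fun s => chartMap (jet q (t + s)) i (x + s * v) (y + s * w)) D 0) :
    fderiv ℂ (chartMapTime q i) (x, y, t) (v, w, 1) = D := by
  have h2 : AnalyticAt ℂ (fun z : ℂ × ℂ × ℂ => z.2.1) (x, y, t) :=
    AnalyticAt.comp (g := Prod.fst) analyticAt_fst analyticAt_snd
  have h3 : AnalyticAt ℂ (fun z : ℂ × ℂ × ℂ => z.2.2) (x, y, t) :=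
    AnalyticAt.comp (g := Prod.snd) analyticAt_snd analyticAt_snd
  have hF : HasFDerivAt (chartMapTime q i) (fderiv ℂ (chartMapTime q i) (x, y, t)) (x, y, t) :=
    (analyticAt_chartMap hB hq (f := fun z : ℂ × ℂ × ℂ => z.1) analyticAt_fst h2 h3 hy ht
      i).differentiableAt.hasFDerivAt
  have hline : ∀ c d : ℂ, HasDerivAt (fun s => c + s * d) d 0 := fun c d => by
    simpa using ((hasDerivAt_id (0 : ℂ)).mul_const d).const_add c
  have hc : HasDerivAt (fun s : ℂ => (x + s * v, y + s * w, t + s * 1)) (v, w, 1) 0 :=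
    (hline x v).prodMk ((hline y w).prodMk (hline t 1))
  have h0 : (x + 0 * v, y + 0 * w, t + 0 * 1) = (x, y, t) := by simp
  rw [← h0] at hF
  have := hF.comp_hasDerivAt (0 : ℂ) hc
  rw [h0] at this
  refine this.unique ?_
  simpa only [mul_one] using! hD

section Derivatives

variable {t : ℂ} (ht : t ∈ B) (x y v w : ℂ)

include ht

theorem hasDerivAt_jet_add (k : ℕ) :
    HasDerivAt (fun s => jet q (t + s) k) (jet q t (k + 1)) 0 := by
  have := hasDerivAt_jet hB hq ht k
  rw [← add_zero t] at this
  simpa using this.comp_const_add t 0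

omit hB hq ht in
theorem hasDerivAt_line (c d : ℂ) : HasDerivAt (fun s => c + s * d) d 0 := by
  simpa using ((hasDerivAt_id (0 : ℂ)).mul_const d).const_add c

omit hB hq ht in
theorem hasDerivAt_inv_line (hy : y ≠ 0) :
    HasDerivAt (fun s => 1 / (y + s * w)) (-w / y ^ 2) 0 := by
  have := (hasDerivAt_line y w).fun_inv (by simpa using hy)
  simpa using this

theorem hasDerivAt_chartMap_one :
    HasDerivAt (fun s => (x + s * v - (y + s * w) ^ 2 / 4 + 12 * jet q (t + s) 0) * (y + s * w))
      ((v - y * w / 2 + 12 * jet q t 1) * y + (x - y ^ 2 / 4 + 12 * jet q t 0) * w) 0 := by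
  have hx := hasDerivAt_line x v
  have hy := hasDerivAt_line y w
  have h0 := hasDerivAt_jet_add hB hq ht 0
  refine (((hx.sub ((hy.pow 2).div_const 4)).add (h0.const_mul 12)).mul hy).congr_deriv ?_
  simp only [Pi.add_apply, Pi.sub_apply, Pi.pow_apply, zero_mul, add_zero, zero_add]
  ring

theorem hasDerivAt_chartMap_two :
    HasDerivAt (fun s => ((((x + s * v) * (y + s * w) - 16 * jet q (t + s) 1) * (y + s * w) -
        32 * jet q (t + s) 2) * (y + s * w) + 768 * jet q (t + s) 0 * jet q (t + s) 1 -
        128 * jet q (t + s) 3) * (y + s * w))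
      (((((v * y + x * w - 16 * jet q t 2) * y + (x * y - 16 * jet q t 1) * w -
        32 * jet q t 3) * y + ((x * y - 16 * jet q t 1) * y - 32 * jet q t 2) * w +
        768 * (jet q t 1 ^ 2 + jet q t 0 * jet q t 2) - 128 * jet q t 4) * y) +
        (((x * y - 16 * jet q t 1) * y - 32 * jet q t 2) * y + 768 * jet q t 0 * jet q t 1 -
          128 * jet q t 3) * w) 0 := by
  have hx := hasDerivAt_line x v
  have hy := hasDerivAt_line y w
  have h0 := hasDerivAt_jet_add hB hq ht 0
  have h1 := hasDerivAt_jet_add hB hq ht 1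
  have h2 := hasDerivAt_jet_add hB hq ht 2
  have h3 := hasDerivAt_jet_add hB hq ht 3
  refine (((((((((hx.mul hy).sub (h1.const_mul 16)).mul hy).sub (h2.const_mul 32)).mul hy).add
    ((h0.const_mul 768).mul h1)).sub (h3.const_mul 128)).mul hy)).congr_deriv ?_
  simp only [Pi.add_apply, Pi.sub_apply, Pi.mul_apply, zero_mul, add_zero, zero_add]
  ring

end Derivatives

open MvPolynomial (X C)

theorem isPolynomialInChart_zero : IsPolynomialInChart B q 0 := by
  refine isPolynomialInChart_of_evalAt (X 0 * X 1 - 12 * C (jetOn hB hq 1))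
    (C (constOn B (-(1 / 4))) * X 1 ^ 2 + 3 * X 0 + 12 * C (jetOn hB hq 0)) fun x y t hy ht => ?_
  refine fderiv_chartMapTime hB hq 0 x hy ht ?_
  simp only [map_sub, map_add, map_mul, map_pow, map_ofNat, evalAt_X_zero, evalAt_X_one,
    evalAt_constOn, evalAt_jetOn, jet_zero, jet_one]
  exact (hasDerivAt_line x _).prodMk (hasDerivAt_line y _)

theorem isPolynomialInChart_one : IsPolynomialInChart B q 1 := by
  refine isPolynomialInChart_of_evalAt
    (3 * X 0 ^ 2 * X 1 ^ 2 - 24 * C (jetOn hB hq 0) * X 0 * X 1)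
    (C (constOn B (-(1 / 2))) - 3 * X 0 * X 1 ^ 3 + 24 * C (jetOn hB hq 0) * X 1 ^ 2)
    fun x y t hy ht => ?_
  refine fderiv_chartMapTime hB hq 1 x hy ht
    (((hasDerivAt_chartMap_one hB hq ht x y _ _).prodMk
      (hasDerivAt_inv_line y _ hy)).congr_deriv ?_)
  simp only [map_sub, map_add, map_mul, map_pow, map_ofNat, evalAt_X_zero, evalAt_X_one,
    evalAt_constOn, evalAt_jetOn, ← jet_zero q, ← jet_one q, chartMapTime, chartMap,
    Matrix.cons_val_one, Matrix.cons_val_zero, Prod.mk.injEq]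
  constructor <;> field_simp <;> ring

/-- The polynomial part of `x₂'`. -/
noncomputable def chartTwoPoly : MvPolynomial (Fin 2) (holomorphicOn B) :=
  let w5 := 128 * C (jetOn hB hq 3) - 768 * C (jetOn hB hq 0) * C (jetOn hB hq 1) + X 1 * X 0
  let w4 := 32 * C (jetOn hB hq 2) + X 1 * w5
  let w3 := 16 * C (jetOn hB hq 1) + X 1 * w4
  24 * C (jetOn hB hq 0) * w5 + 96 * C (jetOn hB hq 1) * w4 + 3 * X 1 * w4 ^ 2 + 3 * w3 * w4 +
    w5 * (12 * C (jetOn hB hq 0) + 3 * X 1 * w3) +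
    X 0 * (12 * C (jetOn hB hq 0) * X 1 + 3 * X 1 ^ 2 * w3)

/-- The polynomial `y₂'`. -/
noncomputable def chartTwoPolySnd : MvPolynomial (Fin 2) (holomorphicOn B) :=
  C (constOn B (1 / 4)) - 12 * C (jetOn hB hq 0) * X 1 ^ 2 - 3 * X 1 ^ 3 *
    (16 * C (jetOn hB hq 1) + X 1 * (32 * C (jetOn hB hq 2) + X 1 * (128 * C (jetOn hB hq 3) -
      768 * C (jetOn hB hq 0) * C (jetOn hB hq 1) + X 1 * X 0)))

/-- In `chartTwoPoly` the abbreviations w3, w4, w5 are the functions w₃ = xy, w₄, w₅ of the first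
branch, expressed by x₂ and y₂ through w_n = c_n + y₂ w_{n+1}. The constants c_n are chosen so that
only a simple pole in y₂ can remain. -/
theorem fderiv_chartMapTime_two (x : ℂ) {y t : ℂ} (hy : y ≠ 0) (ht : t ∈ B) :
    fderiv ℂ (chartMapTime q 2) (x, y, t) (systemField q (x, y, t)) =
      (evalAt B (chartMapTime q 2 (x, y, t)).1 (chartMapTime q 2 (x, y, t)).2 t
          (chartTwoPoly hB hq) +
        -128 * (jet q t 4 - 12 * jet q t 1 ^ 2 - 12 * jet q t 0 * jet q t 2) /
          (chartMapTime q 2 (x, y, t)).2,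
        evalAt B (chartMapTime q 2 (x, y, t)).1 (chartMapTime q 2 (x, y, t)).2 t
          (chartTwoPolySnd hB hq)) := by
  refine fderiv_chartMapTime hB hq 2 x hy ht
    (((hasDerivAt_chartMap_two hB hq ht x y _ _).prodMk
      (hasDerivAt_inv_line y _ hy)).congr_deriv ?_)
  simp only [chartTwoPoly, chartTwoPolySnd, map_sub, map_add, map_mul, map_pow, map_ofNat,
    evalAt_X_zero, evalAt_X_one, evalAt_constOn, evalAt_jetOn, ← jet_zero q, ← jet_one q, chartMapTime,
    chartMap, Matrix.cons_val, Prod.mk.injEq]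
  constructor <;> field_simp <;> ring

theorem isPolynomialInChart_two_iff : IsPolynomialInChart B q 2 ↔
    ∀ t ∈ B, jet q t 4 - 12 * jet q t 1 ^ 2 - 12 * jet q t 0 * jet q t 2 = 0 := by
  constructor
  · rintro ⟨P, Q, -, h⟩ t ht
    have key : -128 * (jet q t 4 - 12 * jet q t 1 ^ 2 - 12 * jet q t 0 * jet q t 2) = 0 := by
      -- It is enough to compare along the line x₂ = 0, all of whose points with y₂ ≠ 0 come from
      -- points (x, y).
      refine MvPolynomial.eq_zero_of_eval_eq_add_div (a := 0)
        (P := MvPolynomial.map (Pi.evalRingHom (fun _ : ℂ => ℂ) t) P)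
        (Q := MvPolynomial.map (Pi.evalRingHom (fun _ : ℂ => ℂ) t)
          (MvPolynomial.map (holomorphicOn B).subtype (chartTwoPoly hB hq))) fun b hb => ?_
      have hy := chartInv_snd_ne_zero (jet q t) 2 0 hb
      have h1 := h (chartInv (jet q t) 2 0 b).1 _ t hy ht
      have h2 : chartMapTime q 2 ((chartInv (jet q t) 2 0 b).1, (chartInv (jet q t) 2 0 b).2, t) =
        (0, b) := chartMap_chartInv (jet q t) 2 0 hb
      rw [fderiv_chartMapTime_two hB hq _ hy ht, h2] at h1
      exact (congrArg Prod.fst h1).symm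
    simpa using key
  · intro h
    refine isPolynomialInChart_of_evalAt (chartTwoPoly hB hq) (chartTwoPolySnd hB hq)
      fun x y t hy ht => ?_
    rw [fderiv_chartMapTime_two hB hq x hy ht, h t ht, mul_zero, zero_div, add_zero]

theorem hasDerivAt_jet_two_sub {t : ℂ} (ht : t ∈ B) :
    HasDerivAt (fun t => jet q t 2 - 6 * jet q t 0 ^ 2)
      (jet q t 3 - 12 * jet q t 0 * jet q t 1) t := by
  refine ((hasDerivAt_jet hB hq ht 2).sub
    (((hasDerivAt_jet hB hq ht 0).pow 2).const_mul 6)).congr_deriv ?_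
  simp
  ring

theorem hasDerivAt_jet_three_sub {t : ℂ} (ht : t ∈ B) :
    HasDerivAt (fun t => jet q t 3 - 12 * jet q t 0 * jet q t 1)
      (jet q t 4 - 12 * jet q t 1 ^ 2 - 12 * jet q t 0 * jet q t 2) t := by
  refine ((hasDerivAt_jet hB hq ht 3).sub
    (((hasDerivAt_jet hB hq ht 0).const_mul 12).mul (hasDerivAt_jet hB hq ht 1))).congr_deriv ?_
  ring

/-- The expression is the second derivative of q'' - 6q². Connectedness of B permits integrating
twice, and openness permits differentiating the resulting identity twice. -/
theorem jet_four_eq_iff (hBc : IsConnected B) :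
    (∀ t ∈ B, jet q t 4 - 12 * jet q t 1 ^ 2 - 12 * jet q t 0 * jet q t 2 = 0) ↔
      ∃ C₁ C₂ : ℂ, ∀ t ∈ B, jet q t 2 = 6 * jet q t 0 ^ 2 + C₁ * t + C₂ := by
  constructor
  · intro h
    obtain ⟨C₁, h1⟩ := hB.exists_is_const_of_deriv_eq_zero hBc.isPreconnected
      (fun t ht => (hasDerivAt_jet_three_sub hB hq ht).differentiableAt.differentiableWithinAt)
      (fun t ht => ((hasDerivAt_jet_three_sub hB hq ht).deriv.trans (h t ht)))
    have hd : ∀ t ∈ B, HasDerivAt (fun t => jet q t 2 - 6 * jet q t 0 ^ 2 - C₁ * t) 0 t :=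
      fun t ht => by
        have := (hasDerivAt_jet_two_sub hB hq ht).sub ((hasDerivAt_id t).const_mul C₁)
        rwa [h1 t ht, mul_one, sub_self] at this
    obtain ⟨C₂, h2⟩ := hB.exists_is_const_of_deriv_eq_zero hBc.isPreconnected
      (fun t ht => (hd t ht).differentiableAt.differentiableWithinAt) (fun t ht => (hd t ht).deriv)
    exact ⟨C₁, C₂, fun t ht => by linear_combination h2 t ht⟩
  · rintro ⟨C₁, C₂, h⟩
    have h1 : ∀ t ∈ B, jet q t 3 - 12 * jet q t 0 * jet q t 1 = C₁ := fun t ht => by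
      refine (hasDerivAt_jet_two_sub hB hq ht).unique ?_
      have hl : HasDerivAt (fun t => C₁ * t + C₂) C₁ t := by
        simpa using ((hasDerivAt_id t).const_mul C₁).add_const C₂
      refine hl.congr_of_eventuallyEq ?_
      filter_upwards [hB.mem_nhds ht] with s hs
      rw [h s hs]
      ring
    intro t ht
    refine (hasDerivAt_jet_three_sub hB hq ht).unique
      ((hasDerivAt_const t C₁).congr_of_eventuallyEq ?_)
    filter_upwards [hB.mem_nhds ht] with s hs
    exact h1 s hs

end System

end InceXXVI

theorem mainTheorem2 (B : Set ℂ) (hB : IsOpen B) (hBc : IsConnected B)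
    (q : ℂ → ℂ) (hq : DifferentiableOn ℂ q B) :
    -- the ten blow-ups and the surface of type `E₈⁽¹⁾`
    (∀ t ∈ B,
      (∀ k : Fin 10, InceXXVI.pointRing (InceXXVI.center q t k).1 (InceXXVI.center q t k).2 0 0 ∈
        InceXXVI.stage q t k) ∧
      InceXXVI.IsE8AffineConfiguration (InceXXVI.surface q t) (InceXXVI.boundaryCurve q t)) ∧
    -- the phase space is glued from three charts
    (InceXXVI.IsManifoldGluing B q ∧
      ∃ Φ : InceXXVI.GluedSpace B q ≃ InceXXVI.PhaseSpace B q, ∀ (j : Fin 3) (a b : ℂ) (t : B),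
        (Φ (InceXXVI.chartIncl B q j (a, b, t))).1 =
          (t, InceXXVI.pointRing (InceXXVI.chartFunctions q t j).1
            (InceXXVI.chartFunctions q t j).2 a b)) ∧
    -- the transformed systems
    (InceXXVI.IsPolynomialInChart B q 0 ∧ InceXXVI.IsPolynomialInChart B q 1 ∧
      (InceXXVI.IsPolynomialInChart B q 2 ↔
        ∃ C₁ C₂ : ℂ, ∀ t ∈ B, iteratedDeriv 2 q t = 6 * q t ^ 2 + C₁ * t + C₂)) := by
  refine ⟨fun t _ => ⟨InceXXVI.pointRing_center_mem_stage q t, InceXXVI.isE8AffineConfiguration q t⟩,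
    ⟨InceXXVI.isManifoldGluing hB hq, Equiv.ofBijective _
      ⟨InceXXVI.toPhaseSpace_injective, InceXXVI.toPhaseSpace_surjective⟩,
      InceXXVI.toPhaseSpace_chartIncl⟩,
    InceXXVI.isPolynomialInChart_zero hB hq, InceXXVI.isPolynomialInChart_one hB hq,
    (InceXXVI.isPolynomialInChart_two_iff hB hq).trans
      ((InceXXVI.jet_four_eq_iff hB hq hBc).trans ?_)⟩
  simp only [InceXXVI.jet, iteratedDeriv_zero]
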